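/- Let $X_1,X_2,\dots$ be i.i.d. real random variables with distribution function $F$, let $0<\alpha<\beta<1$, and let $\xi_\nu=\inf\{x:F(x)\ge\nu\}$ for $\nu=\alpha,\beta$. Suppose that in neighborhoods of $\xi_\alpha$ and $\xi_\beta$ the derivative $f=F'$ exists and satisfies a Lipschitz condition, and that $f(\xi_\alpha)>0$ and $f(\xi_\beta)>0$. For a sample $x_1,\dots,x_N$ with order statistics $x_{1:N}\le\dots\le x_{N:N}$ let $$t_N(x_1,\dots,x_N)=N^{-1/2}\sum_{i=[\alpha N]+1}^{[\beta N]}x_{i:N}$$ be its (normalized) trimmed mean, where $[\cdot]$ is the integer part. For i.i.d. random variables $Y_1,Y_2,\dots$ such that $T_N=t_N(Y_1,\dots,Y_N)$ is square integrable, let $$T_{N\Omega_k}=\sum_{B\subseteq\{1,\dots,k\}}(-1)^{k-|B|}\,E\bigl(T_N\mid Y_i,\ i\in B\bigr)\qquad(1\le k\le N)$$ be the components of its Hoeffding decomposition, and put $\Sigma_N(Y)=\sum_{k=3}^N\binom{N-2}{k-2}E\,T_{N\Omega_k}^2$. (i) (No moment assumptions.) For every $\Delta>0$, with $Y_i=X'_i=\max(\xi_\alpha-\Delta,\min(X_i,\xi_\beta+\Delta))$,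 $$\Sigma_N(Y)=N^{-3}\left(\frac{\alpha^2(1-\alpha)^2}{f^2(\xi_\alpha)}+\frac{\beta^2(1-\beta)^2}{f^2(\xi_\beta)}\right)+o(N^{-3})\qquad(N\to\infty).$$ (ii) If $E\,t_N(X_1,\dots,X_N)^2<\infty$ for all sufficiently large $N$, the same relation holds with $Y_i=X_i$. Consequently, in both cases $\Sigma_N(Y)$ is not $O(N^{-7/2})$, the order required by the second part of condition (1.18) in the theorem of Putter and van Zwet on Edgeworth expansions for Studentized symmetric statistics. That condition therefore fails for the trimmed mean. -/

import Mathlib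

open MeasureTheory ProbabilityTheory Filter Asymptotics

noncomputable section

/-- The left-continuous inverse `F⁻¹(u) = inf {x : F x ≥ u}` (used for `0 < u < 1`). -/
def quantile (F : ℝ → ℝ) (u : ℝ) : ℝ := sInf {x : ℝ | u ≤ F x}

/-- `f = F'` exists in a neighborhood of `ξ`, is Lipschitz there, and `f ξ > 0`. -/
def HasPosLipschitzDensityNear (F f : ℝ → ℝ) (ξ : ℝ) : Prop :=
  0 < f ξ ∧ ∃ ε > 0, ∃ K : NNReal,
    (∀ x ∈ Metric.ball ξ ε, HasDerivAt F (f x) x) ∧ LipschitzOnWith K f (Metric.ball ξ ε)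

/-- The order statistics `x_{1:N} ≤ ⋯ ≤ x_{N:N}` of a sample of size `N`, in increasing order.
Indices start at zero: `orderStat x i` is `x_{i+1:N}`. -/
def orderStat {N : ℕ} (x : Fin N → ℝ) (i : Fin N) : ℝ := x (Tuple.sort x i)

/-- The trimmed mean in the normalization `N^{-1/2} ∑_{i=k}^{m} x_{i:N}`,
with `k = [αN] + 1` and `m = [βN]`. -/
def trimmedMean (α β : ℝ) (N : ℕ) (x : Fin N → ℝ) : ℝ :=
  (Real.sqrt N)⁻¹ *
    ∑ i : Fin N with ⌊α * N⌋₊ + 1 ≤ i.val + 1 ∧ i.val + 1 ≤ ⌊β * N⌋₊, orderStat x i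

variable {Ω : Type*} [MeasurableSpace Ω]

/-- The trimmed mean of the first `N` observations, as a random variable. -/
def trimmedMeanRV (X : ℕ → Ω → ℝ) (α β : ℝ) (N : ℕ) : Ω → ℝ :=
  fun ω => trimmedMean α β N (fun i => X i ω)

/-- The σ-algebra generated by the observations with index in `B`. -/
@[reducible] def sigmaOf (X : ℕ → Ω → ℝ) (B : Finset ℕ) : MeasurableSpace Ω :=
  ⨆ i ∈ B, MeasurableSpace.comap (X i) inferInstance

/-- The component with index set `A` in the Hoeffding decomposition of `T`:
`T_A = ∑_{B ⊆ A} (-1)^{|A| - |B|} E(T | X_i, i ∈ B)`. -/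
def hoeffdingComponent (P : Measure Ω) (X : ℕ → Ω → ℝ) (T : Ω → ℝ) (A : Finset ℕ) : Ω → ℝ :=
  fun ω => ∑ B ∈ A.powerset, (-1 : ℝ) ^ (A.card - B.card) * (P[T | sigmaOf X B]) ω

/-- `∑_{k=3}^{N} C(N-2, k-2) E T²_{N,Ω_k}` for the trimmed mean, where `Ω_k` consists of the
indices of the first `k` observations (here `0, …, k - 1`). -/
def higherOrderSum (P : Measure Ω) (X : ℕ → Ω → ℝ) (α β : ℝ) (N : ℕ) : ℝ :=
  ∑ k ∈ Finset.Icc 3 N, ((N - 2).choose (k - 2) : ℝ) *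
    ∫ ω, (hoeffdingComponent P X (trimmedMeanRV X α β N) (Finset.range k) ω) ^ 2 ∂P

/-- The observations `X'_i = max (a, min (X_i, b))`. -/
def clipped (X : ℕ → Ω → ℝ) (a b : ℝ) : ℕ → Ω → ℝ := fun i ω => max a (min (X i ω) b)

end

/-!
Write `T` for the trimmed mean of a sample of size `N = n + 2` and `g(S) = E T T'`, where `T'` is
computed from a second sample which shares with the first one the observations with index in `S`
and is independent of it otherwise (`pairMoment`). The product of two conditional expectations of
`T` has expectation `E[E(T | B) E(T | C)] = g(B ∩ C)` (`integral_condExp_mul_condExp`), so that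
the second moment of a Hoeffding component is an alternating sum of values of `g`. By symmetry
`g(S)` depends on the cardinality of `S` only, and Newton's forward difference formula turns the
weighted sum over `k ≥ 3` into the second difference of `g` at cardinality `n` minus the one at
cardinality `0` (`higherOrderSum_eq`).

Each second difference of `g` is a quarter of the expectation of a product of two second
differences of `T` in two decoupled observations (`secondDiff_pairMoment`). In terms of the
counting function of the sample, the second difference of `T` is an integral over the levels `s`
such that exactly `⌊βN⌋ - 1` of the other observations are `≤ s`, minus the same with `α`
(`secondDiff_trimmedMean`). Taking expectations with Fubini's theorem gives an exact formula
(`higherOrderSum_eq_kernelIntegral`): `N` times the sum is a signed sum, over the pairs of trimming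
points, of `∫∫ (min (F s) (F t) - F s F t)² L(F s, F t) ds dt`, where `L` is the difference of two
kernels: the probability of having `p` observations below `s` and `q` below `t` in one and the same
sample of size `n`, and the same for two independent samples.

These kernels concentrate at the trimming probabilities (`concentratesAt_sqrt_binomProb`), while
near the quantiles the substitution `u = F s` has Jacobian `f`. Hence each integral is asymptotic to
the total mass of its kernel on the unit square times the value of the remaining factor at the
quantiles (`tendsto_integral_covSq_mul_kernel`). The masses are beta integrals. They are
`1 / (n + 1)²` for independent samples, and for a common sample `1 / ((n + 1) (n + 2))` for `p ≠ q`
but twice this for `p = q` (`integral_jointProb`). To leading order the mixed terms cancel, and one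
copy of `θ² (1 - θ)² / f²` survives for each of the trimming points `θ = α, β`.

Integrability far from the quantiles follows from the square integrability of `T` for a single
sample size, which gives `F s (1 - F s)` polynomial decay (`integrable_cdf_mul_pow`). Clipping the
observations makes `T` bounded and changes neither the quantiles nor `F` near them, so the
asymptotics of the clipped sample are a special case.
-/

noncomputable section

/-! ### The trimmed mean and its second differences -/

open Finset in
/-- The number of indices `i ∈ R` with `x i ≤ t`. -/
def countLE {ι : Type*} (R : Finset ι) (x : ι → ℝ) (t : ℝ) : ℕ := #{i ∈ R | x i ≤ t}

/-- The indicator of `x i ≤ t` for exactly `j` of the indices `i ∈ R`. -/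
def levelInd {ι : Type*} (R : Finset ι) (j : ℕ) (x : ι → ℝ) (t : ℝ) : ℝ :=
  if countLE R x t = j then 1 else 0

/-- The difference `1{a ≤ t} - 1{b ≤ t}`. -/
def jump (a b t : ℝ) : ℝ := (if a ≤ t then 1 else 0) - (if b ≤ t then 1 else 0)

theorem orderStat_le_iff {N : ℕ} (x : Fin N → ℝ) (i : Fin N) (t : ℝ) :
    orderStat x i ≤ t ↔ i.val < countLE Finset.univ x t := by
  have h := Tuple.lt_card_le_iff_apply_le_of_monotone (j := i) (a := t) (Tuple.monotone_sort x)
  unfold orderStat countLE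
  rw [← Function.comp_apply (f := x), ← h]
  have : (Finset.univ.filter fun i => (x ∘ Tuple.sort x) i ≤ t).card
      = (Finset.univ.filter fun i => x i ≤ t).card :=
    Finset.card_equiv (Tuple.sort x) (by simp)
  rw [this]

theorem trimmedMean_comp_perm {N : ℕ} (α β : ℝ) (x : Fin N → ℝ) (σ : Equiv.Perm (Fin N)) :
    trimmedMean α β N (x ∘ σ) = trimmedMean α β N x := by
  unfold trimmedMean
  congr 1
  refine Finset.sum_congr rfl fun i _ => ?_
  exact congrFun (Tuple.comp_perm_comp_sort_eq_comp_sort (f := x) (σ := σ)) i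

theorem measurable_countLE {ι : Type*} (R : Finset ι) :
    Measurable fun p : (ι → ℝ) × ℝ => countLE R p.1 p.2 := by
  have : (fun p : (ι → ℝ) × ℝ => countLE R p.1 p.2)
      = fun p => ∑ i ∈ R, if p.1 i ≤ p.2 then 1 else 0 := by
    funext p
    simp only [countLE, Finset.card_filter]
  rw [this]
  refine Finset.measurable_sum _ fun i _ => ?_
  exact Measurable.ite (measurableSet_le (by fun_prop) (by fun_prop)) measurable_const
    measurable_const

theorem measurable_levelInd {ι : Type*} (R : Finset ι) (j : ℕ) :
    Measurable fun p : (ι → ℝ) × ℝ => levelInd R j p.1 p.2 :=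
  Measurable.ite (measurable_countLE R (measurableSet_singleton j)) measurable_const
    measurable_const

theorem measurable_jump : Measurable fun p : (ℝ × ℝ) × ℝ => jump p.1.1 p.1.2 p.2 := by
  unfold jump
  exact (Measurable.ite (measurableSet_le (by fun_prop) (by fun_prop)) measurable_const
    measurable_const).sub (Measurable.ite (measurableSet_le (by fun_prop) (by fun_prop))
      measurable_const measurable_const)

theorem abs_jump_le (a b t : ℝ) : |jump a b t| ≤ 1 := by
  unfold jump; split_ifs <;> simp

theorem levelInd_nonneg {ι : Type*} (R : Finset ι) (j : ℕ) (x : ι → ℝ) (t : ℝ) :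
    0 ≤ levelInd R j x t := by
  unfold levelInd; split_ifs <;> simp

theorem levelInd_le_one {ι : Type*} (R : Finset ι) (j : ℕ) (x : ι → ℝ) (t : ℝ) :
    levelInd R j x t ≤ 1 := by
  unfold levelInd; split_ifs <;> simp

theorem measurable_trimmedMean (α β : ℝ) (N : ℕ) : Measurable (trimmedMean α β N) := by
  unfold trimmedMean
  refine measurable_const.mul (Finset.measurable_sum _ fun i _ => ?_)
  refine measurable_of_Iic fun t => ?_
  have : (fun x : Fin N → ℝ => orderStat x i) ⁻¹' Set.Iic t
      = (fun x => countLE Finset.univ x t) ⁻¹' Set.Ioi i.val := by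
    ext x; simp [orderStat_le_iff]
  rw [this]
  exact ((measurable_countLE Finset.univ).comp
    (by fun_prop : Measurable fun x : Fin N → ℝ => (x, t)))
    measurableSet_Ioi

/-- Layer-cake form of the trimmed mean: it depends on the sample only through the counting
function, since `x_{i+1:N} ≤ t` exactly when more than `i` observations are `≤ t`. -/
theorem trimmedMean_eq_integral (α β : ℝ) {N : ℕ} (x : Fin N → ℝ) {M : ℝ} (hM : ∀ i, |x i| ≤ M)
    (hβ : ⌊β * N⌋₊ ≤ N) :
    trimmedMean α β N x = (Real.sqrt N)⁻¹ * ∑ i : Fin N with ⌊α * N⌋₊ + 1 ≤ i.val + 1 ∧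
        i.val + 1 ≤ ⌊β * N⌋₊, M
      - (Real.sqrt N)⁻¹ * ∫ t in Set.Icc (-M) M,
          ((min ⌊β * N⌋₊ (countLE Finset.univ x t) - ⌊α * N⌋₊ : ℕ) : ℝ) := by
  have hint : ∀ i : Fin N, IntegrableOn (fun t => if orderStat x i ≤ t then (1 : ℝ) else 0)
      (Set.Icc (-M) M) := by
    intro i
    refine Measure.integrableOn_of_bounded (M := 1) (by simp) ?_ ?_
    · exact (Measurable.ite measurableSet_Ici measurable_const
        measurable_const).aestronglyMeasurable
    · exact ae_of_all _ fun t => by split_ifs <;> simp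
  have h1 : ∀ i : Fin N, orderStat x i
      = M - ∫ t in Set.Icc (-M) M, if orderStat x i ≤ t then (1 : ℝ) else 0 := by
    intro i
    have hb := abs_le.1 (hM (Tuple.sort x i))
    change -M ≤ orderStat x i ∧ orderStat x i ≤ M at hb
    have : (fun t => if orderStat x i ≤ t then (1 : ℝ) else 0)
        = (Set.Ici (orderStat x i)).indicator 1 := by
      funext t; simp [Set.indicator_apply]
    rw [this, integral_indicator_one measurableSet_Ici,
      measureReal_restrict_apply measurableSet_Ici]
    have : Set.Ici (orderStat x i) ∩ Set.Icc (-M) M = Set.Icc (orderStat x i) M := by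
      ext t; simp only [Set.mem_inter_iff, Set.mem_Ici, Set.mem_Icc]
      constructor
      · tauto
      · intro h; exact ⟨h.1, hb.1.trans h.1, h.2⟩
    rw [this, Real.volume_real_Icc_of_le hb.2]
    ring
  have h2 : ∀ t, ∑ i : Fin N with ⌊α * N⌋₊ + 1 ≤ i.val + 1 ∧ i.val + 1 ≤ ⌊β * N⌋₊,
      (if orderStat x i ≤ t then (1 : ℝ) else 0)
        = ((min ⌊β * N⌋₊ (countLE Finset.univ x t) - ⌊α * N⌋₊ : ℕ) : ℝ) := by
    intro t
    rw [Finset.sum_boole, Finset.filter_filter]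
    congr 1
    rw [← Nat.card_Ico]
    refine Finset.card_bij (fun i _ => i.val) ?_ ?_ ?_
    · intro i hi
      simp only [Finset.mem_filter, Finset.mem_univ, true_and, orderStat_le_iff] at hi
      simp only [Finset.mem_Ico, lt_min_iff]
      omega
    · intro i _ j _ h; exact Fin.ext h
    · intro k hk
      simp only [Finset.mem_Ico, lt_min_iff] at hk
      refine ⟨⟨k, by omega⟩, ?_, rfl⟩
      simp only [Finset.mem_filter, Finset.mem_univ, true_and, orderStat_le_iff]
      omega
  unfold trimmedMean
  rw [← mul_sub]
  congr 1
  rw [Finset.sum_congr rfl fun i _ => h1 i, Finset.sum_sub_distrib]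
  congr 1
  rw [← integral_finsetSum _ fun i _ => hint i]
  exact integral_congr_ae (ae_of_all _ h2)

theorem countLE_update_update {N : ℕ} {i j : Fin N} (hij : i ≠ j) (x : Fin N → ℝ) (a b s : ℝ) :
    countLE Finset.univ (Function.update (Function.update x i a) j b) s
      = countLE (Finset.univ \ {i, j}) x s + (if a ≤ s then 1 else 0)
        + (if b ≤ s then 1 else 0) := by
  simp only [countLE, Finset.card_filter]
  rw [← Finset.sum_sdiff (Finset.subset_univ {i, j}), Finset.sum_pair hij, add_assoc]
  congr 1
  · refine Finset.sum_congr rfl fun k hk => ?_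
    simp only [Finset.mem_sdiff, Finset.mem_univ, true_and, Finset.mem_insert,
      Finset.mem_singleton, not_or] at hk
    simp [Function.update_of_ne hk.1, Function.update_of_ne hk.2]
  · simp [Function.update_of_ne hij]

theorem integral_sub_sub_add {E : Type*} [MeasurableSpace E] {μ : Measure E} {g₁ g₂ g₃ g₄ : E → ℝ}
    (h₁ : Integrable g₁ μ) (h₂ : Integrable g₂ μ) (h₃ : Integrable g₃ μ) (h₄ : Integrable g₄ μ) :
    ∫ x, (g₁ x - g₂ x - g₃ x + g₄ x) ∂μ
      = (∫ x, g₁ x ∂μ) - (∫ x, g₂ x ∂μ) - (∫ x, g₃ x ∂μ) + ∫ x, g₄ x ∂μ := by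
  change ∫ x, (g₁ - g₂ - g₃ + g₄) x ∂μ = _
  rw [integral_add' ((h₁.sub h₂).sub h₃) h₄, integral_sub' (h₁.sub h₂) h₃, integral_sub' h₁ h₂]

/-- The second difference of a function along the coordinates `i` and `j`. -/
def secondDiff {N : ℕ} (t : (Fin N → ℝ) → ℝ) (i j : Fin N) (x : Fin N → ℝ) (a a' b b' : ℝ) : ℝ :=
  t (Function.update (Function.update x i a) j b)
    - t (Function.update (Function.update x i a') j b)
    - t (Function.update (Function.update x i a) j b')
    + t (Function.update (Function.update x i a') j b')

/-- The second difference of the trimmed mean in two observations: only the two spacings next to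
the trimming points enter, namely the sets of `s` such that exactly `[βN] - 1`, respectively
`[αN] - 1`, of the remaining observations are `≤ s`. -/
theorem secondDiff_trimmedMean {α β : ℝ} {N : ℕ} (hα : 1 ≤ ⌊α * N⌋₊)
    (hαβ : ⌊α * N⌋₊ ≤ ⌊β * N⌋₊) (hβ : ⌊β * N⌋₊ ≤ N) {i j : Fin N} (hij : i ≠ j)
    (x : Fin N → ℝ) (a a' b b' : ℝ) :
    secondDiff (trimmedMean α β N) i j x a a' b b' = (Real.sqrt N)⁻¹ *
      ((∫ s, jump a a' s * jump b b' s * levelInd (Finset.univ \ {i, j}) (⌊β * N⌋₊ - 1) x s)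
        - ∫ s, jump a a' s * jump b b' s * levelInd (Finset.univ \ {i, j}) (⌊α * N⌋₊ - 1) x s) := by
  -- All the samples involved lie in `[-M, M]`, and the integrands vanish outside.
  set M : ℝ := (∑ k, |x k|) + |a| + |a'| + |b| + |b'| with hMdef
  have hx : ∀ k, |x k| ≤ ∑ k, |x k| := fun k =>
    Finset.single_le_sum (f := fun k => |x k|) (fun _ _ => abs_nonneg _) (Finset.mem_univ k)
  have hs0 : 0 ≤ ∑ k, |x k| := Finset.sum_nonneg fun _ _ => abs_nonneg _
  have hbd : ∀ u v : ℝ, |u| ≤ |a| + |a'| → |v| ≤ |b| + |b'| → ∀ k,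
      |Function.update (Function.update x i u) j v k| ≤ M := by
    intro u v hu hv k
    have := abs_nonneg a; have := abs_nonneg a'; have := abs_nonneg b; have := abs_nonneg b'
    have := hx k
    rcases eq_or_ne k j with rfl | hk
    · simp only [Function.update_self]; linarith
    · rw [Function.update_of_ne hk]
      rcases eq_or_ne k i with rfl | hk
      · simp only [Function.update_self]; linarith
      · rw [Function.update_of_ne hk]; linarith
  have ha := abs_nonneg a; have ha' := abs_nonneg a'
  have hb := abs_nonneg b; have hb' := abs_nonneg b'
  have hI : ∀ y : Fin N → ℝ, IntegrableOn (fun t =>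
      ((min ⌊β * N⌋₊ (countLE Finset.univ y t) - ⌊α * N⌋₊ : ℕ) : ℝ)) (Set.Icc (-M) M) := by
    intro y
    refine Measure.integrableOn_of_bounded (M := ⌊β * N⌋₊) (by simp) ?_ ?_
    · refine Measurable.aestronglyMeasurable ?_
      have h1 : Measurable fun t => countLE Finset.univ y t :=
        (measurable_countLE Finset.univ).comp (by fun_prop : Measurable fun t : ℝ => (y, t))
      exact (measurable_from_nat (f := fun c : ℕ => ((min ⌊β * N⌋₊ c - ⌊α * N⌋₊ : ℕ) : ℝ))).comp h1
    · refine ae_of_all _ fun t => ?_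
      simp only [Real.norm_natCast, Nat.cast_le]
      exact (Nat.sub_le _ _).trans (min_le_left _ _)
  have hJ : ∀ l, IntegrableOn (fun s => jump a a' s * jump b b' s *
      levelInd (Finset.univ \ {i, j}) l x s) (Set.Icc (-M) M) := by
    intro l
    refine Measure.integrableOn_of_bounded (M := 1) (by simp) ?_ ?_
    · refine Measurable.aestronglyMeasurable ?_
      refine Measurable.mul (Measurable.mul ?_ ?_) ?_
      · exact measurable_jump.comp (by fun_prop : Measurable fun s : ℝ => ((a, a'), s))
      · exact measurable_jump.comp (by fun_prop : Measurable fun s : ℝ => ((b, b'), s))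
      · exact (measurable_levelInd _ _).comp (by fun_prop : Measurable fun s : ℝ => (x, s))
    · refine ae_of_all _ fun s => ?_
      rw [norm_mul, norm_mul, Real.norm_eq_abs, Real.norm_eq_abs, Real.norm_eq_abs,
        abs_of_nonneg (levelInd_nonneg _ _ _ _)]
      have := levelInd_le_one (Finset.univ \ {i, j}) l x s
      have := levelInd_nonneg (Finset.univ \ {i, j}) l x s
      have h1 := abs_jump_le a a' s; have h2 := abs_jump_le b b' s
      have := abs_nonneg (jump a a' s); have := abs_nonneg (jump b b' s)
      have := mul_le_one₀ h1 (abs_nonneg (jump b b' s)) h2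
      exact mul_le_one₀ this (levelInd_nonneg _ _ _ _) (levelInd_le_one _ _ _ _)
  have hR : ∀ l, ∫ s, jump a a' s * jump b b' s * levelInd (Finset.univ \ {i, j}) l x s
      = ∫ s in Set.Icc (-M) M, jump a a' s * jump b b' s *
        levelInd (Finset.univ \ {i, j}) l x s := by
    intro l
    refine (setIntegral_eq_integral_of_forall_compl_eq_zero fun s hs => ?_).symm
    have : jump a a' s = 0 := by
      simp only [Set.mem_Icc, not_and_or, not_le] at hs
      unfold jump
      have h1 := neg_abs_le a; have h2 := le_abs_self a
      have h3 := neg_abs_le a'; have h4 := le_abs_self a'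
      rcases hs with h | h
      · rw [if_neg (by linarith), if_neg (by linarith)]; simp
      · rw [if_pos (by linarith), if_pos (by linarith)]; simp
    simp [this]
  unfold secondDiff
  rw [trimmedMean_eq_integral α β _ (hbd a b (by linarith) (by linarith)) hβ,
    trimmedMean_eq_integral α β _ (hbd a' b (by linarith) (by linarith)) hβ,
    trimmedMean_eq_integral α β _ (hbd a b' (by linarith) (by linarith)) hβ,
    trimmedMean_eq_integral α β _ (hbd a' b' (by linarith) (by linarith)) hβ, hR, hR,
    ← integral_sub (hJ _) (hJ _)]
  have key : (fun s => jump a a' s * jump b b' s *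
          levelInd (Finset.univ \ {i, j}) (⌊β * N⌋₊ - 1) x s -
        jump a a' s * jump b b' s * levelInd (Finset.univ \ {i, j}) (⌊α * N⌋₊ - 1) x s)
      = fun s =>
      -(((min ⌊β * N⌋₊ (countLE Finset.univ (Function.update (Function.update x i a) j b) s)
          - ⌊α * N⌋₊ : ℕ) : ℝ)
        - ((min ⌊β * N⌋₊ (countLE Finset.univ (Function.update (Function.update x i a') j b) s)
          - ⌊α * N⌋₊ : ℕ) : ℝ)
        - ((min ⌊β * N⌋₊ (countLE Finset.univ (Function.update (Function.update x i a) j b') s)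
          - ⌊α * N⌋₊ : ℕ) : ℝ)
        + ((min ⌊β * N⌋₊ (countLE Finset.univ (Function.update (Function.update x i a') j b') s)
          - ⌊α * N⌋₊ : ℕ) : ℝ)) := by
    funext s
    simp only [countLE_update_update hij, levelInd, jump]
    generalize countLE (Finset.univ \ {i, j}) x s = c
    generalize ⌊β * N⌋₊ = m at *
    generalize ⌊α * N⌋₊ = k at *
    -- The truncated difference `c ↦ min m c - k` has second difference
    -- `1{c = k - 1} - 1{c = m - 1}`.
    have hφ : (((min m (c + 1 + 1) - k : ℕ) : ℝ) - ((min m (c + 1) - k : ℕ) : ℝ)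
        - ((min m (c + 1) - k : ℕ) : ℝ) + ((min m c - k : ℕ) : ℝ))
        = (if c = k - 1 then 1 else 0) - (if c = m - 1 then 1 else 0) := by
      have : (((min m (c + 1 + 1) - k : ℕ) : ℤ) - ((min m (c + 1) - k : ℕ) : ℤ)
        - ((min m (c + 1) - k : ℕ) : ℤ) + ((min m c - k : ℕ) : ℤ))
        = (if c = k - 1 then 1 else 0) - (if c = m - 1 then 1 else 0) := by
        split_ifs <;> omega
      exact_mod_cast this
    by_cases h1 : a ≤ s <;> by_cases h2 : a' ≤ s <;> by_cases h3 : b ≤ s <;>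
      by_cases h4 : b' ≤ s <;>
      simp only [h1, h2, h3, h4, if_true, if_false, add_zero] <;> linarith
  rw [key, integral_neg, integral_sub_sub_add (hI _) (hI _) (hI _) (hI _)]
  ring

/-! ### Pairs of samples with common observations -/

theorem integral_comp_measurePreserving {E E' : Type*} [MeasurableSpace E] [MeasurableSpace E']
    {μ : Measure E} {ν : Measure E'} {f : E → E'} (hf : MeasurePreserving f μ ν) {g : E' → ℝ}
    (hg : AEStronglyMeasurable g ν) : ∫ x, g (f x) ∂μ = ∫ y, g y ∂ν := by
  rw [← hf.map_eq] at hg ⊢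
  exact (integral_map hf.measurable.aemeasurable hg).symm

/-- The law of `(ξ, ξ)` if `b` holds, and of a pair of independent variables otherwise, where the
marginals have law `μ`. -/
def pairLaw (μ : Measure ℝ) (b : Prop) [Decidable b] : Measure (ℝ × ℝ) :=
  if b then μ.map (fun x => (x, x)) else μ.prod μ

/-- The law of a pair of samples of size `N` which coincide at the positions in `S` and are
independent at the others. -/
def pairPi (μ : Measure ℝ) (N : ℕ) (S : Finset ℕ) : Measure (Fin N → ℝ × ℝ) :=
  Measure.pi fun i => pairLaw μ (i.val ∈ S)

/-- `E[t(ξ) t(ξ')]` for two samples that share the observations with index in `S` and are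
independent otherwise. It equals `E[E(t | ξ_i, i ∈ S)²]`. -/
def pairMoment (μ : Measure ℝ) {N : ℕ} (t : (Fin N → ℝ) → ℝ) (S : Finset ℕ) : ℝ :=
  ∫ z, t (fun i => (z i).1) * t (fun i => (z i).2) ∂pairPi μ N S

/-- The sample whose coordinates in `B` are those of `x` and whose other coordinates are those
of `y`. -/
def mix {N : ℕ} (B : Finset ℕ) (x y : Fin N → ℝ) : Fin N → ℝ :=
  fun i => if i.val ∈ B then x i else y i

section

variable {μ : Measure ℝ} [IsProbabilityMeasure μ] {N : ℕ}

instance (b : Prop) [Decidable b] : IsProbabilityMeasure (pairLaw μ b) := by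
  unfold pairLaw
  split_ifs
  · exact Measure.isProbabilityMeasure_map (by fun_prop)
  · infer_instance

instance (S : Finset ℕ) : IsProbabilityMeasure (pairPi μ N S) := by
  unfold pairPi; infer_instance

theorem measurePreserving_fst_pairLaw (b : Prop) [Decidable b] :
    MeasurePreserving Prod.fst (pairLaw μ b) μ := by
  refine ⟨measurable_fst, ?_⟩
  unfold pairLaw
  split_ifs
  · rw [Measure.map_map measurable_fst (by fun_prop)]
    exact Measure.map_id
  · exact measurePreserving_fst.map_eq

theorem measurePreserving_snd_pairLaw (b : Prop) [Decidable b] :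
    MeasurePreserving Prod.snd (pairLaw μ b) μ := by
  refine ⟨measurable_snd, ?_⟩
  unfold pairLaw
  split_ifs
  · rw [Measure.map_map measurable_snd (by fun_prop)]
    exact Measure.map_id
  · exact measurePreserving_snd.map_eq

theorem measurePreserving_fst_pairPi (S : Finset ℕ) :
    MeasurePreserving (fun (z : Fin N → ℝ × ℝ) i => (z i).1) (pairPi μ N S)
      (Measure.pi fun _ => μ) :=
  measurePreserving_pi _ _ fun _ => measurePreserving_fst_pairLaw _

theorem measurePreserving_snd_pairPi (S : Finset ℕ) :
    MeasurePreserving (fun (z : Fin N → ℝ × ℝ) i => (z i).2) (pairPi μ N S)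
      (Measure.pi fun _ => μ) :=
  measurePreserving_pi _ _ fun _ => measurePreserving_snd_pairLaw _

theorem integrable_pair {t : (Fin N → ℝ) → ℝ} (ht : MemLp t 2 (Measure.pi fun _ => μ))
    (S : Finset ℕ) :
    Integrable (fun z => t (fun i => (z i).1) * t (fun i => (z i).2)) (pairPi μ N S) :=
  (ht.comp_measurePreserving (measurePreserving_fst_pairPi S)).integrable_mul
    (ht.comp_measurePreserving (measurePreserving_snd_pairPi S))

/-- Two tuples of independent observations amount to one tuple of independent pairs. -/
theorem measurePreserving_zip {E E' : Type*} [MeasurableSpace E] [MeasurableSpace E']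
    (μ : Measure E) [SigmaFinite μ] (ν : Measure E') [SigmaFinite ν] :
    MeasurePreserving (fun (p : (Fin N → E) × (Fin N → E')) i => (p.1 i, p.2 i))
      ((Measure.pi fun _ => μ).prod (Measure.pi fun _ => ν)) (Measure.pi fun _ => μ.prod ν) :=
  (measurePreserving_arrowProdEquivProdArrow E E' (Fin N) (fun _ => μ) fun _ => ν).symm
    (MeasurableEquiv.arrowProdEquivProdArrow E E' (Fin N))

theorem measurePreserving_mix (B : Finset ℕ) :
    MeasurePreserving (fun p : (Fin N → ℝ) × (Fin N → ℝ) => mix B p.1 p.2)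
      ((Measure.pi fun _ => μ).prod (Measure.pi fun _ => μ)) (Measure.pi fun _ => μ) := by
  have h : MeasurePreserving (fun (a : Fin N → ℝ × ℝ) i => if i.val ∈ B then (a i).1 else (a i).2)
      (Measure.pi fun _ => μ.prod μ) (Measure.pi fun _ => μ) := by
    refine measurePreserving_pi (f := fun (i : Fin N) (q : ℝ × ℝ) => if i.val ∈ B then q.1 else q.2)
      _ _ fun i => ?_
    by_cases hi : i.val ∈ B
    · simpa only [hi, if_true] using measurePreserving_fst
    · simpa only [hi, if_false] using measurePreserving_snd
  exact h.comp (measurePreserving_zip μ μ)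

/-- Resampling the complements of `B` and `C` independently from a common sample produces a pair
of samples that share exactly the coordinates in `B ∩ C`. -/
theorem measurePreserving_mix_mix (B C : Finset ℕ) :
    MeasurePreserving
      (fun (p : (Fin N → ℝ) × ((Fin N → ℝ) × (Fin N → ℝ))) i =>
        (mix B p.1 p.2.1 i, mix C p.1 p.2.2 i))
      ((Measure.pi fun _ => μ).prod ((Measure.pi fun _ => μ).prod (Measure.pi fun _ => μ)))
      (pairPi μ N (B ∩ C)) := by
  have h : MeasurePreserving (fun (a : Fin N → ℝ × (ℝ × ℝ)) i =>
      ((if i.val ∈ B then (a i).1 else (a i).2.1), (if i.val ∈ C then (a i).1 else (a i).2.2)))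
      (Measure.pi fun _ => μ.prod (μ.prod μ)) (pairPi μ N (B ∩ C)) := by
    refine measurePreserving_pi (f := fun (i : Fin N) (q : ℝ × (ℝ × ℝ)) =>
      ((if i.val ∈ B then q.1 else q.2.1), (if i.val ∈ C then q.1 else q.2.2))) _ _ fun i => ?_
    by_cases hB : i.val ∈ B <;> by_cases hC : i.val ∈ C
    · simp only [hB, hC, if_true, pairLaw, Finset.mem_inter, and_self]
      refine MeasurePreserving.comp (g := fun x : ℝ => (x, x)) (f := Prod.fst)
        ⟨by fun_prop, rfl⟩ measurePreserving_fst
    · simp only [hB, hC, if_true, if_false, pairLaw, Finset.mem_inter, and_false]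
      exact (MeasurePreserving.id μ).prod measurePreserving_snd
    · simp only [hB, hC, if_true, if_false, pairLaw, Finset.mem_inter, false_and]
      exact (Measure.measurePreserving_swap (μ := μ) (ν := μ)).comp
        ((MeasurePreserving.id μ).prod measurePreserving_fst)
    · simp only [hB, hC, if_false, pairLaw, Finset.mem_inter, false_and]
      exact measurePreserving_snd
  exact h.comp ((measurePreserving_zip μ (μ.prod μ)).comp
    ((MeasurePreserving.id _).prod (measurePreserving_zip μ μ)))

end

theorem sigmaOf_eq_comap {Ω : Type*} (X : ℕ → Ω → ℝ) (B : Finset ℕ) :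
    sigmaOf X B = MeasurableSpace.comap (fun ω (i : B) => X i ω) inferInstance := by
  unfold sigmaOf
  simp only [MeasurableSpace.pi, MeasurableSpace.comap_iSup, MeasurableSpace.comap_comp]
  rw [iSup_subtype']
  rfl

section

variable {Ω : Type*} [MeasurableSpace Ω] {P : Measure Ω} [IsProbabilityMeasure P]
  {X : ℕ → Ω → ℝ} {μ : Measure ℝ} [IsProbabilityMeasure μ] {N : ℕ}

/-- Conditioning a function of independent observations on those with index in `B` amounts to
integrating out the others. -/
theorem condExp_sigmaOf
    (hX : MeasurePreserving (fun ω (i : Fin N) => X i ω) P (Measure.pi fun _ => μ))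
    (hmeas : ∀ i, Measurable (X i))
    {t : (Fin N → ℝ) → ℝ} (htm : Measurable t) (ht : Integrable t (Measure.pi fun _ => μ))
    {B : Finset ℕ} (hB : B ⊆ Finset.range N) :
    P[fun ω => t (fun i => X i ω) | sigmaOf X B]
      =ᵐ[P] fun ω => ∫ y, t (mix B (fun i => X i ω) y) ∂(Measure.pi fun _ => μ) := by
  set π : Measure (Fin N → ℝ) := Measure.pi fun _ => μ with hπ
  set U : Ω → (B → ℝ) := fun ω i => X i ω with hU
  have hUm : Measurable U := measurable_pi_iff.2 fun i => hmeas _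
  have hle : sigmaOf X B ≤ inferInstanceAs (MeasurableSpace Ω) := by
    rw [sigmaOf_eq_comap]; exact hUm.comap_le
  have hmix : MeasurePreserving (fun p : (Fin N → ℝ) × (Fin N → ℝ) => mix B p.1 p.2)
    (π.prod π) π := measurePreserving_mix B
  have hint : Integrable (fun p : (Fin N → ℝ) × (Fin N → ℝ) => t (mix B p.1 p.2)) (π.prod π) :=
    hmix.integrable_comp_of_integrable ht
  have hg : Integrable (fun x => ∫ y, t (mix B x y) ∂π) π := hint.integral_prod_left
  refine (ae_eq_condExp_of_forall_setIntegral_eq hle (hX.integrable_comp_of_integrable ht)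
    ?_ ?_ ?_).symm
  · intro s _ _
    exact (hX.integrable_comp_of_integrable hg).integrableOn
  · intro s hs _
    rw [sigmaOf_eq_comap] at hs
    obtain ⟨A, hA, rfl⟩ := hs
    set ρ : (Fin N → ℝ) → (B → ℝ) := fun x i => x ⟨i, Finset.mem_range.1 (hB i.2)⟩ with hρ
    have hρm : Measurable ρ := measurable_pi_iff.2 fun i => measurable_pi_apply _
    have hC : MeasurableSet (ρ ⁻¹' A) := hρm hA
    have hpre : (fun ω (i : B) => X i ω) ⁻¹' A = (fun ω (i : Fin N) => X i ω) ⁻¹' (ρ ⁻¹' A) := rfl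
    have h1 : ∀ g : (Fin N → ℝ) → ℝ, AEStronglyMeasurable g π →
        ∫ ω in (fun ω (i : B) => X i ω) ⁻¹' A, g (fun i : Fin N => X i ω) ∂P
          = ∫ x in ρ ⁻¹' A, g x ∂π := by
      intro g hgm
      rw [hpre, ← hX.map_eq, setIntegral_map hC (by rwa [hX.map_eq]) hX.measurable.aemeasurable]
    refine (h1 (fun x => ∫ y, t (mix B x y) ∂π) hg.aestronglyMeasurable).trans
      (Eq.trans ?_ (h1 t ht.aestronglyMeasurable).symm)
    rw [← integral_indicator hC, ← integral_indicator hC,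
      ← integral_comp_measurePreserving hmix (ht.indicator hC).aestronglyMeasurable]
    refine Eq.trans ?_ (integral_prod _
      (hmix.integrable_comp_of_integrable (ht.indicator hC))).symm
    refine integral_congr_ae (ae_of_all _ fun x => ?_)
    change _ = ∫ y, (ρ ⁻¹' A).indicator t (mix B x y) ∂π
    have hiff : ∀ y, mix B x y ∈ ρ ⁻¹' A ↔ x ∈ ρ ⁻¹' A := by
      intro y
      have : ρ (mix B x y) = ρ x := by
        funext i; simp [hρ, mix]
      simp [this]
    by_cases hx : x ∈ ρ ⁻¹' A
    · simp only [Set.indicator_of_mem hx]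
      refine integral_congr_ae (ae_of_all _ fun y => ?_)
      simp only [Set.indicator_of_mem ((hiff y).2 hx)]
    · simp only [Set.indicator_of_notMem hx]
      symm
      refine integral_eq_zero_of_ae (ae_of_all _ fun y => ?_)
      simp only [Set.indicator_of_notMem (fun h => hx ((hiff y).1 h)), Pi.zero_apply]
  · set ext : (B → ℝ) → (Fin N → ℝ) → (Fin N → ℝ) := fun u y i =>
      if h : i.val ∈ B then u ⟨i, h⟩ else y i with hext
    have hextm : Measurable fun p : (B → ℝ) × (Fin N → ℝ) => ext p.1 p.2 := by
      refine measurable_pi_iff.2 fun i => ?_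
      by_cases h : i.val ∈ B
      · simp only [hext, h, dite_true]; fun_prop
      · simp only [hext, h, dite_false]; fun_prop
    have hG : StronglyMeasurable fun u : B → ℝ => ∫ y, t (ext u y) ∂π :=
      StronglyMeasurable.integral_prod_right (f := fun u y => t (ext u y))
        (htm.comp hextm).stronglyMeasurable
    have : StronglyMeasurable[sigmaOf X B] fun ω => ∫ y, t (ext (U ω) y) ∂π := by
      rw [sigmaOf_eq_comap]
      exact hG.comp_measurable (comap_measurable U)
    exact this.aestronglyMeasurable

/-- The inner product of the conditional expectations given the observations in `B` and in `C`
depends on `B ∩ C` only: the observations outside `B`, respectively `C`, are integrated out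
independently of each other. -/
theorem integral_condExp_mul_condExp
    (hX : MeasurePreserving (fun ω (i : Fin N) => X i ω) P (Measure.pi fun _ => μ))
    (hmeas : ∀ i, Measurable (X i))
    {t : (Fin N → ℝ) → ℝ} (htm : Measurable t) (ht : MemLp t 2 (Measure.pi fun _ => μ))
    {B C : Finset ℕ} (hB : B ⊆ Finset.range N) (hC : C ⊆ Finset.range N) :
    ∫ ω, (P[fun ω => t (fun i => X i ω) | sigmaOf X B]) ω
      * (P[fun ω => t (fun i => X i ω) | sigmaOf X C]) ω ∂P = pairMoment μ t (B ∩ C) := by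
  have hti := ht.integrable one_le_two
  set π : Measure (Fin N → ℝ) := Measure.pi fun _ => μ with hπ
  have hmm := measurePreserving_mix_mix (μ := μ) (N := N) B C
  have hpair := integrable_pair ht (B ∩ C)
  have hI : ∀ B, Integrable (fun x => ∫ y, t (mix B x y) ∂π) π := fun B =>
    ((measurePreserving_mix B).integrable_comp_of_integrable hti).integral_prod_left
  have h1 : ∫ ω, (P[fun ω => t (fun i => X i ω) | sigmaOf X B]) ω
      * (P[fun ω => t (fun i => X i ω) | sigmaOf X C]) ω ∂P
      = ∫ ω, (fun x => (∫ y, t (mix B x y) ∂π) * ∫ y, t (mix C x y) ∂π) (fun i => X i ω) ∂P := by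
    refine integral_congr_ae ?_
    filter_upwards [condExp_sigmaOf hX hmeas htm hti hB, condExp_sigmaOf hX hmeas htm hti hC]
      with ω h1 h2
    rw [h1, h2]
  refine (h1.trans (integral_comp_measurePreserving hX
    ((hI B).aestronglyMeasurable.mul (hI C).aestronglyMeasurable))).trans ?_
  unfold pairMoment
  rw [← integral_comp_measurePreserving hmm hpair.aestronglyMeasurable]
  refine Eq.trans ?_ (integral_prod _ (hmm.integrable_comp_of_integrable hpair)).symm
  refine integral_congr_ae (ae_of_all _ fun x => ?_)
  exact (integral_prod_mul (fun y => t (mix B x y)) (fun y => t (mix C x y))).symm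

end

/-! ### Second moments of the Hoeffding components -/

/-- If `w (B ∩ C)` is the inner product of `g B` and `g C`, this is the squared norm of the
alternating sum of the `g B`. -/
theorem sum_powerset_sum_powerset_inter (A : Finset ℕ) (w : Finset ℕ → ℝ) :
    ∑ B ∈ A.powerset, ∑ C ∈ A.powerset,
      (-1 : ℝ) ^ (A.card - B.card) * (-1 : ℝ) ^ (A.card - C.card) * w (B ∩ C)
      = ∑ B ∈ A.powerset, (-1 : ℝ) ^ (A.card - B.card) * w B := by
  have hz : ∀ B ∈ A.powerset, B ≠ A → ∑ C ∈ A.powerset,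
      (-1 : ℝ) ^ (A.card - B.card) * (-1 : ℝ) ^ (A.card - C.card) * w (B ∩ C) = 0 := by
    intro B hB hBA
    obtain ⟨a, haA, haB⟩ : ∃ a ∈ A, a ∉ B := by
      by_contra! h
      exact hBA (Finset.Subset.antisymm (Finset.mem_powerset.1 hB) h)
    -- The terms of `C` and of the symmetric difference of `C` and `{a}` cancel.
    refine Finset.sum_involution (fun C _ => if a ∈ C then C.erase a else insert a C) ?_ ?_ ?_ ?_
    · intro C hC
      have hCA := Finset.mem_powerset.1 hC
      have hcard := Finset.card_le_card hCA
      by_cases ha : a ∈ C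
      · have h1 : B ∩ C.erase a = B ∩ C := by
          ext x; simp only [Finset.mem_inter, Finset.mem_erase]
          refine ⟨fun h => ⟨h.1, h.2.2⟩, fun h => ⟨h.1, ?_, h.2⟩⟩
          rintro rfl; exact haB h.1
        have h2 : A.card - (C.erase a).card = A.card - C.card + 1 := by
          have := Finset.card_erase_add_one ha; omega
        simp only [ha, if_true, h1, h2, pow_succ]; ring
      · have h1 : B ∩ insert a C = B ∩ C := by
          ext x; simp only [Finset.mem_inter, Finset.mem_insert]
          refine ⟨fun h => ⟨h.1, h.2.resolve_left ?_⟩, fun h => ⟨h.1, Or.inr h.2⟩⟩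
          rintro rfl; exact haB h.1
        have h2 : A.card - C.card = A.card - (insert a C).card + 1 := by
          have h3 := Finset.card_insert_of_notMem ha
          have := Finset.card_le_card (Finset.insert_subset haA hCA); omega
        simp only [ha, if_false, h1, h2, pow_succ]; ring
    · intro C _ _ h
      by_cases ha : a ∈ C
      · simp only [ha, if_true] at h
        exact Finset.erase_eq_self.1 h ha
      · simp only [ha, if_false] at h
        exact ha (Finset.insert_eq_self.1 h)
    · intro C hC
      have hCA := Finset.mem_powerset.1 hC
      by_cases ha : a ∈ C
      · simp only [ha, if_true]
        exact Finset.mem_powerset.2 ((Finset.erase_subset _ _).trans hCA)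
      · simp only [ha, if_false]
        exact Finset.mem_powerset.2 (Finset.insert_subset haA hCA)
    · intro C _
      by_cases ha : a ∈ C
      · simp [ha, Finset.insert_erase ha]
      · simp [ha, Finset.erase_insert ha]
  rw [Finset.sum_eq_single_of_mem A (Finset.mem_powerset_self A) hz]
  refine Finset.sum_congr rfl fun C hC => ?_
  simp [Finset.inter_eq_right.2 (Finset.mem_powerset.1 hC)]

/-- Gregory–Newton summation of all differences of order at least three. -/
theorem sum_choose_mul_sum_powerset (v : ℕ → ℝ) (n : ℕ) :
    ∑ k ∈ Finset.Icc 3 (n + 2), ((n + 2 - 2).choose (k - 2) : ℝ) *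
        ∑ B ∈ (Finset.range k).powerset, (-1 : ℝ) ^ ((Finset.range k).card - B.card) * v B.card
      = (v (n + 2) - 2 * v (n + 1) + v n) - (v 2 - 2 * v 1 + v 0) := by
  have hin : ∀ k, ∑ B ∈ (Finset.range k).powerset,
      (-1 : ℝ) ^ ((Finset.range k).card - B.card) * v B.card = (fwdDiff 1)^[k] v 0 := by
    intro k
    rw [fwdDiff_iter_eq_sum_shift,
      Finset.sum_powerset_apply_card (fun j => (-1 : ℝ) ^ ((Finset.range k).card - j) * v j)]
    simp only [Finset.card_range]
    refine Finset.sum_congr rfl fun j _ => ?_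
    simp [mul_comm, mul_left_comm]
  have h2 : ∀ y, (fwdDiff 1)^[2] v y = v (y + 2) - 2 * v (y + 1) + v y := by
    intro y; simp [fwdDiff]; ring
  have key : ∑ k ∈ Finset.range (n + 1), (n.choose k : ℝ) * (fwdDiff 1)^[k + 2] v 0
      = (fwdDiff 1)^[2] v n := by
    have := shift_eq_sum_fwdDiff_iter 1 ((fwdDiff 1)^[2] v) n 0
    simp only [smul_eq_mul, mul_one, zero_add, nsmul_eq_mul] at this
    rw [this]
    refine Finset.sum_congr rfl fun k _ => ?_
    rw [Function.iterate_add_apply]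
  have hshift : ∀ f : ℕ → ℝ, ∑ k ∈ Finset.Icc 3 (n + 2), f k = ∑ k ∈ Finset.range n, f (k + 3) := by
    intro f
    rw [Finset.range_eq_Ico, Finset.sum_Ico_add' f 0 n 3]
    rfl
  rw [← h2 n, ← key, ← h2 0, Finset.sum_range_succ', hshift]
  simp only [hin, Nat.add_sub_cancel]
  simp [add_assoc]

section

variable {μ : Measure ℝ} [IsProbabilityMeasure μ] {N : ℕ}

theorem pairMoment_eq_range {t : (Fin N → ℝ) → ℝ}
    (hsymm : ∀ (σ : Equiv.Perm (Fin N)) x, t (x ∘ σ) = t x) {B : Finset ℕ}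
    (hB : B ⊆ Finset.range N) :
    pairMoment μ t B = pairMoment μ t (Finset.range B.card) := by
  have hcard : Fintype.card {i : Fin N // i.val ∈ Finset.range B.card}
      = Fintype.card {i : Fin N // i.val ∈ B} := by
    have h : ∀ C ⊆ Finset.range N, Fintype.card {i : Fin N // i.val ∈ C} = C.card := by
      intro C hC
      rw [Fintype.card_subtype]
      refine Finset.card_bij (fun i _ => i.val) (by simp) (fun i _ j _ h => Fin.ext h) ?_
      intro k hk
      exact ⟨⟨k, Finset.mem_range.1 (hC hk)⟩, by simpa using hk, rfl⟩
    rw [h B hB, h _ (by simpa using Finset.card_le_card hB), Finset.card_range]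
  let e := Fintype.equivOfCardEq hcard
  let σ := e.extendSubtype
  have hσ : ∀ i : Fin N, (i.val ∈ Finset.range B.card) = ((σ i).val ∈ B) := fun i =>
    propext ⟨fun h => e.extendSubtype_mem i h, fun h => by
      by_contra hn; exact e.extendSubtype_not_mem i hn h⟩
  have hmp : MeasurePreserving (MeasurableEquiv.piCongrLeft (fun _ : Fin N => ℝ × ℝ) σ)
      (pairPi μ N (Finset.range B.card)) (pairPi μ N B) := by
    have := measurePreserving_piCongrLeft (fun i : Fin N => pairLaw μ (i.val ∈ B)) σ
    unfold pairPi
    convert this using 2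
    funext i
    simp only [pairLaw, hσ]
  have happ : ∀ z i, MeasurableEquiv.piCongrLeft (fun _ : Fin N => ℝ × ℝ) σ z i = z (σ.symm i) := by
    intro z i
    conv_lhs => rw [← σ.apply_symm_apply i]
    exact Equiv.piCongrLeft_apply_apply (fun _ : Fin N => ℝ × ℝ) σ z _
  unfold pairMoment
  rw [← hmp.integral_comp']
  refine integral_congr_ae (ae_of_all _ fun z => ?_)
  simp only [happ]
  congr 1
  · exact hsymm σ.symm fun i => (z i).1
  · exact hsymm σ.symm fun i => (z i).2

variable {Ω : Type*} [MeasurableSpace Ω] {P : Measure Ω} [IsProbabilityMeasure P] {X : ℕ → Ω → ℝ}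

theorem integral_hoeffdingComponent_sq
    (hX : MeasurePreserving (fun ω (i : Fin N) => X i ω) P (Measure.pi fun _ => μ))
    (hmeas : ∀ i, Measurable (X i))
    {t : (Fin N → ℝ) → ℝ} (htm : Measurable t) (ht : MemLp t 2 (Measure.pi fun _ => μ))
    {A : Finset ℕ} (hA : A ⊆ Finset.range N) :
    ∫ ω, (hoeffdingComponent P X (fun ω => t (fun i => X i ω)) A ω) ^ 2 ∂P
      = ∑ B ∈ A.powerset, (-1 : ℝ) ^ (A.card - B.card) * pairMoment μ t B := by
  have hT : MemLp (fun ω => t (fun i => X i ω)) 2 P := ht.comp_measurePreserving hX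
  have hL : ∀ B, MemLp (P[fun ω => t (fun i => X i ω) | sigmaOf X B]) 2 P := fun B =>
    hT.condExp one_le_two
  have hI : ∀ (b c : ℝ) (B C : Finset ℕ), Integrable (fun ω =>
      b * (P[fun ω => t (fun i => X i ω) | sigmaOf X B]) ω
        * (c * (P[fun ω => t (fun i => X i ω) | sigmaOf X C]) ω)) P := fun b c B C =>
    ((hL B).const_mul b).integrable_mul ((hL C).const_mul c)
  rw [← sum_powerset_sum_powerset_inter]
  unfold hoeffdingComponent
  simp only [sq, Finset.sum_mul_sum]
  rw [integral_finsetSum _ fun B _ => integrable_finsetSum _ fun C _ => hI _ _ B C]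
  refine Finset.sum_congr rfl fun B hB => ?_
  rw [integral_finsetSum _ fun C _ => hI _ _ B C]
  refine Finset.sum_congr rfl fun C hC => ?_
  rw [← integral_condExp_mul_condExp hX hmeas htm ht ((Finset.mem_powerset.1 hB).trans hA)
    ((Finset.mem_powerset.1 hC).trans hA), ← integral_const_mul]
  refine integral_congr_ae (ae_of_all _ fun ω => ?_)
  beta_reduce
  ring

/-- The sum over the components of order at least three is a second difference of the moments
`pairMoment`. -/
theorem higherOrderSum_eq {n : ℕ} {α β : ℝ}
    (hX : MeasurePreserving (fun ω (i : Fin (n + 2)) => X i ω) P (Measure.pi fun _ => μ))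
    (hmeas : ∀ i, Measurable (X i))
    (ht : MemLp (trimmedMean α β (n + 2)) 2 (Measure.pi fun _ => μ)) :
    higherOrderSum P X α β (n + 2) =
      (pairMoment μ (trimmedMean α β (n + 2)) (Finset.Ico 2 (n + 2) ∪ {0, 1})
        - pairMoment μ (trimmedMean α β (n + 2)) (Finset.Ico 2 (n + 2) ∪ {0})
        - pairMoment μ (trimmedMean α β (n + 2)) (Finset.Ico 2 (n + 2) ∪ {1})
        + pairMoment μ (trimmedMean α β (n + 2)) (Finset.Ico 2 (n + 2)))
      - (pairMoment μ (trimmedMean α β (n + 2)) (∅ ∪ {0, 1})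
        - pairMoment μ (trimmedMean α β (n + 2)) (∅ ∪ {0})
        - pairMoment μ (trimmedMean α β (n + 2)) (∅ ∪ {1})
        + pairMoment μ (trimmedMean α β (n + 2)) ∅) := by
  have htm := measurable_trimmedMean α β (n + 2)
  have hW : ∀ B ⊆ Finset.range (n + 2), ∀ k, B.card = k →
      pairMoment μ (trimmedMean α β (n + 2)) B
        = pairMoment μ (trimmedMean α β (n + 2)) (Finset.range k) := by
    rintro B hB k rfl
    exact pairMoment_eq_range (fun σ x => trimmedMean_comp_perm α β x σ) hB
  have h01 : Disjoint (Finset.Ico 2 (n + 2)) {0, 1} := by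
    rw [Finset.disjoint_right]; intro x; simp only [Finset.mem_insert, Finset.mem_singleton,
      Finset.mem_Ico]; omega
  have hd : ∀ x < 2, Disjoint (Finset.Ico 2 (n + 2)) {x} := by
    intro x hx; rw [Finset.disjoint_singleton_right, Finset.mem_Ico]; omega
  have hsub : ∀ B ⊆ Finset.Ico 2 (n + 2), ∀ C : Finset ℕ, (∀ x ∈ C, x < 2) →
      B ∪ C ⊆ Finset.range (n + 2) := by
    intro B hB C hC x hx
    rcases Finset.mem_union.1 hx with h | h
    · exact Finset.mem_range.2 (Finset.mem_Ico.1 (hB h)).2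
    · exact Finset.mem_range.2 ((hC x h).trans_le (by omega))
  rw [hW _ (hsub _ subset_rfl _ (by simp)) (n + 2)
      (by rw [Finset.card_union_of_disjoint h01]; simp),
    hW _ (hsub _ subset_rfl _ (by simp)) (n + 1)
      (by rw [Finset.card_union_of_disjoint (hd 0 (by simp))]; simp),
    hW _ (hsub _ subset_rfl _ (by simp)) (n + 1)
      (by rw [Finset.card_union_of_disjoint (hd 1 (by simp))]; simp),
    hW (Finset.Ico 2 (n + 2)) (by simpa using hsub _ subset_rfl ∅ (by simp)) n (by simp),
    hW _ (hsub _ (by simp) _ (by simp)) 2 (by simp),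
    hW _ (hsub _ (by simp) _ (by simp)) 1 (by simp),
    hW _ (hsub _ (by simp) _ (by simp)) 1 (by simp),
    hW ∅ (by simp) 0 (by simp)]
  have := sum_choose_mul_sum_powerset
    (fun k => pairMoment μ (trimmedMean α β (n + 2)) (Finset.range k)) n
  unfold higherOrderSum
  rw [show ∀ a b c d e : ℝ, (a - b - b + c) - (d - e - e + pairMoment μ (trimmedMean α β (n + 2))
      (Finset.range 0)) = (a - 2 * b + c) - (d - 2 * e + pairMoment μ (trimmedMean α β (n + 2))
      (Finset.range 0)) by intros; ring, ← this]
  refine Finset.sum_congr rfl fun k hk => ?_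
  congr 1
  have hk' : Finset.range k ⊆ Finset.range (n + 2) := by
    simpa using (Finset.mem_Icc.1 hk).2
  refine (integral_hoeffdingComponent_sq hX hmeas htm ht hk').trans ?_
  refine Finset.sum_congr rfl fun B hB => ?_
  rw [hW B ((Finset.mem_powerset.1 hB).trans hk') _ rfl]

end

/-! ### Decoupling of two observations -/

section

variable {μ : Measure ℝ} [IsProbabilityMeasure μ] {N : ℕ}

theorem measurePreserving_update_pairPi {S S' : Finset ℕ} {k : Fin N}
    (hS : ∀ i : Fin N, i ≠ k → (i.val ∈ S ↔ i.val ∈ S')) {φ : ℝ × ℝ → ℝ × ℝ}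
    (hφ : MeasurePreserving φ (pairLaw μ (k.val ∈ S)) (pairLaw μ (k.val ∈ S'))) :
    MeasurePreserving (fun z => Function.update z k (φ (z k))) (pairPi μ N S) (pairPi μ N S') := by
  have h : MeasurePreserving (fun (z : Fin N → ℝ × ℝ) i => (if i = k then φ else id) (z i))
      (pairPi μ N S) (pairPi μ N S') := by
    refine measurePreserving_pi (f := fun i => if i = k then φ else id) _ _ fun i => ?_
    by_cases hi : i = k
    · subst hi; simpa using hφ
    · simp only [hi, if_false, pairLaw, hS i hi]
      exact MeasurePreserving.id _
  convert h using 2 with z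
  funext i
  by_cases hi : i = k
  · subst hi; simp
  · simp [hi]

/-- The symmetrized effect of decoupling the two copies of the observation at position `k`. -/
def decouple (k : Fin N) (G : (Fin N → ℝ × ℝ) → ℝ) (z : Fin N → ℝ × ℝ) : ℝ :=
  G (Function.update z k ((z k).1, (z k).1)) - G (Function.update z k ((z k).1, (z k).2))
    - G (Function.update z k ((z k).2, (z k).1)) + G (Function.update z k ((z k).2, (z k).2))

theorem measurePreserving_update_diag {S : Finset ℕ} {k : Fin N} (hk : k.val ∉ S) {φ : ℝ × ℝ → ℝ}
    (hφ : MeasurePreserving φ (μ.prod μ) μ) :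
    MeasurePreserving (fun z => Function.update z k (φ (z k), φ (z k)))
      (pairPi μ N S) (pairPi μ N (S ∪ {k.val})) := by
  refine measurePreserving_update_pairPi (φ := fun p => (φ p, φ p)) ?_ ?_
  · intro i hi
    simp [Fin.val_inj, hi]
  · simp only [hk, pairLaw, Finset.mem_union, Finset.mem_singleton, or_true, if_true, if_false]
    exact MeasurePreserving.comp (g := fun x : ℝ => (x, x)) ⟨by fun_prop, rfl⟩ hφ

theorem measurePreserving_update_swap {S : Finset ℕ} {k : Fin N} (hk : k.val ∉ S) :
    MeasurePreserving (fun z => Function.update z k ((z k).2, (z k).1))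
      (pairPi μ N S) (pairPi μ N S) := by
  refine measurePreserving_update_pairPi (φ := fun p => (p.2, p.1)) (fun _ _ => Iff.rfl) ?_
  simp only [hk, pairLaw, if_false]
  exact Measure.measurePreserving_swap (μ := μ) (ν := μ)

theorem integrable_decouple {S : Finset ℕ} {k : Fin N} (hk : k.val ∉ S)
    {G : (Fin N → ℝ × ℝ) → ℝ} (hG : Integrable G (pairPi μ N S))
    (hG' : Integrable G (pairPi μ N (S ∪ {k.val}))) :
    Integrable (decouple k G) (pairPi μ N S) := by
  have h12 : Integrable (fun z => G (Function.update z k ((z k).1, (z k).2))) (pairPi μ N S) := by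
    simpa using hG
  exact ((((measurePreserving_update_diag hk measurePreserving_fst).integrable_comp_of_integrable
    hG').sub h12).sub ((measurePreserving_update_swap hk).integrable_comp_of_integrable hG)).add
    ((measurePreserving_update_diag hk measurePreserving_snd).integrable_comp_of_integrable hG')

/-- Passing from an independent to a common observation at position `k`, in symmetrized form:
for an independent copy `ξ'` of `ξ`, `E f(ξ) g(ξ) - E f(ξ) E g(ξ)` is half the expectation of
`(f(ξ) - f(ξ')) (g(ξ) - g(ξ'))`. -/
theorem integral_pairPi_union_sub {S : Finset ℕ} {k : Fin N} (hk : k.val ∉ S)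
    {G : (Fin N → ℝ × ℝ) → ℝ} (hG : Integrable G (pairPi μ N S))
    (hG' : Integrable G (pairPi μ N (S ∪ {k.val}))) :
    ∫ z, G z ∂pairPi μ N (S ∪ {k.val}) - ∫ z, G z ∂pairPi μ N S
      = 1 / 2 * ∫ z, decouple k G z ∂pairPi μ N S := by
  have h12 : Integrable (fun z => G (Function.update z k ((z k).1, (z k).2))) (pairPi μ N S) := by
    simpa using hG
  have h11 := measurePreserving_update_diag (μ := μ) hk measurePreserving_fst
  have h22 := measurePreserving_update_diag (μ := μ) hk measurePreserving_snd
  have h21 := measurePreserving_update_swap (μ := μ) hk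
  unfold decouple
  rw [integral_sub_sub_add
      (g₁ := fun z => G (Function.update z k ((z k).1, (z k).1)))
      (g₂ := fun z => G (Function.update z k ((z k).1, (z k).2)))
      (g₃ := fun z => G (Function.update z k ((z k).2, (z k).1)))
      (g₄ := fun z => G (Function.update z k ((z k).2, (z k).2)))
      (h11.integrable_comp_of_integrable hG') h12
      (h21.integrable_comp_of_integrable hG) (h22.integrable_comp_of_integrable hG'),
    integral_comp_measurePreserving h11 hG'.aestronglyMeasurable,
    integral_comp_measurePreserving h21 hG.aestronglyMeasurable,
    integral_comp_measurePreserving h22 hG'.aestronglyMeasurable]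
  simp only [Prod.mk.eta, Function.update_eq_self]
  ring

/-- The second difference of `pairMoment` in two shared observations, expressed through the second
difference of the statistic. -/
theorem secondDiff_pairMoment {t : (Fin N → ℝ) → ℝ} (ht : MemLp t 2 (Measure.pi fun _ => μ))
    {S : Finset ℕ} {i j : Fin N} (hij : i ≠ j) (hi : i.val ∉ S) (hj : j.val ∉ S) :
    pairMoment μ t (S ∪ {i.val, j.val}) - pairMoment μ t (S ∪ {i.val})
        - pairMoment μ t (S ∪ {j.val}) + pairMoment μ t S
      = 1 / 4 * ∫ z, secondDiff t i j (fun k => (z k).1) (z i).1 (z i).2 (z j).1 (z j).2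
          * secondDiff t i j (fun k => (z k).2) (z i).1 (z i).2 (z j).1 (z j).2
            ∂pairPi μ N S := by
  have hij' : i.val ≠ j.val := fun h => hij (Fin.ext h)
  have hji : j.val ∉ S ∪ {i.val} := by simp [hj, hij'.symm]
  have hI := integrable_pair ht
  have h1 := integral_pairPi_union_sub hji (hI _) (hI _)
  have h2 := integral_pairPi_union_sub hj (hI _) (hI _)
  have h3 := integral_pairPi_union_sub hi (integrable_decouple hj (hI _) (hI _))
    (integrable_decouple hji (hI _) (hI _))
  rw [Finset.union_assoc] at h1
  change pairMoment μ t (S ∪ {i.val, j.val}) - pairMoment μ t (S ∪ {i.val}) = _ at h1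
  change pairMoment μ t (S ∪ {j.val}) - pairMoment μ t S = _ at h2
  have hfst : ∀ (z : Fin N → ℝ × ℝ) (k : Fin N) (a b : ℝ),
      (fun l => (Function.update z k (a, b) l).1) = Function.update (fun l => (z l).1) k a := by
    intro z k a b; funext l
    rcases eq_or_ne l k with rfl | h <;> simp [*]
  have hsnd : ∀ (z : Fin N → ℝ × ℝ) (k : Fin N) (a b : ℝ),
      (fun l => (Function.update z k (a, b) l).2) = Function.update (fun l => (z l).2) k b := by
    intro z k a b; funext l
    rcases eq_or_ne l k with rfl | h <;> simp [*]
  have hpt : ∀ z : Fin N → ℝ × ℝ,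
      decouple i (decouple j fun z => t (fun k => (z k).1) * t (fun k => (z k).2)) z
        = secondDiff t i j (fun k => (z k).1) (z i).1 (z i).2 (z j).1 (z j).2
          * secondDiff t i j (fun k => (z k).2) (z i).1 (z i).2 (z j).1 (z j).2 := by
    intro z
    simp only [decouple, secondDiff, hfst, hsnd, Function.update_of_ne hij.symm]
    ring
  simp only [hpt] at h3
  linarith

end

/-! ### Level events and binomial probabilities -/

/-- The binomial probability `P(Bin(n, u) = j)`. -/
def binomProb (n j : ℕ) (u : ℝ) : ℝ := n.choose j * u ^ j * (1 - u) ^ (n - j)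

/-- For `n` independent uniform variables and `u ≤ v`, the probability that exactly `p` of them are
`≤ u` and exactly `q` are `≤ v`. For `u > v` the roles of `(p, u)` and `(q, v)` are exchanged. -/
def jointProb (n p q : ℕ) (u v : ℝ) : ℝ :=
  if u ≤ v then n.choose q * q.choose p * u ^ p * (v - u) ^ (q - p) * (1 - v) ^ (n - q)
  else n.choose p * p.choose q * v ^ q * (u - v) ^ (p - q) * (1 - u) ^ (n - p)

theorem jointProb_comm (n p q : ℕ) (u v : ℝ) : jointProb n p q u v = jointProb n q p v u := by
  unfold jointProb
  rcases lt_trichotomy u v with h | rfl | h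
  · simp [h.le, h]
  · rcases lt_trichotomy p q with h | rfl | h
    · have h0 : q - p ≠ 0 := by omega
      simp [Nat.choose_eq_zero_of_lt h, h0]
    · rfl
    · have h0 : p - q ≠ 0 := by omega
      simp [Nat.choose_eq_zero_of_lt h, h0]
  · simp [h.le, h]

/-- The level event as a disjoint union over the set `A` of the indices with `x k ≤ s`. -/
theorem levelInd_eq_sum {ι : Type*} [DecidableEq ι] (R : Finset ι) (p : ℕ) (x : ι → ℝ) (s : ℝ) :
    levelInd R p x s = ∑ A ∈ R.powersetCard p,
      ∏ k ∈ R, if (k ∈ A ↔ x k ≤ s) then (1 : ℝ) else 0 := by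
  have hprod : ∀ A ∈ R.powersetCard p, (∏ k ∈ R, if (k ∈ A ↔ x k ≤ s) then (1 : ℝ) else 0)
      = if A = {k ∈ R | x k ≤ s} then 1 else 0 := by
    intro A hA
    have hAR := (Finset.mem_powersetCard.1 hA).1
    rw [Finset.prod_ite_zero]
    have : (∀ k ∈ R, (k ∈ A ↔ x k ≤ s)) ↔ A = {k ∈ R | x k ≤ s} := by
      constructor
      · intro h; ext k
        simp only [Finset.mem_filter]
        exact ⟨fun hk => ⟨hAR hk, (h k (hAR hk)).1 hk⟩, fun hk => (h k hk.1).2 hk.2⟩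
      · rintro rfl k hk; simp [hk]
    simp [this]
  rw [Finset.sum_congr rfl hprod, Finset.sum_ite_eq']
  simp only [levelInd, countLE, Finset.mem_powersetCard, Finset.filter_subset, true_and]
  congr

theorem cdf_nonneg {μ : Measure ℝ} {F : ℝ → ℝ} (hF : ∀ x, F x = μ.real (Set.Iic x)) (s : ℝ) :
    0 ≤ F s := by
  rw [hF]; exact measureReal_nonneg

section

variable {μ : Measure ℝ} [IsProbabilityMeasure μ] {N : ℕ}

theorem integrable_pairPi_prod {S : Finset ℕ} (h : Fin N → ℝ × ℝ → ℝ)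
    (hm : ∀ k, Measurable (h k)) (hb : ∀ k z, |h k z| ≤ 1) :
    Integrable (fun z : Fin N → ℝ × ℝ => ∏ k, h k (z k)) (pairPi μ N S) :=
  Integrable.fintype_prod fun k =>
    Integrable.of_bound (hm k).aestronglyMeasurable 1 (ae_of_all _ fun z => hb k z)

/-- Expectations of products over the two coordinates `i`, `j` and level events for the others. -/
theorem integral_mul_levelInd_mul_levelInd {S : Finset ℕ} {i j : Fin N} (hij : i ≠ j)
    {f g : ℝ × ℝ → ℝ} (hf : Measurable f) (hg : Measurable g) (hf1 : ∀ x, |f x| ≤ 1)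
    (hg1 : ∀ x, |g x| ≤ 1) (p q : ℕ) (s t : ℝ) :
    ∫ z, f (z i) * g (z j) * levelInd (Finset.univ \ {i, j}) p (fun k => (z k).1) s
        * levelInd (Finset.univ \ {i, j}) q (fun k => (z k).2) t ∂pairPi μ N S
      = (∫ x, f x ∂pairLaw μ (i.val ∈ S)) * (∫ x, g x ∂pairLaw μ (j.val ∈ S)) *
        ∑ A ∈ (Finset.univ \ {i, j}).powersetCard p, ∑ B ∈ (Finset.univ \ {i, j}).powersetCard q,
          ∏ k ∈ Finset.univ \ {i, j}, ∫ x, (if (k ∈ A ↔ x.1 ≤ s) then (1 : ℝ) else 0)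
            * (if (k ∈ B ↔ x.2 ≤ t) then 1 else 0) ∂pairLaw μ (k.val ∈ S) := by
  set R : Finset (Fin N) := Finset.univ \ {i, j} with hR
  have hm1 : ∀ (A : Finset (Fin N)) k, Measurable fun x : ℝ × ℝ =>
      if (k ∈ A ↔ x.1 ≤ s) then (1 : ℝ) else 0 := by
    intro A k
    refine Measurable.ite ?_ measurable_const measurable_const
    by_cases hk : k ∈ A
    · simp only [hk, true_iff]; exact measurableSet_le measurable_fst measurable_const
    · simp only [hk, false_iff, not_le]; exact measurableSet_lt measurable_const measurable_fst
  have hm2 : ∀ (A : Finset (Fin N)) k, Measurable fun x : ℝ × ℝ =>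
      if (k ∈ A ↔ x.2 ≤ t) then (1 : ℝ) else 0 := by
    intro A k
    refine Measurable.ite ?_ measurable_const measurable_const
    by_cases hk : k ∈ A
    · simp only [hk, true_iff]; exact measurableSet_le measurable_snd measurable_const
    · simp only [hk, false_iff, not_le]; exact measurableSet_lt measurable_const measurable_snd
  set h : Finset (Fin N) → Finset (Fin N) → Fin N → ℝ × ℝ → ℝ := fun A B k =>
    if k = i then f else if k = j then g else fun x =>
      (if (k ∈ A ↔ x.1 ≤ s) then (1 : ℝ) else 0) * (if (k ∈ B ↔ x.2 ≤ t) then 1 else 0) with hh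
  have hint : ∀ A B, Integrable (fun z : Fin N → ℝ × ℝ => ∏ k, h A B k (z k)) (pairPi μ N S) := by
    intro A B
    refine integrable_pairPi_prod _ (fun k => ?_) fun k z => ?_
    · simp only [hh]
      split_ifs
      · exact hf
      · exact hg
      · exact (hm1 A k).mul (hm2 B k)
    · simp only [hh]
      split_ifs <;> first | exact hf1 _ | exact hg1 _ | skip
      dsimp only
      split_ifs <;> simp
  have hsplit : ∀ φ : Fin N → ℝ, ∏ k, φ k = φ i * φ j * ∏ k ∈ R, φ k := by
    intro φ
    rw [← Finset.prod_sdiff (Finset.subset_univ {i, j}), Finset.prod_pair hij, mul_comm]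
  have hRi : ∀ k ∈ R, k ≠ i ∧ k ≠ j := by
    intro k hk; simpa [hR] using hk
  have hpt : ∀ z : Fin N → ℝ × ℝ,
      f (z i) * g (z j) * levelInd R p (fun k => (z k).1) s * levelInd R q (fun k => (z k).2) t
        = ∑ A ∈ R.powersetCard p, ∑ B ∈ R.powersetCard q, ∏ k, h A B k (z k) := by
    intro z
    rw [levelInd_eq_sum, levelInd_eq_sum, mul_assoc, Finset.sum_mul_sum, Finset.mul_sum]
    refine Finset.sum_congr rfl fun A _ => ?_
    rw [Finset.mul_sum]
    refine Finset.sum_congr rfl fun B _ => ?_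
    rw [hsplit, ← Finset.prod_mul_distrib]
    congr 1
    · simp [hh, hij.symm]
    · refine Finset.prod_congr rfl fun k hk => ?_
      simp [hh, hRi k hk]
  simp only [hpt]
  rw [integral_finsetSum _ fun A _ => integrable_finsetSum _ fun B _ => hint A B, Finset.mul_sum]
  refine Finset.sum_congr rfl fun A _ => ?_
  rw [integral_finsetSum _ fun B _ => hint A B, Finset.mul_sum]
  refine Finset.sum_congr rfl fun B _ => ?_
  unfold pairPi
  rw [integral_fintype_prod_eq_prod, hsplit]
  congr 1
  · simp [hh, hij.symm]
  · refine Finset.prod_congr rfl fun k hk => ?_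
    simp [hh, hRi k hk]

theorem card_sdiff_pair {i j : Fin N} (hij : i ≠ j) :
    (Finset.univ \ {i, j} : Finset (Fin N)).card = N - 2 := by
  rw [Finset.card_sdiff_of_subset (Finset.subset_univ _), Finset.card_pair hij]; simp

theorem integral_iff_le {F : ℝ → ℝ} (hF : ∀ x, F x = μ.real (Set.Iic x)) (a : Prop) [Decidable a]
    (s : ℝ) : ∫ x, (if (a ↔ x ≤ s) then (1 : ℝ) else 0) ∂μ = if a then F s else 1 - F s := by
  split_ifs with ha
  · have : (fun x : ℝ => if (a ↔ x ≤ s) then (1 : ℝ) else 0) = (Set.Iic s).indicator 1 := by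
      funext x; simp [ha, Set.indicator_apply]
    rw [this, integral_indicator_one measurableSet_Iic, hF]
  · have : (fun x : ℝ => if (a ↔ x ≤ s) then (1 : ℝ) else 0) = (Set.Iic s)ᶜ.indicator 1 := by
      funext x; simp [ha, Set.indicator_apply]
    rw [this, integral_indicator_one measurableSet_Iic.compl, hF,
      probReal_compl_eq_one_sub measurableSet_Iic]

theorem prod_ite_mem_eq_pow {ι : Type*} [DecidableEq ι] {A R : Finset ι} (hA : A ⊆ R) (a b : ℝ) :
    ∏ k ∈ R, (if k ∈ A then a else b) = a ^ A.card * b ^ (R.card - A.card) := by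
  rw [Finset.prod_ite, Finset.prod_const, Finset.prod_const, Finset.filter_mem_eq_inter,
    Finset.inter_eq_right.2 hA, Finset.filter_notMem_eq_sdiff, Finset.card_sdiff_of_subset hA]

/-- Level events of two independent samples. -/
theorem sum_prod_level_indep {F : ℝ → ℝ} (hF : ∀ x, F x = μ.real (Set.Iic x)) {ι : Type*}
    [DecidableEq ι] (R : Finset ι) (p q : ℕ) (s t : ℝ) :
    ∑ A ∈ R.powersetCard p, ∑ B ∈ R.powersetCard q,
      ∏ k ∈ R, ∫ x, (if (k ∈ A ↔ x.1 ≤ s) then (1 : ℝ) else 0)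
            * (if (k ∈ B ↔ x.2 ≤ t) then 1 else 0) ∂(μ.prod μ)
      = binomProb R.card p (F s) * binomProb R.card q (F t) := by
  have h1 : ∀ A ∈ R.powersetCard p, ∀ B ∈ R.powersetCard q,
      ∏ k ∈ R, ∫ x, (if (k ∈ A ↔ x.1 ≤ s) then (1 : ℝ) else 0)
            * (if (k ∈ B ↔ x.2 ≤ t) then 1 else 0) ∂(μ.prod μ)
        = (F s ^ p * (1 - F s) ^ (R.card - p)) * (F t ^ q * (1 - F t) ^ (R.card - q)) := by
    intro A hA B hB
    obtain ⟨hAR, rfl⟩ := Finset.mem_powersetCard.1 hA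
    obtain ⟨hBR, rfl⟩ := Finset.mem_powersetCard.1 hB
    rw [← prod_ite_mem_eq_pow hAR, ← prod_ite_mem_eq_pow hBR, ← Finset.prod_mul_distrib]
    refine Finset.prod_congr rfl fun k _ => ?_
    rw [← integral_iff_le hF, ← integral_iff_le hF]
    exact integral_prod_mul (fun x : ℝ => if (k ∈ A ↔ x ≤ s) then (1 : ℝ) else 0)
      (fun x : ℝ => if (k ∈ B ↔ x ≤ t) then (1 : ℝ) else 0)
  rw [Finset.sum_congr rfl fun A hA => Finset.sum_congr rfl fun B hB => h1 A hA B hB]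
  simp only [Finset.sum_const, Finset.card_powersetCard, nsmul_eq_mul, binomProb]
  ring

theorem cdf_le_one {F : ℝ → ℝ} (hF : ∀ x, F x = μ.real (Set.Iic x)) (s : ℝ) : F s ≤ 1 := by
  rw [hF]; exact measureReal_le_one

theorem cdf_monotone {F : ℝ → ℝ} (hF : ∀ x, F x = μ.real (Set.Iic x)) : Monotone F := by
  intro s t hst
  rw [hF, hF]; exact measureReal_mono (Set.Iic_subset_Iic.2 hst)

/-- Level events of one and the same sample at two points. -/
theorem sum_prod_level_diag {F : ℝ → ℝ} (hF : ∀ x, F x = μ.real (Set.Iic x)) {ι : Type*}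
    [DecidableEq ι] (R : Finset ι) (p q : ℕ) {s t : ℝ} (hst : s ≤ t) :
    ∑ A ∈ R.powersetCard p, ∑ B ∈ R.powersetCard q,
      ∏ k ∈ R, ∫ x, (if (k ∈ A ↔ x ≤ s) then (1 : ℝ) else 0)
            * (if (k ∈ B ↔ x ≤ t) then 1 else 0) ∂μ
      = jointProb R.card p q (F s) (F t) := by
  have hval : ∀ (a b : Prop) [Decidable a] [Decidable b],
      ∫ x, (if (a ↔ x ≤ s) then (1 : ℝ) else 0) * (if (b ↔ x ≤ t) then 1 else 0) ∂μ
        = if b then (if a then F s else F t - F s) else (if a then 0 else 1 - F t) := by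
    intro a b _ _
    by_cases ha : a <;> by_cases hb : b
    · rw [if_pos hb, if_pos ha]
      have := integral_iff_le hF a s
      rw [if_pos ha] at this
      rw [← this]
      refine integral_congr_ae (ae_of_all _ fun x => ?_)
      by_cases hx : x ≤ s
      · simp [ha, hb, hx, hx.trans hst]
      · simp [ha, hx]
    · rw [if_neg hb, if_pos ha]
      refine integral_eq_zero_of_ae (ae_of_all _ fun x => ?_)
      by_cases hx : x ≤ s
      · simp [ha, hb, hx, hx.trans hst]
      · simp [ha, hx]
    · rw [if_pos hb, if_neg ha]
      have : (fun x : ℝ => (if (a ↔ x ≤ s) then (1 : ℝ) else 0) * (if (b ↔ x ≤ t) then 1 else 0))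
          = (Set.Iic t \ Set.Iic s).indicator 1 := by
        funext x
        by_cases hx : x ≤ s <;> by_cases hx' : x ≤ t <;>
          simp [ha, hb, hx, hx', Set.indicator_apply]
      rw [this, integral_indicator_one (measurableSet_Iic.diff measurableSet_Iic),
        measureReal_sdiff (Set.Iic_subset_Iic.2 hst) measurableSet_Iic, hF, hF]
    · rw [if_neg hb, if_neg ha]
      have := integral_iff_le hF b t
      rw [if_neg hb] at this
      rw [← this]
      refine integral_congr_ae (ae_of_all _ fun x => ?_)
      by_cases hx : x ≤ t
      · simp [hb, hx]
      · have : ¬ x ≤ s := fun h => hx (h.trans hst)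
        simp [ha, hb, hx, this]
  have h1 : ∀ B ∈ R.powersetCard q, ∀ A ∈ R.powersetCard p,
      ∏ k ∈ R, ∫ x, (if (k ∈ A ↔ x ≤ s) then (1 : ℝ) else 0)
            * (if (k ∈ B ↔ x ≤ t) then 1 else 0) ∂μ
        = if A ⊆ B then F s ^ p * (F t - F s) ^ (q - p) * (1 - F t) ^ (R.card - q) else 0 := by
    intro B hB A hA
    obtain ⟨hAR, rfl⟩ := Finset.mem_powersetCard.1 hA
    obtain ⟨hBR, rfl⟩ := Finset.mem_powersetCard.1 hB
    simp only [hval]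
    split_ifs with hAB
    · rw [← prod_ite_mem_eq_pow hAB, Finset.prod_ite, Finset.filter_mem_eq_inter,
        Finset.inter_eq_right.2 hBR, Finset.filter_notMem_eq_sdiff]
      congr 1
      rw [← Finset.card_sdiff_of_subset hBR, ← Finset.prod_const]
      refine Finset.prod_congr rfl fun k hk => ?_
      rw [if_neg fun h => (Finset.mem_sdiff.1 hk).2 (hAB h)]
    · obtain ⟨k, hkA, hkB⟩ := Finset.not_subset.1 hAB
      exact Finset.prod_eq_zero (hAR hkA) (by simp [hkA, hkB])
  rw [Finset.sum_comm, Finset.sum_congr rfl fun B hB => Finset.sum_congr rfl fun A hA =>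
    h1 B hB A hA]
  have h2 : ∀ B ∈ R.powersetCard q, (∑ A ∈ R.powersetCard p,
      if A ⊆ B then F s ^ p * (F t - F s) ^ (q - p) * (1 - F t) ^ (R.card - q) else 0)
      = q.choose p * (F s ^ p * (F t - F s) ^ (q - p) * (1 - F t) ^ (R.card - q)) := by
    intro B hB
    obtain ⟨hBR, rfl⟩ := Finset.mem_powersetCard.1 hB
    rw [← Finset.sum_filter, Finset.sum_const, nsmul_eq_mul]
    congr 2
    rw [← Finset.card_powersetCard]
    congr 1
    ext A
    simp only [Finset.mem_filter, Finset.mem_powersetCard]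
    exact ⟨fun h => ⟨h.2, h.1.2⟩, fun h => ⟨⟨h.1.trans hBR, h.2⟩, h.1⟩⟩
  rw [Finset.sum_congr rfl h2]
  simp only [Finset.sum_const, Finset.card_powersetCard, nsmul_eq_mul, jointProb,
    if_pos (cdf_monotone hF hst)]
  ring

/-- The probability that exactly `p` observations of one sample of `n` uniform variables are `≤ u`
and exactly `q` of another one are `≤ v`, where the two samples coincide if `diag` holds and are
independent otherwise. -/
def levelKernel (diag : Prop) [Decidable diag] (n p q : ℕ) (u v : ℝ) : ℝ :=
  if diag then jointProb n p q u v else binomProb n p u * binomProb n q v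

theorem sum_prod_level {F : ℝ → ℝ} (hF : ∀ x, F x = μ.real (Set.Iic x)) {ι : Type*}
    [DecidableEq ι] (R : Finset ι) (p q : ℕ) (s t : ℝ) (b : Prop) [Decidable b] :
    ∑ A ∈ R.powersetCard p, ∑ B ∈ R.powersetCard q,
      ∏ k ∈ R, ∫ x, (if (k ∈ A ↔ x.1 ≤ s) then (1 : ℝ) else 0)
            * (if (k ∈ B ↔ x.2 ≤ t) then 1 else 0) ∂(pairLaw μ b)
      = levelKernel b R.card p q (F s) (F t) := by
  unfold levelKernel pairLaw
  split_ifs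
  · have hmap : ∀ (A B : Finset ι) k, ∫ x, (if (k ∈ A ↔ x.1 ≤ s) then (1 : ℝ) else 0)
        * (if (k ∈ B ↔ x.2 ≤ t) then 1 else 0) ∂(μ.map fun x => (x, x))
        = ∫ x, (if (k ∈ A ↔ x ≤ s) then (1 : ℝ) else 0)
          * (if (k ∈ B ↔ x ≤ t) then 1 else 0) ∂μ := by
      intro A B k
      rw [integral_map (by fun_prop)]
      refine Measurable.aestronglyMeasurable ?_
      refine Measurable.mul (Measurable.ite ?_ measurable_const measurable_const)
        (Measurable.ite ?_ measurable_const measurable_const)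
      · by_cases hk : k ∈ A
        · simp only [hk, true_iff]; exact measurableSet_le measurable_fst measurable_const
        · simp only [hk, false_iff, not_le]; exact measurableSet_lt measurable_const measurable_fst
      · by_cases hk : k ∈ B
        · simp only [hk, true_iff]; exact measurableSet_le measurable_snd measurable_const
        · simp only [hk, false_iff, not_le]; exact measurableSet_lt measurable_const measurable_snd
    simp only [hmap]
    rcases le_total s t with h | h
    · exact sum_prod_level_diag hF R p q h
    · rw [jointProb_comm, ← sum_prod_level_diag hF R q p h, Finset.sum_comm]
      refine Finset.sum_congr rfl fun B _ => Finset.sum_congr rfl fun A _ =>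
        Finset.prod_congr rfl fun k _ => ?_
      simp only [mul_comm]
  · exact sum_prod_level_indep hF R p q s t

theorem integral_jump_mul_jump {F : ℝ → ℝ} (hF : ∀ x, F x = μ.real (Set.Iic x)) (s t : ℝ) :
    ∫ x, jump x.1 x.2 s * jump x.1 x.2 t ∂(μ.prod μ) = 2 * (min (F s) (F t) - F s * F t) := by
  set I : ℝ → ℝ → ℝ := fun s => (Set.Iic s).indicator 1 with hI
  have hIm : ∀ s, Measurable (I s) := fun s => measurable_one.indicator measurableSet_Iic
  have hIb : ∀ s, Integrable (I s) μ := fun s =>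
    Integrable.of_bound (hIm s).aestronglyMeasurable 1 (ae_of_all _ fun x => by
      simp only [hI, Set.indicator_apply]; split_ifs <;> simp)
  have hIF : ∀ s, ∫ x, I s x ∂μ = F s := fun s => by
    rw [hF]; exact integral_indicator_one measurableSet_Iic
  have h1 : ∀ s, Integrable (fun x : ℝ × ℝ => I s x.1) (μ.prod μ) := fun s =>
    measurePreserving_fst.integrable_comp_of_integrable (hIb s)
  have h2 : ∀ s, Integrable (fun x : ℝ × ℝ => I s x.2) (μ.prod μ) := fun s =>
    measurePreserving_snd.integrable_comp_of_integrable (hIb s)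
  have hpt : ∀ x : ℝ × ℝ, jump x.1 x.2 s * jump x.1 x.2 t
      = I (min s t) x.1 - I s x.1 * I t x.2 - I t x.1 * I s x.2 + I (min s t) x.2 := by
    intro x
    simp only [jump, hI, Set.indicator_apply, Set.mem_Iic, le_min_iff, Pi.one_apply]
    by_cases ha : x.1 ≤ s <;> by_cases hb : x.1 ≤ t <;> by_cases hc : x.2 ≤ s <;>
      by_cases hd : x.2 ≤ t <;> simp [ha, hb, hc, hd]
  simp only [hpt]
  rw [integral_sub_sub_add (h1 _) ((hIb s).mul_prod (hIb t)) ((hIb t).mul_prod (hIb s)) (h2 _),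
    integral_prod_mul, integral_prod_mul,
    integral_comp_measurePreserving measurePreserving_fst (hIb _).aestronglyMeasurable,
    integral_comp_measurePreserving measurePreserving_snd (hIb _).aestronglyMeasurable]
  simp only [hIF]
  rw [(cdf_monotone hF).map_min]
  ring

end

/-! ### The higher order sum as a double integral -/

/-- The square of the covariance `min u v - u v` of the indicators `1{U ≤ u}` and `1{U ≤ v}` for a
uniform random variable `U`. -/
def covSq (u v : ℝ) : ℝ := (min u v - u * v) ^ 2

/-- The integral `∫∫ covSq (F s) (F t) L(F s, F t) ds dt` of the kernel `L = levelKernel`. -/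
def kernelIntegral (F : ℝ → ℝ) (diag : Prop) [Decidable diag] (n p q : ℕ) : ℝ :=
  ∫ w : ℝ × ℝ, covSq (F w.1) (F w.2) * levelKernel diag n p q (F w.1) (F w.2)

section

variable {μ : Measure ℝ} [IsProbabilityMeasure μ]

theorem measurable_levelKernel (diag : Prop) [Decidable diag] (n p q : ℕ) :
    Measurable fun w : ℝ × ℝ => levelKernel diag n p q w.1 w.2 := by
  unfold levelKernel
  split_ifs
  · unfold jointProb
    exact Measurable.ite (measurableSet_le measurable_fst measurable_snd) (by fun_prop)
      (by fun_prop)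
  · unfold binomProb; fun_prop

section

variable {N : ℕ} {F : ℝ → ℝ} {S : Finset ℕ} {i j : Fin N} {diag : Prop} [Decidable diag]

theorem integral_mul_levels (hF : ∀ x, F x = μ.real (Set.Iic x)) (hij : i ≠ j)
    (hi : i.val ∉ S) (hj : j.val ∉ S) (hS : ∀ k : Fin N, k ≠ i → k ≠ j → (k.val ∈ S ↔ diag))
    {f g : ℝ × ℝ → ℝ} (hf : Measurable f) (hg : Measurable g) (hf1 : ∀ x, |f x| ≤ 1)
    (hg1 : ∀ x, |g x| ≤ 1) (p q : ℕ) (s t : ℝ) :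
    ∫ z, f (z i) * g (z j) * levelInd (Finset.univ \ {i, j}) p (fun k => (z k).1) s
        * levelInd (Finset.univ \ {i, j}) q (fun k => (z k).2) t ∂pairPi μ N S
      = (∫ x, f x ∂(μ.prod μ)) * (∫ x, g x ∂(μ.prod μ))
        * levelKernel diag (N - 2) p q (F s) (F t) := by
  rw [integral_mul_levelInd_mul_levelInd hij hf hg hf1 hg1, ← card_sdiff_pair hij,
    ← sum_prod_level hF]
  congr 1
  · simp only [hi, hj, pairLaw, if_false]
  · refine Finset.sum_congr rfl fun A _ => Finset.sum_congr rfl fun B _ =>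
      Finset.prod_congr rfl fun k hk => ?_
    simp only [Finset.mem_sdiff, Finset.mem_univ, true_and, Finset.mem_insert,
      Finset.mem_singleton, not_or] at hk
    have : pairLaw μ (k.val ∈ S) = pairLaw μ diag := by
      simp only [pairLaw, hS k hk.1 hk.2]
    rw [this]

/-- Fubini: products of integrals over the random spacings as integrals of the level kernel. -/
theorem integral_spacing_mul_spacing (hF : ∀ x, F x = μ.real (Set.Iic x)) (hij : i ≠ j)
    (hi : i.val ∉ S) (hj : j.val ∉ S) (hS : ∀ k : Fin N, k ≠ i → k ≠ j → (k.val ∈ S ↔ diag))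
    {p q : ℕ} (hint : Integrable fun w : ℝ × ℝ => levelKernel diag (N - 2) p q (F w.1) (F w.2)) :
    Integrable (fun z =>
      (∫ s, jump (z i).1 (z i).2 s * jump (z j).1 (z j).2 s
          * levelInd (Finset.univ \ {i, j}) p (fun k => (z k).1) s)
        * ∫ t, jump (z i).1 (z i).2 t * jump (z j).1 (z j).2 t
          * levelInd (Finset.univ \ {i, j}) q (fun k => (z k).2) t) (pairPi μ N S) ∧
    ∫ z, (∫ s, jump (z i).1 (z i).2 s * jump (z j).1 (z j).2 s
          * levelInd (Finset.univ \ {i, j}) p (fun k => (z k).1) s)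
        * (∫ t, jump (z i).1 (z i).2 t * jump (z j).1 (z j).2 t
          * levelInd (Finset.univ \ {i, j}) q (fun k => (z k).2) t) ∂pairPi μ N S
      = 4 * kernelIntegral F diag (N - 2) p q := by
  set R : Finset (Fin N) := Finset.univ \ {i, j} with hR
  set H : (Fin N → ℝ × ℝ) × (ℝ × ℝ) → ℝ := fun y =>
    (jump (y.1 i).1 (y.1 i).2 y.2.1 * jump (y.1 j).1 (y.1 j).2 y.2.1
          * levelInd R p (fun k => (y.1 k).1) y.2.1)
      * (jump (y.1 i).1 (y.1 i).2 y.2.2 * jump (y.1 j).1 (y.1 j).2 y.2.2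
          * levelInd R q (fun k => (y.1 k).2) y.2.2) with hH
  have hjm : ∀ {E : Type} [MeasurableSpace E] {a : E → ℝ × ℝ} {c : E → ℝ}, Measurable a →
      Measurable c → Measurable fun y => jump (a y).1 (a y).2 (c y) := fun ha hc =>
    measurable_jump.comp (ha.prodMk hc)
  have hlm : ∀ {E : Type} [MeasurableSpace E] (l : ℕ) {a : E → (Fin N → ℝ)} {c : E → ℝ},
      Measurable a → Measurable c → Measurable fun y => levelInd R l (a y) (c y) :=
    fun l _ _ ha hc => (measurable_levelInd R l).comp (Measurable.prodMk ha hc)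
  have hHm : Measurable H := by
    refine Measurable.mul (Measurable.mul (Measurable.mul ?_ ?_) ?_)
      (Measurable.mul (Measurable.mul ?_ ?_) ?_)
    · exact hjm (by fun_prop) (by fun_prop)
    · exact hjm (by fun_prop) (by fun_prop)
    · exact hlm _ (by fun_prop) (by fun_prop)
    · exact hjm (by fun_prop) (by fun_prop)
    · exact hjm (by fun_prop) (by fun_prop)
    · exact hlm _ (by fun_prop) (by fun_prop)
  have hH0 : ∀ y, |H y| ≤ levelInd R p (fun k => (y.1 k).1) y.2.1
      * levelInd R q (fun k => (y.1 k).2) y.2.2 := by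
    intro y
    have hone : ∀ a b l : ℝ, |a| ≤ 1 → |b| ≤ 1 → 0 ≤ l → |a * b * l| ≤ l := by
      intro a b l ha hb hl
      rw [abs_mul, abs_mul, abs_of_nonneg hl]
      exact mul_le_of_le_one_left hl (mul_le_one₀ ha (abs_nonneg b) hb)
    rw [hH, abs_mul]
    exact mul_le_mul (hone _ _ _ (abs_jump_le _ _ _) (abs_jump_le _ _ _) (levelInd_nonneg _ _ _ _))
      (hone _ _ _ (abs_jump_le _ _ _) (abs_jump_le _ _ _) (levelInd_nonneg _ _ _ _))
      (abs_nonneg _) (levelInd_nonneg _ _ _ _)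
  have hlev1 : ∀ (z : Fin N → ℝ × ℝ) (w : ℝ × ℝ), levelInd R p (fun k => (z k).1) w.1
      * levelInd R q (fun k => (z k).2) w.2 ≤ 1 := fun z w =>
    mul_le_one₀ (levelInd_le_one _ _ _ _) (levelInd_nonneg _ _ _ _) (levelInd_le_one _ _ _ _)
  have hsec : ∀ w, Integrable (fun z => H (z, w)) (pairPi μ N S) := fun w =>
    Integrable.of_bound (hHm.comp measurable_prodMk_right).aestronglyMeasurable 1
      (ae_of_all _ fun z => (hH0 (z, w)).trans (hlev1 z w))
  have hInt : Integrable H ((pairPi μ N S).prod volume) := by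
    rw [integrable_prod_iff' hHm.aestronglyMeasurable]
    refine ⟨ae_of_all _ hsec, hint.mono' ?_ (ae_of_all _ fun w => ?_)⟩
    · exact hHm.norm.stronglyMeasurable.integral_prod_left'.aestronglyMeasurable
    · rw [Real.norm_of_nonneg (integral_nonneg fun z => norm_nonneg _)]
      have := integral_mul_levels hF hij hi hj hS (f := fun _ => 1) (g := fun _ => 1)
        measurable_const measurable_const (by simp) (by simp) p q w.1 w.2
      simp only [one_mul, integral_const, probReal_univ, smul_eq_mul, mul_one] at this
      rw [← this]
      refine integral_mono (hsec w).norm ?_ fun z => hH0 (z, w)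
      refine Integrable.of_bound (Measurable.mul (hlm _ (by fun_prop) (by fun_prop))
        (hlm _ (by fun_prop) (by fun_prop))).aestronglyMeasurable 1 (ae_of_all _ fun z => ?_)
      rw [Real.norm_of_nonneg (mul_nonneg (levelInd_nonneg _ _ _ _) (levelInd_nonneg _ _ _ _))]
      exact hlev1 z w
  have hinner : ∀ z : Fin N → ℝ × ℝ, ∫ w, H (z, w)
      = (∫ s, jump (z i).1 (z i).2 s * jump (z j).1 (z j).2 s
          * levelInd R p (fun k => (z k).1) s)
        * ∫ t, jump (z i).1 (z i).2 t * jump (z j).1 (z j).2 t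
          * levelInd R q (fun k => (z k).2) t := fun z =>
    integral_prod_mul (μ := volume) (ν := volume)
      (fun s => jump (z i).1 (z i).2 s * jump (z j).1 (z j).2 s
          * levelInd R p (fun k => (z k).1) s)
      (fun t => jump (z i).1 (z i).2 t * jump (z j).1 (z j).2 t
          * levelInd R q (fun k => (z k).2) t)
  simp only [← hinner]
  refine ⟨hInt.integral_prod_left, ?_⟩
  rw [integral_integral_swap (f := fun z w => H (z, w)) hInt, kernelIntegral, ← integral_const_mul]
  refine integral_congr_ae (ae_of_all _ fun w => ?_)
  have := integral_mul_levels hF hij hi hj hS (f := fun x => jump x.1 x.2 w.1 * jump x.1 x.2 w.2)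
    (g := fun x => jump x.1 x.2 w.1 * jump x.1 x.2 w.2)
    ((hjm measurable_id measurable_const).mul (hjm measurable_id measurable_const))
    ((hjm measurable_id measurable_const).mul (hjm measurable_id measurable_const))
    (fun x => by
      rw [abs_mul]; exact mul_le_one₀ (abs_jump_le _ _ _) (abs_nonneg _) (abs_jump_le _ _ _))
    (fun x => by
      rw [abs_mul]; exact mul_le_one₀ (abs_jump_le _ _ _) (abs_nonneg _) (abs_jump_le _ _ _))
    p q w.1 w.2
  rw [integral_jump_mul_jump hF] at this
  have h2 : ∫ z, H (z, w) ∂pairPi μ N S = 2 * (min (F w.1) (F w.2) - F w.1 * F w.2) *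
      (2 * (min (F w.1) (F w.2) - F w.1 * F w.2)) *
        levelKernel diag (N - 2) p q (F w.1) (F w.2) := by
    rw [← this]
    refine integral_congr_ae (ae_of_all _ fun z => ?_)
    simp only [hH]
    ring
  simp only [h2, covSq]
  ring

/-- The second difference of `pairMoment` for the trimmed mean: the second difference of the trimmed
mean is a difference of two spacings, so that its square contributes four integrals. -/
theorem secondDiff_pairMoment_trimmedMean (hF : ∀ x, F x = μ.real (Set.Iic x)) {α β : ℝ}
    (hα : 1 ≤ ⌊α * N⌋₊) (hαβ : ⌊α * N⌋₊ ≤ ⌊β * N⌋₊) (hβ : ⌊β * N⌋₊ ≤ N)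
    (ht : MemLp (trimmedMean α β N) 2 (Measure.pi fun _ => μ)) (hij : i ≠ j)
    (hi : i.val ∉ S) (hj : j.val ∉ S) (hS : ∀ k : Fin N, k ≠ i → k ≠ j → (k.val ∈ S ↔ diag))
    (hint : ∀ p ∈ ({⌊β * N⌋₊ - 1, ⌊α * N⌋₊ - 1} : Finset ℕ),
      ∀ q ∈ ({⌊β * N⌋₊ - 1, ⌊α * N⌋₊ - 1} : Finset ℕ),
      Integrable fun w : ℝ × ℝ => levelKernel diag (N - 2) p q (F w.1) (F w.2)) :
    pairMoment μ (trimmedMean α β N) (S ∪ {i.val, j.val})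
        - pairMoment μ (trimmedMean α β N) (S ∪ {i.val})
        - pairMoment μ (trimmedMean α β N) (S ∪ {j.val}) + pairMoment μ (trimmedMean α β N) S
      = (N : ℝ)⁻¹ * (kernelIntegral F diag (N - 2) (⌊β * N⌋₊ - 1) (⌊β * N⌋₊ - 1)
        - kernelIntegral F diag (N - 2) (⌊β * N⌋₊ - 1) (⌊α * N⌋₊ - 1)
        - kernelIntegral F diag (N - 2) (⌊α * N⌋₊ - 1) (⌊β * N⌋₊ - 1)
        + kernelIntegral F diag (N - 2) (⌊α * N⌋₊ - 1) (⌊α * N⌋₊ - 1)) := by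
  rw [secondDiff_pairMoment ht hij hi hj]
  simp only [secondDiff_trimmedMean hα hαβ hβ hij]
  generalize ⌊β * N⌋₊ - 1 = m at *
  generalize ⌊α * N⌋₊ - 1 = a at *
  have hsp := fun p hp q hq => integral_spacing_mul_spacing hF hij hi hj hS (hint p hp q hq)
  have hmm := hsp m (by simp) m (by simp)
  have hma := hsp m (by simp) a (by simp)
  have ham := hsp a (by simp) m (by simp)
  have haa := hsp a (by simp) a (by simp)
  have hN : (Real.sqrt N)⁻¹ * (Real.sqrt N)⁻¹ = (N : ℝ)⁻¹ := by
    rw [← mul_inv, Real.mul_self_sqrt (Nat.cast_nonneg N)]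
  have hsplit : ∀ c x y x' y' : ℝ, c * (x - y) * (c * (x' - y'))
      = c * c * (x * x' - x * y' - y * x' + y * y') := by intros; ring
  simp only [hsplit, hN]
  rw [integral_const_mul, integral_sub_sub_add hmm.1 hma.1 ham.1 haa.1, hmm.2, hma.2, ham.2, haa.2]
  ring

end

/-- The sum of the higher order terms as a difference of explicit double integrals: the joint
distribution of the two spacings next to the trimming points against the product of its
marginals. -/
theorem higherOrderSum_eq_kernelIntegral {Ω : Type*} [MeasurableSpace Ω] {P : Measure Ω}
    [IsProbabilityMeasure P] {X : ℕ → Ω → ℝ} {n : ℕ} {F : ℝ → ℝ} {α β : ℝ}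
    (hF : ∀ x, F x = μ.real (Set.Iic x))
    (hX : MeasurePreserving (fun ω (i : Fin (n + 2)) => X i ω) P (Measure.pi fun _ => μ))
    (hmeas : ∀ i, Measurable (X i))
    (ht : MemLp (trimmedMean α β (n + 2)) 2 (Measure.pi fun _ => μ))
    {m a : ℕ} (hm : m + 1 = ⌊β * (n + 2 : ℕ)⌋₊) (ha : a + 1 = ⌊α * (n + 2 : ℕ)⌋₊)
    (ham : a ≤ m) (hmn : m ≤ n + 1)
    (hint : ∀ p ∈ ({m, a} : Finset ℕ), ∀ q ∈ ({m, a} : Finset ℕ),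
      (Integrable fun w : ℝ × ℝ => levelKernel True n p q (F w.1) (F w.2)) ∧
      Integrable fun w : ℝ × ℝ => levelKernel False n p q (F w.1) (F w.2)) :
    higherOrderSum P X α β (n + 2) = ((n + 2 : ℕ) : ℝ)⁻¹ *
      ((kernelIntegral F True n m m - kernelIntegral F False n m m)
        - (kernelIntegral F True n m a - kernelIntegral F False n m a)
        - (kernelIntegral F True n a m - kernelIntegral F False n a m)
        + (kernelIntegral F True n a a - kernelIntegral F False n a a)) := by
  have hmp : ⌊β * (n + 2 : ℕ)⌋₊ - 1 = m := by omega
  have hap : ⌊α * (n + 2 : ℕ)⌋₊ - 1 = a := by omega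
  have h01 : (0 : Fin (n + 2)) ≠ 1 := by simp
  have hd := secondDiff_pairMoment_trimmedMean (diag := True) (S := Finset.Ico 2 (n + 2))
    (i := 0) (j := 1) hF (by omega) (by omega) (by omega) ht h01 (by simp) (by simp)
    (fun k h0 h1 => by
      have h0' : k.val ≠ 0 := fun h => h0 (Fin.ext h)
      have h1' : k.val ≠ 1 := fun h => h1 (Fin.ext (by simpa using h))
      have := k.2
      simp only [Finset.mem_Ico, iff_true]; omega)
    (by rw [hmp, hap]; exact fun p hp q hq => (hint p hp q hq).1)
  have hp := secondDiff_pairMoment_trimmedMean (diag := False) (S := ∅)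
    (i := 0) (j := 1) hF (by omega) (by omega) (by omega) ht h01 (by simp) (by simp)
    (fun k _ _ => by simp)
    (by rw [hmp, hap]; exact fun p hp q hq => (hint p hp q hq).2)
  rw [hmp, hap] at hd hp
  have h1 : ((1 : Fin (n + 2)) : ℕ) = 1 := by simp
  simp only [Fin.val_zero, h1, Nat.add_sub_cancel] at hd hp
  rw [higherOrderSum_eq hX hmeas ht, hd, hp]
  ring

end

/-! ### Concentration of binomial probabilities -/

theorem choose_mul_pow_mul_pow_le {x y : ℝ} (hx : 0 ≤ x) (hy : 0 ≤ y) (n m : ℕ) :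
    n.choose m * x ^ m * y ^ (n - m) ≤ (x + y) ^ n := by
  rcases le_or_gt m n with h | h
  · rw [add_pow]
    refine le_trans (le_of_eq ?_) (Finset.single_le_sum
      (f := fun m => x ^ m * y ^ (n - m) * n.choose m) (fun i _ => by positivity)
      (Finset.mem_range.2 (Nat.lt_succ_of_le h)))
    ring
  · simp only [Nat.choose_eq_zero_of_lt h, Nat.cast_zero, zero_mul]; positivity

theorem binomProb_nonneg (n j : ℕ) {u : ℝ} (hu : u ∈ Set.Icc (0 : ℝ) 1) : 0 ≤ binomProb n j u := by
  have := hu.1; have : 0 ≤ 1 - u := sub_nonneg.2 hu.2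
  unfold binomProb; positivity

theorem binomProb_le_one (n j : ℕ) {u : ℝ} (hu : u ∈ Set.Icc (0 : ℝ) 1) : binomProb n j u ≤ 1 := by
  have := choose_mul_pow_mul_pow_le hu.1 (sub_nonneg.2 hu.2) n j
  simpa [binomProb] using this

theorem jointProb_bounds_of_le {n p q : ℕ} (hq : q ≤ n) {u v : ℝ}
    (hu : u ∈ Set.Icc (0 : ℝ) 1) (hv : v ∈ Set.Icc (0 : ℝ) 1) (huv : u ≤ v) :
    0 ≤ jointProb n p q u v ∧ jointProb n p q u v ≤ binomProb n p u ∧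
      jointProb n p q u v ≤ binomProb n q v := by
  have hu0 := hu.1
  have hvu : 0 ≤ v - u := sub_nonneg.2 huv
  have hv1 : 0 ≤ 1 - v := sub_nonneg.2 hv.2
  unfold jointProb binomProb
  rw [if_pos huv]
  refine ⟨by positivity, ?_, ?_⟩
  · rcases le_or_gt p q with hpq | hpq
    · have h1 : (n.choose q * q.choose p : ℝ) = n.choose p * (n - p).choose (q - p) := by
        exact_mod_cast Nat.choose_mul hpq
      have h2 := choose_mul_pow_mul_pow_le hvu hv1 (n - p) (q - p)
      rw [show n - p - (q - p) = n - q by omega, show v - u + (1 - v) = 1 - u by ring] at h2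
      calc _ = n.choose p * u ^ p *
            ((n - p).choose (q - p) * (v - u) ^ (q - p) * (1 - v) ^ (n - q)) := by rw [h1]; ring
        _ ≤ _ := mul_le_mul_of_nonneg_left h2 (by positivity)
    · have : 0 ≤ 1 - u := by linarith
      rw [Nat.choose_eq_zero_of_lt hpq]
      simp only [Nat.cast_zero, mul_zero, zero_mul]; positivity
  · have h2 := choose_mul_pow_mul_pow_le hu0 hvu q p
    rw [show u + (v - u) = v by ring] at h2
    calc _ = n.choose q * (q.choose p * u ^ p * (v - u) ^ (q - p)) * (1 - v) ^ (n - q) := by ring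
      _ ≤ _ := by gcongr

/-- The joint probability of two events is at most the geometric mean of their probabilities. This
bound by a product serves both kinds of kernels. -/
theorem levelKernel_bounds (diag : Prop) [Decidable diag] {n p q : ℕ} (hp : p ≤ n) (hq : q ≤ n)
    {u v : ℝ} (hu : u ∈ Set.Icc (0 : ℝ) 1) (hv : v ∈ Set.Icc (0 : ℝ) 1) :
    0 ≤ levelKernel diag n p q u v ∧ levelKernel diag n p q u v
      ≤ Real.sqrt (binomProb n p u) * Real.sqrt (binomProb n q v) := by
  have hb := binomProb_nonneg n p hu
  have hb' := binomProb_nonneg n q hv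
  unfold levelKernel
  rw [← Real.sqrt_mul hb]
  split_ifs
  · have : 0 ≤ jointProb n p q u v ∧ jointProb n p q u v ≤ binomProb n p u ∧
        jointProb n p q u v ≤ binomProb n q v := by
      rcases le_total u v with h | h
      · exact jointProb_bounds_of_le hq hu hv h
      · rw [jointProb_comm]
        have := jointProb_bounds_of_le (p := q) hp hv hu h
        exact ⟨this.1, this.2.2, this.2.1⟩
    refine ⟨this.1, Real.le_sqrt_of_sq_le ?_⟩
    rw [sq]; exact mul_le_mul this.2.1 this.2.2 this.1 hb
  · refine ⟨mul_nonneg hb hb', Real.le_sqrt_of_sq_le ?_⟩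
    have := mul_le_one₀ (binomProb_le_one n p hu) hb' (binomProb_le_one n q hv)
    rw [sq]; exact mul_le_of_le_one_left (mul_nonneg hb hb') this

/-- Trading polynomial factors in `n` for powers of `u (1 - u)`. -/
theorem binomProb_le_mul_binomProb (r : ℕ) {n j : ℕ} (hj : r ≤ j) (hjn : j + r ≤ n) {u : ℝ}
    (hu : u ∈ Set.Icc (0 : ℝ) 1) :
    binomProb n j u ≤ ((n : ℝ) ^ 2 * (u * (1 - u))) ^ r * binomProb (n - 2 * r) (j - r) u := by
  have hu0 := hu.1
  have hu1 : 0 ≤ 1 - u := sub_nonneg.2 hu.2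
  induction r with
  | zero => simp
  | succ r ih =>
    refine (ih (by omega) (by omega)).trans ?_
    rw [pow_succ ((n : ℝ) ^ 2 * (u * (1 - u))) r,
      mul_assoc (((n : ℝ) ^ 2 * (u * (1 - u))) ^ r)]
    refine mul_le_mul_of_nonneg_left ?_ (by positivity)
    obtain ⟨k, hk⟩ : ∃ k, j - r = k + 1 := ⟨j - r - 1, by omega⟩
    obtain ⟨m, hm⟩ : ∃ m, n - 2 * r = m + 2 := ⟨n - 2 * r - 2, by omega⟩
    rw [show j - (r + 1) = k by omega, show n - 2 * (r + 1) = m by omega, hk, hm]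
    have hkm : k ≤ m := by omega
    have h1 : (m + 2).choose (k + 1) ≤ (m + 2) * (m + 1).choose k :=
      (Nat.le_mul_of_pos_right _ (Nat.succ_pos k)).trans_eq
        (Nat.add_one_mul_choose_eq (m + 1) k).symm
    have h2 : (m + 1).choose k ≤ (m + 1) * m.choose k := by
      rw [mul_comm (m + 1), Nat.choose_mul_succ_eq]; exact Nat.le_mul_of_pos_right _ (by omega)
    have h3 : ((m + 2).choose (k + 1) : ℝ) ≤ (n : ℝ) ^ 2 * m.choose k := by
      have : (m + 2).choose (k + 1) ≤ n ^ 2 * m.choose k := by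
        calc _ ≤ (m + 2) * ((m + 1) * m.choose k) := h1.trans (Nat.mul_le_mul_left _ h2)
          _ = (m + 2) * (m + 1) * m.choose k := by ring
          _ ≤ _ := by
            refine Nat.mul_le_mul_right _ ?_
            rw [sq]; exact Nat.mul_le_mul (by omega) (by omega)
      exact_mod_cast this
    unfold binomProb
    rw [show m + 2 - (k + 1) = m - k + 1 by omega, pow_succ u, pow_succ (1 - u)]
    calc _ = ((m + 2).choose (k + 1) : ℝ) * (u ^ k * u * ((1 - u) ^ (m - k) * (1 - u))) := by ring
      _ ≤ (n : ℝ) ^ 2 * m.choose k * (u ^ k * u * ((1 - u) ^ (m - k) * (1 - u))) := by gcongr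
      _ = _ := by ring

/-- Chernoff bound for a single binomial probability. -/
theorem binomProb_le_exp (n j : ℕ) {u x : ℝ} (hu : u ∈ Set.Icc (0 : ℝ) 1) (hx : |x| ≤ 1) :
    binomProb n j u ≤ Real.exp (n * (u * x + x ^ 2) - x * j) := by
  have hu0 := hu.1
  have hu1 : 0 ≤ 1 - u := sub_nonneg.2 hu.2
  have h1 : Real.exp x ≤ 1 + x + x ^ 2 := by
    have := (abs_le.1 (Real.abs_exp_sub_one_sub_id_le hx)).2
    linarith
  have h2 : u * Real.exp x + (1 - u) ≤ Real.exp (u * x + x ^ 2) := by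
    have h3 := Real.add_one_le_exp (u * x + x ^ 2)
    have h4 : u * Real.exp x ≤ u * (1 + x + x ^ 2) := mul_le_mul_of_nonneg_left h1 hu0
    have h5 : u * x ^ 2 ≤ x ^ 2 := mul_le_of_le_one_left (sq_nonneg x) hu.2
    nlinarith
  have h6 := choose_mul_pow_mul_pow_le (mul_nonneg hu0 (Real.exp_pos x).le) hu1 n j
  have h7 : (u * Real.exp x + (1 - u)) ^ n ≤ Real.exp (n * (u * x + x ^ 2)) := by
    rw [Real.exp_nat_mul]
    exact pow_le_pow_left₀ (add_nonneg (mul_nonneg hu0 (Real.exp_pos x).le) hu1) h2 n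
  rw [Real.exp_sub, le_div_iff₀ (Real.exp_pos _)]
  refine le_trans (le_of_eq ?_) (h6.trans h7)
  unfold binomProb
  rw [mul_pow, ← Real.exp_nat_mul, mul_comm x]
  ring

theorem binomProb_le_of_far {n j : ℕ} {u θ η c : ℝ} (hu : u ∈ Set.Icc (0 : ℝ) 1) (hη : 0 < η)
    (hη1 : η ≤ 1) (hc : |(j : ℝ) - θ * n| ≤ c) (hfar : η ≤ |u - θ|) :
    binomProb n j u ≤ Real.exp (c - n * (η / 2) ^ 2) := by
  have hc' := abs_le.1 hc
  have hn : (0 : ℝ) ≤ n := Nat.cast_nonneg n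
  have hc0 : 0 ≤ c := (abs_nonneg _).trans hc
  -- In the Chernoff bound take `x = ± η / 2`, with the sign of `θ - u`.
  have key : ∀ x : ℝ, |x| = η / 2 → x * (u - θ) ≤ - (η / 2 * η) →
      binomProb n j u ≤ Real.exp (c - n * (η / 2) ^ 2) := by
    intro x hx hxu
    have hx1 : |x| ≤ 1 := by rw [hx]; linarith
    refine (binomProb_le_exp n j hu hx1).trans (Real.exp_le_exp.2 ?_)
    have hsq : x ^ 2 = (η / 2) ^ 2 := by rw [← sq_abs, hx]
    have h1 : x * (θ * n - j) ≤ c := by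
      calc x * (θ * n - j) ≤ |x * (θ * n - j)| := le_abs_self _
        _ = |x| * |(j : ℝ) - θ * n| := by rw [abs_mul, abs_sub_comm]
        _ ≤ 1 * c := mul_le_mul hx1 hc (abs_nonneg _) zero_le_one
        _ = c := one_mul c
    have h2 : n * (x * (u - θ)) ≤ n * -(η / 2 * η) := mul_le_mul_of_nonneg_left hxu hn
    rw [hsq]
    nlinarith
  rcases le_total θ u with h | h
  · rw [abs_of_nonneg (sub_nonneg.2 h)] at hfar
    exact key (-(η / 2)) (by rw [abs_neg, abs_of_pos (by linarith)]) (by nlinarith)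
  · rw [abs_of_nonpos (sub_nonpos.2 h)] at hfar
    exact key (η / 2) (abs_of_pos (by linarith)) (by nlinarith)

/-- The functions `b n` on `[0, 1]` concentrate at `θ`: they are bounded by polynomials in `n`, and
away from `θ` they decrease faster than any power of `n`, in both cases with a factor
`(u (1 - u)) ^ q` near the end points. -/
def ConcentratesAt (θ : ℝ) (q : ℕ) (b : ℕ → ℝ → ℝ) : Prop :=
  (∃ k : ℕ, ∀ᶠ n in atTop, ∀ u ∈ Set.Icc (0 : ℝ) 1,
    0 ≤ b n u ∧ b n u ≤ (n : ℝ) ^ k * (u * (1 - u)) ^ q) ∧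
  ∀ η > 0, ∀ l : ℕ, ∀ᶠ n : ℕ in atTop, ∀ u ∈ Set.Icc (0 : ℝ) 1, η ≤ |u - θ| →
    (n : ℝ) ^ l * b n u ≤ (u * (1 - u)) ^ q

/-- Half of the exponential decay of the binomial probabilities away from `θ` is left after the
square root; the factor `(u (1 - u)) ^ q` is split off by `binomProb_le_mul_binomProb`. -/
theorem concentratesAt_sqrt_binomProb {θ c : ℝ} (hθ : 0 < θ) (hθ1 : θ < 1) {j : ℕ → ℕ}
    (hj : ∀ᶠ n in atTop, |(j n : ℝ) - θ * n| ≤ c) (q : ℕ) :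
    ConcentratesAt θ q fun n u => Real.sqrt (binomProb n (j n) u) := by
  have hlarge : ∀ᶠ n in atTop, 2 * q ≤ j n ∧ j n + 2 * q ≤ n := by
    have h1 : Tendsto (fun n : ℕ => θ * (n : ℝ)) atTop atTop :=
      tendsto_natCast_atTop_atTop.const_mul_atTop hθ
    have h2 : Tendsto (fun n : ℕ => (1 - θ) * (n : ℝ)) atTop atTop :=
      tendsto_natCast_atTop_atTop.const_mul_atTop (sub_pos.2 hθ1)
    filter_upwards [hj, h1.eventually_ge_atTop (2 * q + c), h2.eventually_ge_atTop (2 * q + c)]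
      with n hn h1 h2
    have := abs_le.1 hn
    constructor
    · have : ((2 * q : ℕ) : ℝ) ≤ j n := by push_cast; linarith
      exact_mod_cast this
    · have : ((j n + 2 * q : ℕ) : ℝ) ≤ n := by push_cast; linarith
      exact_mod_cast this
  have hred : ∀ᶠ n : ℕ in atTop, ∀ u ∈ Set.Icc (0 : ℝ) 1, Real.sqrt (binomProb n (j n) u)
      ≤ (n : ℝ) ^ (2 * q) * (u * (1 - u)) ^ q
        * Real.sqrt (binomProb (n - 2 * (2 * q)) (j n - 2 * q) u) := by
    filter_upwards [hlarge] with n hn u hu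
    have h0 : 0 ≤ u * (1 - u) := mul_nonneg hu.1 (sub_nonneg.2 hu.2)
    refine (Real.sqrt_le_sqrt (binomProb_le_mul_binomProb (2 * q) hn.1 hn.2 hu)).trans ?_
    rw [Real.sqrt_mul (by positivity)]
    refine le_of_eq ?_
    congr 1
    generalize u * (1 - u) = w at *
    rw [show ((n : ℝ) ^ 2 * w) ^ (2 * q) = ((n : ℝ) ^ (2 * q) * w ^ q) ^ 2 by ring,
      Real.sqrt_sq (by positivity)]
  refine ⟨⟨2 * q, ?_⟩, ?_⟩
  · filter_upwards [hred] with n hn u hu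
    have h0 : 0 ≤ u * (1 - u) := mul_nonneg hu.1 (sub_nonneg.2 hu.2)
    refine ⟨Real.sqrt_nonneg _, (hn u hu).trans (mul_le_of_le_one_right (by positivity) ?_)⟩
    exact Real.sqrt_le_one.2 (binomProb_le_one _ _ hu)
  · intro η hη l
    set η' := min η 1 with hη'
    have hη'0 : 0 < η' := lt_min hη one_pos
    have hlim : Tendsto (fun n : ℕ => (n : ℝ) ^ (l + 2 * q) *
        (Real.exp (-((η' / 2) ^ 2 / 2)) ^ n)) atTop (nhds 0) := by
      refine tendsto_pow_const_mul_const_pow_of_abs_lt_one _ ?_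
      rw [abs_of_pos (Real.exp_pos _), Real.exp_lt_one_iff]
      have : 0 < (η' / 2) ^ 2 := by positivity
      linarith
    set K := Real.exp ((c + 4 * q + 4 * q * (η' / 2) ^ 2) / 2) with hK
    have hlim' := hlim.const_mul K
    rw [mul_zero] at hlim'
    filter_upwards [hred, hj, hlarge, hlim'.eventually_le_const one_pos] with n hn hjn hln hle u hu
      hfar
    have h0 : 0 ≤ u * (1 - u) := mul_nonneg hu.1 (sub_nonneg.2 hu.2)
    have hcn : ((n - 2 * (2 * q) : ℕ) : ℝ) = n - 4 * q := by
      rw [Nat.cast_sub (by omega)]; push_cast; ring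
    have hcj : ((j n - 2 * q : ℕ) : ℝ) = j n - 2 * q := by
      rw [Nat.cast_sub (by omega)]; push_cast; ring
    have hq0 : (0 : ℝ) ≤ q := Nat.cast_nonneg q
    have hc' : |((j n - 2 * q : ℕ) : ℝ) - θ * ((n - 2 * (2 * q) : ℕ) : ℝ)| ≤ c + 4 * q := by
      rw [hcn, hcj]
      have := abs_le.1 hjn
      rw [abs_le]
      constructor <;> nlinarith
    have h1 := binomProb_le_of_far hu hη'0 (min_le_right _ _) hc' ((min_le_left _ _).trans hfar)
    have h2 : Real.sqrt (binomProb (n - 2 * (2 * q)) (j n - 2 * q) u)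
        ≤ K * Real.exp (-((η' / 2) ^ 2 / 2)) ^ n := by
      refine (Real.sqrt_le_sqrt h1).trans (le_of_eq ?_)
      rw [hK, ← Real.exp_nat_mul, ← Real.exp_add, ← Real.exp_half, hcn]
      congr 1; ring
    calc (n : ℝ) ^ l * Real.sqrt (binomProb n (j n) u)
        ≤ (n : ℝ) ^ l * ((n : ℝ) ^ (2 * q) * (u * (1 - u)) ^ q
          * (K * Real.exp (-((η' / 2) ^ 2 / 2)) ^ n)) := by
          refine mul_le_mul_of_nonneg_left ((hn u hu).trans ?_) (by positivity)
          exact mul_le_mul_of_nonneg_left h2 (by positivity)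
      _ = (K * ((n : ℝ) ^ (l + 2 * q) * Real.exp (-((η' / 2) ^ 2 / 2)) ^ n))
          * (u * (1 - u)) ^ q := by rw [pow_add]; ring
      _ ≤ 1 * (u * (1 - u)) ^ q := mul_le_mul_of_nonneg_right hle (by positivity)
      _ = _ := one_mul _

/-! ### Tails of the distribution function -/

/-- Square integrability of the trimmed mean for a single sample size forces polynomial tails: if
all observations exceed `s ≥ 0`, then so does the sum of the untrimmed ones. -/
theorem integrable_cdf_mul_pow {μ : Measure ℝ} [IsProbabilityMeasure μ] {F : ℝ → ℝ}
    (hF : ∀ x, F x = μ.real (Set.Iic x)) {α β : ℝ} {N : ℕ}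
    (hαβ : ⌊α * N⌋₊ < ⌊β * N⌋₊) (hβ : ⌊β * N⌋₊ ≤ N)
    (ht : MemLp (trimmedMean α β N) 2 (Measure.pi fun _ => μ)) :
    Integrable fun s => (F s * (1 - F s)) ^ N := by
  set C : ℝ := N * ∫ x, trimmedMean α β N x ^ 2 ∂(Measure.pi fun _ => μ) with hC
  have hC0 : 0 ≤ C := mul_nonneg (Nat.cast_nonneg N) (integral_nonneg fun x => sq_nonneg _)
  have hN : (0 : ℝ) < N := by exact_mod_cast (by omega : 0 < N)
  set J : Finset (Fin N) := {i | ⌊α * N⌋₊ + 1 ≤ i.val + 1 ∧ i.val + 1 ≤ ⌊β * N⌋₊} with hJ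
  have hJ1 : (1 : ℝ) ≤ J.card := by
    have : 0 < J.card := Finset.card_pos.2 ⟨⟨⌊α * N⌋₊, by omega⟩, by simp [hJ]; omega⟩
    exact_mod_cast this
  have hsq : ∀ (x : Fin N → ℝ) (s : ℝ), s ^ 2 ≤ (∑ i ∈ J, orderStat x i) ^ 2 →
      s ^ 2 / N ≤ trimmedMean α β N x ^ 2 := by
    intro x s h
    unfold trimmedMean
    rw [mul_pow, inv_pow, Real.sq_sqrt hN.le, div_eq_inv_mul]
    exact mul_le_mul_of_nonneg_left h (by positivity)
  -- Markov's inequality for the event that all observations lie in `A`.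
  have hmarkov : ∀ (A : Set ℝ) (s : ℝ), MeasurableSet A →
      (∀ x : Fin N → ℝ, (∀ i, x i ∈ A) → s ^ 2 / N ≤ trimmedMean α β N x ^ 2) →
      μ.real A ^ N * s ^ 2 ≤ C := by
    intro A s hA h
    have h1 := mul_meas_ge_le_integral_of_nonneg (μ := Measure.pi fun _ : Fin N => μ)
      (f := fun x => trimmedMean α β N x ^ 2) (ae_of_all _ fun x => sq_nonneg _) ht.integrable_sq
      (s ^ 2 / N)
    have h2 : μ.real A ^ N ≤ (Measure.pi fun _ : Fin N => μ).real
        {x | s ^ 2 / N ≤ trimmedMean α β N x ^ 2} := by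
      have h3 : (Measure.pi fun _ : Fin N => μ).real (Set.univ.pi fun _ => A) = μ.real A ^ N := by
        simp [Measure.real, Measure.pi_pi, ENNReal.toReal_pow]
      rw [← h3]
      exact measureReal_mono fun x hx => h x fun i => hx i (Set.mem_univ i)
    have h4 := (mul_le_mul_of_nonneg_left h2 (by positivity : 0 ≤ s ^ 2 / N)).trans h1
    rw [hC, ← div_le_iff₀' hN]
    calc _ = s ^ 2 / N * μ.real A ^ N := by ring
      _ ≤ _ := h4
  have hbase : ∀ s, 0 ≤ F s * (1 - F s) := fun s =>
    mul_nonneg (cdf_nonneg hF s) (sub_nonneg.2 (cdf_le_one hF s))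
  have htail : ∀ s, (F s * (1 - F s)) ^ N * s ^ 2 ≤ C := by
    intro s
    have hF0 := cdf_nonneg hF s
    have hF1 : 0 ≤ 1 - F s := sub_nonneg.2 (cdf_le_one hF s)
    rcases le_total 0 s with hs | hs
    · refine le_trans ?_ (hmarkov (Set.Ioi s) s measurableSet_Ioi fun x hx => hsq x s ?_)
      · have : μ.real (Set.Ioi s) = 1 - F s := by
          rw [hF, ← Set.compl_Iic, probReal_compl_eq_one_sub measurableSet_Iic]
        rw [this]
        gcongr
        exact mul_le_of_le_one_left hF1 (cdf_le_one hF s)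
      · refine pow_le_pow_left₀ hs ?_ 2
        calc s ≤ J.card * s := le_mul_of_one_le_left hs hJ1
          _ = ∑ i ∈ J, s := by simp
          _ ≤ _ := Finset.sum_le_sum fun i _ => (hx _).le
    · refine le_trans ?_ (hmarkov (Set.Iic s) s measurableSet_Iic fun x hx => hsq x s ?_)
      · rw [← hF]
        gcongr
        exact mul_le_of_le_one_right hF0 (by linarith)
      · rw [← neg_sq s, ← neg_sq (∑ i ∈ J, orderStat x i)]
        refine pow_le_pow_left₀ (neg_nonneg.2 hs) (neg_le_neg ?_) 2
        calc ∑ i ∈ J, orderStat x i ≤ ∑ i ∈ J, s := Finset.sum_le_sum fun i _ => hx _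
          _ = J.card * s := by simp
          _ ≤ s := by nlinarith
  refine (integrable_inv_one_add_sq.const_mul (1 + C)).mono' ?_ (ae_of_all _ fun s => ?_)
  · have hFm : Measurable F := (cdf_monotone hF).measurable
    exact ((hFm.mul (measurable_const.sub hFm)).pow_const N).aestronglyMeasurable
  · rw [Real.norm_of_nonneg (pow_nonneg (hbase s) N), ← div_eq_mul_inv, le_div_iff₀ (by positivity),
      mul_add, mul_one]
    have : (F s * (1 - F s)) ^ N ≤ 1 := by
      refine pow_le_one₀ (hbase s) ?_
      have := cdf_nonneg hF s; have := cdf_le_one hF s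
      nlinarith
    linarith [htail s]

/-! ### Integrals of concentrating kernels -/

section

variable {θ θ' : ℝ} {q : ℕ} {b b' : ℕ → ℝ → ℝ} {h : ℕ → ℝ → ℝ → ℝ}

theorem mul_one_sub_nonneg {u : ℝ} (hu : u ∈ Set.Icc (0 : ℝ) 1) : 0 ≤ u * (1 - u) :=
  mul_nonneg hu.1 (sub_nonneg.2 hu.2)

theorem eventually_kernel_le (hb : ConcentratesAt θ q b) (hb' : ConcentratesAt θ' q b')
    (hh : ∀ᶠ n in atTop, ∀ u ∈ Set.Icc (0 : ℝ) 1, ∀ v ∈ Set.Icc (0 : ℝ) 1,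
      0 ≤ h n u v ∧ h n u v ≤ b n u * b' n v) :
    ∃ K : ℕ, ∀ᶠ n : ℕ in atTop, ∀ u ∈ Set.Icc (0 : ℝ) 1, ∀ v ∈ Set.Icc (0 : ℝ) 1,
      |h n u v| ≤ (n : ℝ) ^ K * ((u * (1 - u)) ^ q * (v * (1 - v)) ^ q) := by
  obtain ⟨⟨k, hk⟩, -⟩ := hb
  obtain ⟨⟨k', hk'⟩, -⟩ := hb'
  refine ⟨k + k', ?_⟩
  filter_upwards [hk, hk', hh] with n hn hn' hhn u hu v hv
  have h0 := mul_one_sub_nonneg hu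
  rw [abs_of_nonneg (hhn u hu v hv).1]
  refine (hhn u hu v hv).2.trans ?_
  refine (mul_le_mul (hn u hu).2 (hn' v hv).2 (hn' v hv).1 (by positivity)).trans (le_of_eq ?_)
  rw [pow_add]; ring

theorem eventually_kernel_le_of_far (hb : ConcentratesAt θ q b) (hb' : ConcentratesAt θ' q b')
    (hh : ∀ᶠ n in atTop, ∀ u ∈ Set.Icc (0 : ℝ) 1, ∀ v ∈ Set.Icc (0 : ℝ) 1,
      0 ≤ h n u v ∧ h n u v ≤ b n u * b' n v) {η : ℝ} (hη : 0 < η) :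
    ∀ᶠ n : ℕ in atTop, ∀ u ∈ Set.Icc (0 : ℝ) 1, ∀ v ∈ Set.Icc (0 : ℝ) 1,
      (η ≤ |u - θ| ∨ η ≤ |v - θ'|) →
      (n : ℝ) ^ 2 * |h n u v| ≤ (n : ℝ)⁻¹ * ((u * (1 - u)) ^ q * (v * (1 - v)) ^ q) := by
  obtain ⟨⟨k, hk⟩, hl⟩ := hb
  obtain ⟨⟨k', hk'⟩, hl'⟩ := hb'
  filter_upwards [hk, hk', hh, hl η hη (3 + k'), hl' η hη (3 + k), eventually_gt_atTop 0]
    with n hn hn' hhn hf hf' hn0 u hu v hv hfar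
  have hpos : (0 : ℝ) < n := by exact_mod_cast hn0
  have h0 := mul_one_sub_nonneg hu
  have h0' := mul_one_sub_nonneg hv
  rw [abs_of_nonneg (hhn u hu v hv).1, ← div_eq_inv_mul, le_div_iff₀ hpos]
  have h1 : (n : ℝ) ^ 2 * h n u v * n ≤ (n : ℝ) ^ 3 * (b n u * b' n v) := by
    have := mul_le_mul_of_nonneg_left (hhn u hu v hv).2 (by positivity : (0 : ℝ) ≤ (n : ℝ) ^ 3)
    linarith [this, (by ring : (n : ℝ) ^ 2 * h n u v * n = (n : ℝ) ^ 3 * h n u v)]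
  refine h1.trans ?_
  rcases hfar with hfar | hfar
  · calc (n : ℝ) ^ 3 * (b n u * b' n v)
        ≤ (n : ℝ) ^ 3 * (b n u * ((n : ℝ) ^ k' * (v * (1 - v)) ^ q)) :=
          mul_le_mul_of_nonneg_left (mul_le_mul_of_nonneg_left (hn' v hv).2 (hn u hu).1)
            (by positivity)
      _ = (n : ℝ) ^ (3 + k') * b n u * (v * (1 - v)) ^ q := by rw [pow_add]; ring
      _ ≤ _ := mul_le_mul_of_nonneg_right (hf u hu hfar) (by positivity)
  · calc (n : ℝ) ^ 3 * (b n u * b' n v)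
        ≤ (n : ℝ) ^ 3 * (((n : ℝ) ^ k * (u * (1 - u)) ^ q) * b' n v) :=
          mul_le_mul_of_nonneg_left (mul_le_mul_of_nonneg_right (hn u hu).2 (hn' v hv).1)
            (by positivity)
      _ = (n : ℝ) ^ (3 + k) * b' n v * (u * (1 - u)) ^ q := by rw [pow_add]; ring
      _ ≤ (v * (1 - v)) ^ q * (u * (1 - u)) ^ q :=
        mul_le_mul_of_nonneg_right (hf' v hv hfar) (by positivity)
      _ = _ := mul_comm _ _

variable {E : Type*} [MeasurableSpace E] {ν : Measure E} {G : E → ℝ}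

theorem eventually_integrable_kernel (hb : ConcentratesAt θ q b) (hb' : ConcentratesAt θ' q b')
    (hh : ∀ᶠ n in atTop, ∀ u ∈ Set.Icc (0 : ℝ) 1, ∀ v ∈ Set.Icc (0 : ℝ) 1,
      0 ≤ h n u v ∧ h n u v ≤ b n u * b' n v)
    (hm : ∀ n, Measurable fun w : ℝ × ℝ => h n w.1 w.2) (hG : Measurable G)
    (hG1 : ∀ᵐ s ∂ν, G s ∈ Set.Icc (0 : ℝ) 1) (hint : Integrable (fun s => (G s * (1 - G s)) ^ q) ν)
    {φ : E × E → ℝ} (hφ : Measurable φ) (hφ1 : ∀ᵐ w ∂(ν.prod ν), |φ w| ≤ 1) :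
    ∀ᶠ n in atTop, Integrable (fun w => φ w * h n (G w.1) (G w.2)) (ν.prod ν) := by
  obtain ⟨K, hK⟩ := eventually_kernel_le hb hb' hh
  filter_upwards [hK] with n hn
  refine ((hint.mul_prod hint).const_mul ((n : ℝ) ^ K)).mono' ?_ ?_
  · refine (hφ.mul ?_).aestronglyMeasurable
    exact (hm n).comp ((hG.comp measurable_fst).prodMk (hG.comp measurable_snd))
  · filter_upwards [hφ1, Measure.quasiMeasurePreserving_fst.ae hG1,
      Measure.quasiMeasurePreserving_snd.ae hG1] with w h1 h2 h3
    rw [norm_mul]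
    exact (mul_le_of_le_one_left (norm_nonneg _) h1).trans (hn _ h2 _ h3)

/-- The region where one of the arguments stays away from its concentration point is
asymptotically negligible. -/
theorem tendsto_setIntegral_kernel_far (hb : ConcentratesAt θ q b) (hb' : ConcentratesAt θ' q b')
    (hh : ∀ᶠ n in atTop, ∀ u ∈ Set.Icc (0 : ℝ) 1, ∀ v ∈ Set.Icc (0 : ℝ) 1,
      0 ≤ h n u v ∧ h n u v ≤ b n u * b' n v)
    (hG1 : ∀ᵐ s ∂ν, G s ∈ Set.Icc (0 : ℝ) 1) (hint : Integrable (fun s => (G s * (1 - G s)) ^ q) ν)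
    {φ : E × E → ℝ} (hφ1 : ∀ᵐ w ∂(ν.prod ν), |φ w| ≤ 1)
    {D : Set (E × E)} (hD : MeasurableSet D) {η : ℝ} (hη : 0 < η)
    (hfar : ∀ᵐ w ∂(ν.prod ν), w ∈ D → η ≤ |G w.1 - θ| ∨ η ≤ |G w.2 - θ'|) :
    Tendsto (fun n : ℕ => (n : ℝ) ^ 2 * ∫ w in D, φ w * h n (G w.1) (G w.2) ∂(ν.prod ν)) atTop
      (nhds 0) := by
  set W : E × E → ℝ := fun w => (G w.1 * (1 - G w.1)) ^ q * (G w.2 * (1 - G w.2)) ^ q with hW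
  have hWi : Integrable W (ν.prod ν) := hint.mul_prod hint
  have hW0 : ∀ᵐ w ∂(ν.prod ν), 0 ≤ W w := by
    filter_upwards [Measure.quasiMeasurePreserving_fst.ae hG1,
      Measure.quasiMeasurePreserving_snd.ae hG1] with w h2 h3
    exact mul_nonneg (pow_nonneg (mul_one_sub_nonneg h2) _) (pow_nonneg (mul_one_sub_nonneg h3) _)
  have hlim : Tendsto (fun n : ℕ => (n : ℝ)⁻¹ * ∫ w, W w ∂(ν.prod ν)) atTop (nhds 0) := by
    have := (tendsto_inv_atTop_nhds_zero_nat (𝕜 := ℝ)).mul_const (∫ w, W w ∂(ν.prod ν))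
    rwa [zero_mul] at this
  refine squeeze_zero_norm' ?_ hlim
  filter_upwards [eventually_kernel_le_of_far hb hb' hh hη] with n hn
  rw [← integral_const_mul, ← integral_const_mul]
  refine (norm_integral_le_of_norm_le (hWi.const_mul _).integrableOn ?_).trans
    (setIntegral_le_integral (hWi.const_mul _) ?_)
  · filter_upwards [ae_restrict_of_ae hφ1, ae_restrict_of_ae hfar, ae_restrict_mem hD,
      ae_restrict_of_ae (Measure.quasiMeasurePreserving_fst.ae hG1),
      ae_restrict_of_ae (Measure.quasiMeasurePreserving_snd.ae hG1)] with w h1 h2 h3 h4 h5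
    refine le_trans ?_ (hn _ h4 _ h5 (h2 h3))
    rw [norm_mul, norm_mul, Real.norm_of_nonneg (by positivity : (0 : ℝ) ≤ (n : ℝ) ^ 2)]
    exact mul_le_mul_of_nonneg_left (mul_le_of_le_one_left (norm_nonneg _) h1) (by positivity)
  · filter_upwards [hW0] with w hw
    exact mul_nonneg (by positivity) hw

end

/-- Local regularity of `F` on a compact neighborhood of `ξ`. -/
theorem HasPosLipschitzDensityNear.exists_Icc {F f : ℝ → ℝ} {ξ : ℝ}
    (hf : HasPosLipschitzDensityNear F f ξ) :
    ∃ r > 0, (∀ x ∈ Set.Icc (ξ - r) (ξ + r), HasDerivAt F (f x) x) ∧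
      ContinuousOn f (Set.Icc (ξ - r) (ξ + r)) ∧ (∀ x ∈ Set.Icc (ξ - r) (ξ + r), 0 < f x) ∧
      StrictMonoOn F (Set.Icc (ξ - r) (ξ + r)) := by
  obtain ⟨hpos, ε, hε, K, hderiv, hlip⟩ := hf
  have hcont : ContinuousAt f ξ :=
    hlip.continuousOn.continuousAt (Metric.ball_mem_nhds ξ hε)
  obtain ⟨ρ, hρ, hρpos⟩ := Metric.eventually_nhds_iff.1 (hcont.eventually (lt_mem_nhds hpos))
  have hr : 0 < min ε ρ / 2 := by positivity
  have hsub : ∀ x ∈ Set.Icc (ξ - min ε ρ / 2) (ξ + min ε ρ / 2), dist x ξ < min ε ρ := by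
    intro x hx
    rw [Real.dist_eq]
    have : |x - ξ| ≤ min ε ρ / 2 := by rw [abs_le]; constructor <;> linarith [hx.1, hx.2]
    linarith
  have hd : ∀ x ∈ Set.Icc (ξ - min ε ρ / 2) (ξ + min ε ρ / 2), HasDerivAt F (f x) x := fun x hx =>
    hderiv x ((hsub x hx).trans_le (min_le_left _ _))
  have hp : ∀ x ∈ Set.Icc (ξ - min ε ρ / 2) (ξ + min ε ρ / 2), 0 < f x := fun x hx =>
    hρpos ((hsub x hx).trans_le (min_le_right _ _))
  refine ⟨min ε ρ / 2, hr, hd, ?_, hp, ?_⟩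
  · exact hlip.continuousOn.mono fun x hx => (hsub x hx).trans_le (min_le_left _ _)
  · refine strictMonoOn_of_deriv_pos (convex_Icc _ _)
      (fun x hx => (hd x hx).continuousAt.continuousWithinAt) fun x hx => ?_
    rw [(hd x (interior_subset hx)).deriv]
    exact hp x (interior_subset hx)

theorem exists_le_abs_sub_of_strictMonoOn {F : ℝ → ℝ} {ξ r : ℝ} (hF : Monotone F) (hr : 0 < r)
    (hs : StrictMonoOn F (Set.Icc (ξ - r) (ξ + r))) {ρ : ℝ} (hρ : 0 < ρ) :
    ∃ η > 0, ∀ x, ρ ≤ |x - ξ| → η ≤ |F x - F ξ| := by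
  set δ := min ρ r with hδ
  have hδ0 : 0 < δ := lt_min hρ hr
  have hδr : δ ≤ r := min_le_right _ _
  have hξ : ξ ∈ Set.Icc (ξ - r) (ξ + r) := ⟨by linarith, by linarith⟩
  have h1 : F ξ < F (ξ + δ) := hs hξ ⟨by linarith, by linarith⟩ (by linarith)
  have h2 : F (ξ - δ) < F ξ := hs ⟨by linarith, by linarith⟩ hξ (by linarith)
  refine ⟨min (F (ξ + δ) - F ξ) (F ξ - F (ξ - δ)), lt_min (by linarith) (by linarith), ?_⟩
  intro x hx
  have hδx : δ ≤ |x - ξ| := (min_le_left _ _).trans hx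
  rcases le_total ξ x with h | h
  · rw [abs_of_nonneg (sub_nonneg.2 h)] at hδx
    refine (min_le_left _ _).trans (le_trans ?_ (le_abs_self _))
    linarith [hF (by linarith : ξ + δ ≤ x)]
  · rw [abs_of_nonpos (sub_nonpos.2 h)] at hδx
    refine (min_le_right _ _).trans (le_trans ?_ (neg_le_abs _))
    linarith [hF (by linarith : x ≤ ξ - δ)]

/-! ### Localization at the quantiles -/

/-- Substitution `(u, v) = (F s, F t)` in a double integral. -/
theorem setIntegral_image_prod_image {F f : ℝ → ℝ} {U U' : Set ℝ} (hU : MeasurableSet U)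
    (hU' : MeasurableSet U') (hd : ∀ x ∈ U, HasDerivAt F (f x) x)
    (hd' : ∀ x ∈ U', HasDerivAt F (f x) x) (hi : Set.InjOn F U) (hi' : Set.InjOn F U')
    (hp : ∀ x ∈ U, 0 < f x) (hp' : ∀ x ∈ U', 0 < f x) {g : ℝ → ℝ → ℝ}
    (hg : IntegrableOn (fun w : ℝ × ℝ => g w.1 w.2) ((F '' U) ×ˢ (F '' U')))
    (hg' : IntegrableOn (fun w : ℝ × ℝ => f w.1 * f w.2 * g (F w.1) (F w.2)) (U ×ˢ U')) :
    ∫ w in (F '' U) ×ˢ (F '' U'), g w.1 w.2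
      = ∫ w in U ×ˢ U', f w.1 * f w.2 * g (F w.1) (F w.2) := by
  refine (setIntegral_prod (μ := volume) (ν := volume) _ hg).trans
    (Eq.trans ?_ (setIntegral_prod (μ := volume) (ν := volume) _ hg').symm)
  rw [integral_image_eq_integral_abs_deriv_smul hU
    (fun x hx => (hd x hx).hasDerivWithinAt) hi]
  refine setIntegral_congr_fun hU fun s hs => ?_
  rw [integral_image_eq_integral_abs_deriv_smul hU'
    (fun x hx => (hd' x hx).hasDerivWithinAt) hi', smul_eq_mul, ← integral_const_mul]
  refine setIntegral_congr_fun hU' fun t ht => ?_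
  simp only [abs_of_pos (hp s hs), abs_of_pos (hp' t ht), smul_eq_mul]
  ring

theorem exists_le_abs_sub_of_notMem_image {F : ℝ → ℝ} {ξ r : ℝ} (hr : 0 < r)
    (hs : StrictMonoOn F (Set.Icc (ξ - r) (ξ + r)))
    (hc : ContinuousOn F (Set.Icc (ξ - r) (ξ + r))) :
    ∃ η > 0, ∀ u, u ∉ F '' Set.Icc (ξ - r) (ξ + r) → η ≤ |u - F ξ| := by
  have hξ : ξ ∈ Set.Icc (ξ - r) (ξ + r) := ⟨by linarith, by linarith⟩
  have h1 : F ξ < F (ξ + r) := hs hξ ⟨by linarith, by linarith⟩ (by linarith)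
  have h2 : F (ξ - r) < F ξ := hs ⟨by linarith, by linarith⟩ hξ (by linarith)
  refine ⟨min (F (ξ + r) - F ξ) (F ξ - F (ξ - r)), lt_min (by linarith) (by linarith), ?_⟩
  intro u hu
  have hu' : u ∉ Set.Icc (F (ξ - r)) (F (ξ + r)) := fun h =>
    hu (intermediate_value_Icc (by linarith) hc h)
  rw [Set.mem_Icc, not_and_or, not_le, not_le] at hu'
  rcases hu' with h | h
  · refine (min_le_right _ _).trans (le_trans ?_ (neg_le_abs _)); linarith
  · refine (min_le_left _ _).trans (le_trans ?_ (le_abs_self _)); linarith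

theorem continuous_covSq : Continuous fun w : ℝ × ℝ => covSq w.1 w.2 := by
  unfold covSq; fun_prop

theorem abs_covSq_le_one {u v : ℝ} (hu : u ∈ Set.Icc (0 : ℝ) 1) (hv : v ∈ Set.Icc (0 : ℝ) 1) :
    |covSq u v| ≤ 1 := by
  have h1 : 0 ≤ min u v - u * v := by
    rcases le_total u v with h | h
    · rw [min_eq_left h]; nlinarith [hu.1, hv.2]
    · rw [min_eq_right h]; nlinarith [hv.1, hu.2]
  have h2 : min u v - u * v ≤ 1 := by
    have := mul_nonneg hu.1 hv.1
    linarith [min_le_left u v, hu.2]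
  unfold covSq
  rw [abs_of_nonneg (sq_nonneg _)]
  exact pow_le_one₀ h1 h2

/-- The limit of the double integrals `∫∫ covSq (F s) (F t) h n (F s) (F t) ds dt` for kernels `h n`
on the unit square which concentrate at `(F ξ, F ξ')` with total mass asymptotic to `c / n²`. -/
theorem tendsto_integral_covSq_mul_kernel {F f : ℝ → ℝ} {ξ ξ' : ℝ} {q : ℕ} {b b' : ℕ → ℝ → ℝ}
    {h : ℕ → ℝ → ℝ → ℝ} {c : ℝ} (hF : Monotone F) (hF1 : ∀ x, F x ∈ Set.Icc (0 : ℝ) 1)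
    (hint : Integrable fun s => (F s * (1 - F s)) ^ q)
    (hf : HasPosLipschitzDensityNear F f ξ) (hf' : HasPosLipschitzDensityNear F f ξ')
    (hb : ConcentratesAt (F ξ) q b) (hb' : ConcentratesAt (F ξ') q b')
    (hh : ∀ᶠ n in atTop, ∀ u ∈ Set.Icc (0 : ℝ) 1, ∀ v ∈ Set.Icc (0 : ℝ) 1,
      0 ≤ h n u v ∧ h n u v ≤ b n u * b' n v)
    (hm : ∀ n, Measurable fun w : ℝ × ℝ => h n w.1 w.2) (hc : 0 < c)
    (htot : Tendsto (fun n : ℕ => (n : ℝ) ^ 2 *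
      ∫ w in Set.Icc (0 : ℝ) 1 ×ˢ Set.Icc (0 : ℝ) 1, h n w.1 w.2) atTop (nhds c)) :
    Tendsto (fun n : ℕ => (n : ℝ) ^ 2 *
      ∫ w : ℝ × ℝ, covSq (F w.1) (F w.2) * h n (F w.1) (F w.2)) atTop
      (nhds (c * (covSq (F ξ) (F ξ') / (f ξ * f ξ')))) := by
  obtain ⟨r, hr, hd, hfc, hp, hs⟩ := hf.exists_Icc
  obtain ⟨r', hr', hd', hfc', hp', hs'⟩ := hf'.exists_Icc
  have hsep := fun ρ (hρ : 0 < ρ) => exists_le_abs_sub_of_strictMonoOn hF hr hs hρ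
  have hsep' := fun ρ (hρ : 0 < ρ) => exists_le_abs_sub_of_strictMonoOn hF hr' hs' hρ
  have hFc : ContinuousOn F (Set.Icc (ξ - r) (ξ + r)) := fun x hx =>
    (hd x hx).continuousAt.continuousWithinAt
  have hFc' : ContinuousOn F (Set.Icc (ξ' - r') (ξ' + r')) := fun x hx =>
    (hd' x hx).continuousAt.continuousWithinAt
  obtain ⟨ζ, hζ, hζV⟩ := exists_le_abs_sub_of_notMem_image hr hs hFc
  obtain ⟨ζ', hζ', hζV'⟩ := exists_le_abs_sub_of_notMem_image hr' hs' hFc'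
  have hξU : ξ ∈ Set.Icc (ξ - r) (ξ + r) := ⟨by linarith, by linarith⟩
  have hξU' : ξ' ∈ Set.Icc (ξ' - r') (ξ' + r') := ⟨by linarith, by linarith⟩
  have hUnhds : Set.Icc (ξ - r) (ξ + r) ∈ nhds ξ := Icc_mem_nhds (by linarith) (by linarith)
  have hUnhds' : Set.Icc (ξ' - r') (ξ' + r') ∈ nhds ξ' := Icc_mem_nhds (by linarith) (by linarith)
  have hUout : ∀ x, x ∉ Set.Icc (ξ - r) (ξ + r) → r ≤ |x - ξ| := by
    intro x hx; by_contra hlt; push Not at hlt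
    rw [abs_lt] at hlt; exact hx ⟨by linarith, by linarith⟩
  have hUout' : ∀ x, x ∉ Set.Icc (ξ' - r') (ξ' + r') → r' ≤ |x - ξ'| := by
    intro x hx; by_contra hlt; push Not at hlt
    rw [abs_lt] at hlt; exact hx ⟨by linarith, by linarith⟩
  have hUc : IsCompact (Set.Icc (ξ - r) (ξ + r)) := isCompact_Icc
  have hUc' : IsCompact (Set.Icc (ξ' - r') (ξ' + r')) := isCompact_Icc
  generalize Set.Icc (ξ - r) (ξ + r) = U at *
  generalize Set.Icc (ξ' - r') (ξ' + r') = U' at *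
  have hUm := hUc.measurableSet
  have hUm' := hUc'.measurableSet
  have hVm : MeasurableSet (F '' U) := (hUc.image_of_continuousOn hFc).measurableSet
  have hVm' : MeasurableSet (F '' U') := (hUc'.image_of_continuousOn hFc').measurableSet
  have hV1 : F '' U ⊆ Set.Icc 0 1 := by rintro _ ⟨x, _, rfl⟩; exact hF1 x
  have hV1' : F '' U' ⊆ Set.Icc 0 1 := by rintro _ ⟨x, _, rfl⟩; exact hF1 x
  have hFm : Measurable F := hF.measurable
  -- The total mass is carried by the image of `U × U'`.
  have hmass : Tendsto (fun n : ℕ => (n : ℝ) ^ 2 * ∫ w in (F '' U) ×ˢ (F '' U'), h n w.1 w.2)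
      atTop (nhds c) := by
    set ν : Measure ℝ := volume.restrict (Set.Icc 0 1) with hν
    have hνae : ∀ᵐ s ∂ν, s ∈ Set.Icc (0 : ℝ) 1 := ae_restrict_mem measurableSet_Icc
    have hνint : Integrable (fun s : ℝ => (id s * (1 - id s)) ^ q) ν := by
      refine Continuous.integrableOn_Icc ?_
      simp only [id]; fun_prop
    have hνν : ν.prod ν = (volume : Measure (ℝ × ℝ)).restrict (Set.Icc 0 1 ×ˢ Set.Icc 0 1) :=
      Measure.prod_restrict _ _
    have hD : MeasurableSet (((F '' U) ×ˢ (F '' U'))ᶜ) := (hVm.prod hVm').compl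
    have hfar := tendsto_setIntegral_kernel_far (ν := ν) (G := id) (φ := fun _ => 1) hb hb' hh hνae
      hνint (by simp) hD (lt_min hζ hζ') (by
        refine ae_of_all _ fun w hw => ?_
        rw [Set.mem_compl_iff, Set.mem_prod, not_and_or] at hw
        rcases hw with hw | hw
        · exact Or.inl ((min_le_left _ _).trans (hζV _ hw))
        · exact Or.inr ((min_le_right _ _).trans (hζV' _ hw)))
    have hint' := eventually_integrable_kernel (ν := ν) (G := id) (φ := fun _ => 1) hb hb' hh hm
      measurable_id hνae hνint measurable_const (by simp)
    have hsub := htot.sub hfar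
    rw [sub_zero] at hsub
    refine hsub.congr' ?_
    filter_upwards [hint'] with n hn
    simp only [one_mul, id] at hn ⊢
    have hsplit := integral_add_compl (hVm.prod hVm') hn
    rw [← hνν, ← hsplit, hνν, Measure.restrict_restrict (hVm.prod hVm'),
      Set.inter_eq_left.2 (Set.prod_mono hV1 hV1')]
    ring
  have hprodc : IsCompact (U ×ˢ U') := hUc.prod hUc'
  have hprodm : MeasurableSet (U ×ˢ U') := hUm.prod hUm'
  have hffc : ContinuousOn (fun w : ℝ × ℝ => f w.1 * f w.2) (U ×ˢ U') :=
    (hfc.comp continuousOn_fst fun w hw => hw.1).mul (hfc'.comp continuousOn_snd fun w hw => hw.2)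
  have hffp : ∀ w ∈ U ×ˢ U', 0 < f w.1 * f w.2 := fun w hw => mul_pos (hp _ hw.1) (hp' _ hw.2)
  obtain ⟨M, hM⟩ := hprodc.exists_bound_of_continuousOn hffc
  have hhm : ∀ n, Measurable fun w : ℝ × ℝ => h n (F w.1) (F w.2) := fun n =>
    (hm n).comp ((hFm.comp measurable_fst).prodMk (hFm.comp measurable_snd))
  have hae1 : ∀ᵐ s : ℝ, F s ∈ Set.Icc (0 : ℝ) 1 := ae_of_all _ hF1
  have hcov1 : ∀ᵐ w : ℝ × ℝ, |covSq (F w.1) (F w.2)| ≤ 1 :=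
    ae_of_all _ fun w => abs_covSq_le_one (hF1 _) (hF1 _)
  have hcovm : Measurable fun w : ℝ × ℝ => covSq (F w.1) (F w.2) :=
    continuous_covSq.measurable.comp ((hFm.comp measurable_fst).prodMk (hFm.comp measurable_snd))
  have hone := eventually_integrable_kernel (ν := volume) (G := F) (φ := fun _ => 1) hb hb' hh hm
    hFm hae1 hint measurable_const (by simp)
  have hcovint := eventually_integrable_kernel (ν := volume) (G := F)
    (φ := fun w => covSq (F w.1) (F w.2)) hb hb' hh hm hFm hae1 hint hcovm hcov1
  have hφm : ∀ n, AEStronglyMeasurable (fun w : ℝ × ℝ => f w.1 * f w.2 * h n (F w.1) (F w.2))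
      (volume.restrict (U ×ˢ U')) := fun n =>
    (hffc.aestronglyMeasurable hprodm).mul (hhm n).aestronglyMeasurable
  have hmass' : Tendsto (fun n : ℕ => ∫ w in U ×ˢ U',
      c⁻¹ * ((n : ℝ) ^ 2 * (f w.1 * f w.2 * h n (F w.1) (F w.2)))) atTop (nhds 1) := by
    have h1 := hmass.const_mul c⁻¹
    rw [inv_mul_cancel₀ hc.ne'] at h1
    refine h1.congr' ?_
    have hV := eventually_integrable_kernel (ν := volume.restrict (Set.Icc (0 : ℝ) 1)) (G := id)
      (φ := fun _ => 1) hb hb' hh hm measurable_id (ae_restrict_mem measurableSet_Icc)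
      (by refine Continuous.integrableOn_Icc ?_; simp only [id]; fun_prop) measurable_const
      (by simp)
    filter_upwards [hone, hV] with n hn hn'
    simp only [one_mul, id] at hn hn'
    rw [Measure.prod_restrict] at hn'
    rw [integral_const_mul, integral_const_mul, setIntegral_image_prod_image hUm hUm' hd hd'
      hs.injOn hs'.injOn hp hp' (IntegrableOn.mono_set hn' (Set.prod_mono hV1 hV1'))]
    refine Integrable.mono' ((hn.norm.const_mul M).integrableOn) (hφm n) ?_
    filter_upwards [ae_restrict_mem hprodm] with w hw
    rw [norm_mul]
    exact mul_le_mul_of_nonneg_right (hM w hw) (norm_nonneg _)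
  -- After the substitution, `f s * f t * h n (F s) (F t)` is an approximate identity at `(ξ, ξ')`.
  have hpeak := tendsto_setIntegral_peak_smul_of_integrableOn_of_tendsto (μ := volume)
    (φ := fun (n : ℕ) (w : ℝ × ℝ) => c⁻¹ * ((n : ℝ) ^ 2 * (f w.1 * f w.2 * h n (F w.1) (F w.2))))
    (g := fun w => covSq (F w.1) (F w.2) / (f w.1 * f w.2)) (x₀ := (ξ, ξ'))
    (a := covSq (F ξ) (F ξ') / (f ξ * f ξ')) (s := U ×ˢ U') (t := U ×ˢ U') (l := atTop)
    hprodm hprodm subset_rfl self_mem_nhdsWithin hprodc.measure_lt_top.ne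
    (by
      filter_upwards [hh] with n hn w hw
      have := (hn _ (hF1 w.1) _ (hF1 w.2)).1
      have := (hffp w hw).le
      positivity)
    (by
      intro u hu hxu
      obtain ⟨ρ, hρ, hball⟩ := Metric.isOpen_iff.1 hu _ hxu
      obtain ⟨η, hη, hηF⟩ := hsep ρ hρ
      obtain ⟨η', hη', hηF'⟩ := hsep' ρ hρ
      rw [Metric.tendstoUniformlyOn_iff]
      intro ε hε
      have hlim : Tendsto (fun n : ℕ => c⁻¹ * (M * (n : ℝ)⁻¹)) atTop (nhds 0) := by
        have := ((tendsto_inv_atTop_nhds_zero_nat (𝕜 := ℝ)).const_mul M).const_mul c⁻¹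
        simpa using this
      filter_upwards [eventually_kernel_le_of_far hb hb' hh (lt_min hη hη'),
        hlim.eventually_lt_const hε] with n hn hnε w hw
      have hfar : min η η' ≤ |F w.1 - F ξ| ∨ min η η' ≤ |F w.2 - F ξ'| := by
        have : w ∉ Metric.ball (ξ, ξ') ρ := fun h => hw.2 (hball h)
        rw [Metric.mem_ball, Prod.dist_eq, max_lt_iff, not_and_or, not_lt, not_lt,
          Real.dist_eq, Real.dist_eq] at this
        exact this.imp (fun h => (min_le_left _ _).trans (hηF _ h))
          fun h => (min_le_right _ _).trans (hηF' _ h)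
      have hk := hn _ (hF1 w.1) _ (hF1 w.2) hfar
      have hMw := hM w hw.1
      have hM0 : 0 ≤ M := (norm_nonneg _).trans hMw
      have hw1 : ∀ x, (F x * (1 - F x)) ^ q ≤ 1 := fun x => by
        refine pow_le_one₀ (mul_one_sub_nonneg (hF1 x)) ?_
        nlinarith [(hF1 x).1, (hF1 x).2]
      have hk' : (n : ℝ) ^ 2 * |h n (F w.1) (F w.2)| ≤ (n : ℝ)⁻¹ := by
        refine hk.trans (mul_le_of_le_one_right (by positivity) ?_)
        exact mul_le_one₀ (hw1 _) (pow_nonneg (mul_one_sub_nonneg (hF1 _)) _) (hw1 _)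
      rw [Pi.zero_apply, dist_zero_left]
      refine lt_of_le_of_lt ?_ hnε
      rw [norm_mul, Real.norm_of_nonneg (inv_nonneg.2 hc.le)]
      refine mul_le_mul_of_nonneg_left ?_ (inv_nonneg.2 hc.le)
      rw [norm_mul, norm_mul, Real.norm_of_nonneg (by positivity : (0 : ℝ) ≤ (n : ℝ) ^ 2)]
      calc (n : ℝ) ^ 2 * (‖f w.1 * f w.2‖ * ‖h n (F w.1) (F w.2)‖)
          = ‖f w.1 * f w.2‖ * ((n : ℝ) ^ 2 * |h n (F w.1) (F w.2)|) := by
            rw [Real.norm_eq_abs (h n _ _)]; ring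
        _ ≤ M * (n : ℝ)⁻¹ := mul_le_mul hMw hk' (by positivity) hM0)
    hmass'
    (Eventually.of_forall fun n => ((hφm n).const_mul _).const_mul _)
    (by
      refine ContinuousOn.integrableOn_compact hprodc (ContinuousOn.div ?_ hffc fun w hw =>
        (hffp w hw).ne')
      exact continuous_covSq.comp_continuousOn
        ((hFc.comp continuousOn_fst fun w hw => hw.1).prodMk
          (hFc'.comp continuousOn_snd fun w hw => hw.2)))
    (by
      refine Tendsto.mono_left ?_ nhdsWithin_le_nhds
      have hc1 : ContinuousAt (fun w : ℝ × ℝ => F w.1) (ξ, ξ') :=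
        ContinuousAt.comp (f := Prod.fst) (g := F) (hd ξ hξU).continuousAt continuousAt_fst
      have hc2 : ContinuousAt (fun w : ℝ × ℝ => F w.2) (ξ, ξ') :=
        ContinuousAt.comp (f := Prod.snd) (g := F) (hd' ξ' hξU').continuousAt continuousAt_snd
      have hc3 : ContinuousAt (fun w : ℝ × ℝ => f w.1 * f w.2) (ξ, ξ') :=
        hffc.continuousAt (prod_mem_nhds hUnhds hUnhds')
      exact ContinuousAt.div
        (ContinuousAt.comp (f := fun w : ℝ × ℝ => (F w.1, F w.2)) (g := fun w => covSq w.1 w.2)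
          continuous_covSq.continuousAt (hc1.prodMk hc2)) hc3 (hffp _ ⟨hξU, hξU'⟩).ne')
  obtain ⟨η, hη, hηF⟩ := hsep r hr
  obtain ⟨η', hη', hηF'⟩ := hsep' r' hr'
  have hrest := tendsto_setIntegral_kernel_far (ν := volume) (G := F)
    (φ := fun w => covSq (F w.1) (F w.2)) hb hb' hh hae1 hint hcov1 hprodm.compl (lt_min hη hη')
    (by
      refine ae_of_all _ fun w hw => ?_
      rw [Set.mem_compl_iff, Set.mem_prod, not_and_or] at hw
      rcases hw with hw | hw
      · exact Or.inl ((min_le_left _ _).trans (hηF _ (hUout _ hw)))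
      · exact Or.inr ((min_le_right _ _).trans (hηF' _ (hUout' _ hw))))
  have hsum := (hpeak.const_mul c).add hrest
  rw [add_zero] at hsum
  refine hsum.congr' ?_
  filter_upwards [hcovint] with n hn
  have hsplit := integral_add_compl hprodm hn
  change _ = (n : ℝ) ^ 2 * ∫ w, covSq (F w.1) (F w.2) * h n (F w.1) (F w.2)
    ∂((volume : Measure ℝ).prod volume)
  rw [← hsplit, mul_add]
  congr 1
  rw [← integral_const_mul, ← integral_const_mul]
  refine setIntegral_congr_fun hprodm fun w hw => ?_
  have h1 := (hp _ hw.1).ne'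
  have h2 := (hp' _ hw.2).ne'
  simp only [smul_eq_mul]
  field_simp

/-! ### The total mass of the level kernels -/

open Nat in
/-- The beta integral with natural exponents on the interval `[v, w]`. -/
theorem integral_sub_pow_mul_sub_pow (v w : ℝ) (a b : ℕ) :
    ∫ u in v..w, (u - v) ^ a * (w - u) ^ b
      = (w - v) ^ (a + b + 1) * (a ! * b ! / (a + b + 1)! : ℝ) := by
  induction b generalizing a with
  | zero =>
    simp only [pow_zero, mul_one, add_zero, factorial_zero, Nat.cast_one]
    rw [intervalIntegral.integral_comp_sub_right (fun u => u ^ a), integral_pow, sub_self,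
      zero_pow (by omega), sub_zero, factorial_succ]
    push_cast
    have : (a ! : ℝ) ≠ 0 := by positivity
    have : (a + 1 : ℝ) ≠ 0 := by positivity
    field_simp
  | succ b ih =>
    have hd : ∀ u ∈ Set.uIcc v w, HasDerivAt (fun u => (u - v) ^ (a + 1) * (w - u) ^ (b + 1))
        ((a + 1) * ((u - v) ^ a * (w - u) ^ (b + 1))
          - (b + 1) * ((u - v) ^ (a + 1) * (w - u) ^ b)) u := by
      intro u _
      have h1 : HasDerivAt (fun u => (u - v) ^ (a + 1)) ((a + 1 : ℕ) * (u - v) ^ a * 1) u :=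
        ((hasDerivAt_id u).sub_const v).pow (a + 1)
      have h2 : HasDerivAt (fun u => (w - u) ^ (b + 1)) ((b + 1 : ℕ) * (w - u) ^ b * (-1)) u :=
        ((hasDerivAt_id u).const_sub w).pow (b + 1)
      refine (h1.mul h2).congr_deriv ?_
      push_cast [Nat.add_sub_cancel]; ring
    have h0 := intervalIntegral.integral_eq_sub_of_hasDerivAt hd
      (by apply Continuous.intervalIntegrable; fun_prop)
    rw [intervalIntegral.integral_sub (by apply Continuous.intervalIntegrable; fun_prop)
      (by apply Continuous.intervalIntegrable; fun_prop), intervalIntegral.integral_const_mul,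
      intervalIntegral.integral_const_mul, ih (a + 1)] at h0
    simp only [sub_self, zero_pow (Nat.succ_ne_zero _), mul_zero, zero_mul] at h0
    have h3 : (a + 1 : ℝ) ≠ 0 := by positivity
    rw [show a + 1 + b + 1 = a + (b + 1) + 1 by ring, factorial_succ a] at h0
    rw [factorial_succ b]
    push_cast at h0 ⊢
    have h4 : ((a + (b + 1) + 1)! : ℝ) ≠ 0 := by positivity
    apply mul_left_cancel₀ h3
    rw [sub_eq_zero.1 h0]
    ring

theorem integral_binomProb {n p : ℕ} (hp : p ≤ n) :
    ∫ u in Set.Icc (0 : ℝ) 1, binomProb n p u = 1 / (n + 1) := by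
  rw [integral_Icc_eq_integral_Ioc, ← intervalIntegral.integral_of_le zero_le_one]
  have h := integral_sub_pow_mul_sub_pow 0 1 p (n - p)
  simp only [sub_zero, one_pow, one_mul] at h
  unfold binomProb
  simp only [mul_assoc]
  rw [intervalIntegral.integral_const_mul, h, show p + (n - p) + 1 = n + 1 by omega,
    Nat.cast_choose ℝ hp, Nat.factorial_succ]
  have h1 : (p.factorial : ℝ) ≠ 0 := by positivity
  have h2 : ((n - p).factorial : ℝ) ≠ 0 := by positivity
  have h3 : (n.factorial : ℝ) ≠ 0 := by positivity
  push_cast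
  field_simp

theorem integral_binomProb_mul_binomProb {n p q : ℕ} (hp : p ≤ n) (hq : q ≤ n) :
    ∫ w in Set.Icc (0 : ℝ) 1 ×ˢ Set.Icc (0 : ℝ) 1, levelKernel False n p q w.1 w.2
      = 1 / ((n : ℝ) + 1) ^ 2 := by
  have := setIntegral_prod_mul (μ := volume) (ν := volume) (binomProb n p) (binomProb n q)
    (Set.Icc 0 1) (Set.Icc 0 1)
  rw [integral_binomProb hp, integral_binomProb hq] at this
  simp only [levelKernel, if_false]
  refine this.trans ?_
  rw [sq, one_div_mul_one_div]

/-- The total mass of the joint probabilities. Two uniform variables added to a sample of size `n`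
are equally likely to occupy any of the `(n + 1) (n + 2)` ordered pairs of different ranks; for
`p = q` they are neighbors, in either order. -/
theorem integral_jointProb {n p q : ℕ} (hpq : p ≤ q) (hq : q ≤ n) :
    ∫ w in Set.Icc (0 : ℝ) 1 ×ˢ Set.Icc (0 : ℝ) 1, levelKernel True n p q w.1 w.2
      = (if p = q then 2 else 1) / (((n : ℝ) + 1) * (n + 2)) := by
  have hp : p ≤ n := hpq.trans hq
  have hbd : ∀ u ∈ Set.Icc (0 : ℝ) 1, ∀ v ∈ Set.Icc (0 : ℝ) 1,
      ‖levelKernel True n p q u v‖ ≤ 1 := by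
    intro u hu v hv
    have h := levelKernel_bounds True hp hq hu hv
    rw [Real.norm_of_nonneg h.1]
    exact h.2.trans (mul_le_one₀ (Real.sqrt_le_one.2 (binomProb_le_one _ _ hu)) (Real.sqrt_nonneg _)
      (Real.sqrt_le_one.2 (binomProb_le_one _ _ hv)))
  have hm := measurable_levelKernel True n p q
  have hint : IntegrableOn (fun w : ℝ × ℝ => levelKernel True n p q w.1 w.2)
      (Set.Icc (0 : ℝ) 1 ×ˢ Set.Icc (0 : ℝ) 1) := by
    refine Measure.integrableOn_of_bounded (M := 1)
      (isCompact_Icc.prod isCompact_Icc).measure_ne_top hm.aestronglyMeasurable ?_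
    filter_upwards [ae_restrict_mem (measurableSet_Icc.prod measurableSet_Icc)] with w hw
    exact hbd _ hw.1 _ hw.2
  have hinner : ∀ u ∈ Set.Icc (0 : ℝ) 1, ∫ v in Set.Icc (0 : ℝ) 1, levelKernel True n p q u v
      = (n.choose p * p.choose q * (q.factorial * (p - q).factorial / (q + (p - q) + 1).factorial))
          * (u ^ (q + (p - q) + 1) * (1 - u) ^ (n - p))
        + (n.choose q * q.choose p * ((q - p).factorial * (n - q).factorial
            / (q - p + (n - q) + 1).factorial))
          * (u ^ p * (1 - u) ^ (q - p + (n - q) + 1)) := by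
    intro u hu
    have hi : IntegrableOn (fun v => levelKernel True n p q u v) (Set.Icc 0 1) := by
      refine Measure.integrableOn_of_bounded (M := 1) isCompact_Icc.measure_ne_top
        (hm.comp measurable_prodMk_left).aestronglyMeasurable ?_
      filter_upwards [ae_restrict_mem measurableSet_Icc] with v hv
      exact hbd u hu v hv
    have hii : ∀ {x y : ℝ}, x ∈ Set.Icc (0 : ℝ) 1 → y ∈ Set.Icc (0 : ℝ) 1 →
        IntervalIntegrable (fun v => levelKernel True n p q u v) volume x y := fun hx hy =>
      (hi.mono_set (Set.uIcc_subset_Icc hx hy)).intervalIntegrable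
    have h0 : (0 : ℝ) ∈ Set.Icc (0 : ℝ) 1 := by simp
    have h1 : (1 : ℝ) ∈ Set.Icc (0 : ℝ) 1 := by simp
    rw [integral_Icc_eq_integral_Ioc, ← intervalIntegral.integral_of_le zero_le_one,
      ← intervalIntegral.integral_add_adjacent_intervals (hii h0 hu) (hii hu h1)]
    congr 1
    · have hc : ∫ v in (0 : ℝ)..u, levelKernel True n p q u v
          = ∫ v in (0 : ℝ)..u, (n.choose p * p.choose q * (1 - u) ^ (n - p))
            * ((v - 0) ^ q * (u - v) ^ (p - q)) := by
        refine intervalIntegral.integral_congr fun v hv => ?_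
        rw [Set.uIcc_of_le hu.1] at hv
        simp only [levelKernel, if_true]
        rw [jointProb_comm, jointProb, if_pos hv.2, sub_zero]
        ring
      rw [hc, intervalIntegral.integral_const_mul, integral_sub_pow_mul_sub_pow, sub_zero]
      ring
    · have hc : ∫ v in u..1, levelKernel True n p q u v
          = ∫ v in u..1, (n.choose q * q.choose p * u ^ p)
            * ((v - u) ^ (q - p) * (1 - v) ^ (n - q)) := by
        refine intervalIntegral.integral_congr fun v hv => ?_
        rw [Set.uIcc_of_le hu.2] at hv
        simp only [levelKernel, if_true]
        rw [jointProb, if_pos hv.1]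
        ring
      rw [hc, intervalIntegral.integral_const_mul, integral_sub_pow_mul_sub_pow]
      ring
  have hbeta : ∀ a b : ℕ, ∫ u in Set.Icc (0 : ℝ) 1, u ^ a * (1 - u) ^ b
      = (a.factorial * b.factorial / (a + b + 1).factorial : ℝ) := by
    intro a b
    have h := integral_sub_pow_mul_sub_pow 0 1 a b
    simp only [sub_zero, one_pow, one_mul] at h
    rw [integral_Icc_eq_integral_Ioc, ← intervalIntegral.integral_of_le zero_le_one, h]
  refine (setIntegral_prod (μ := volume) (ν := volume) _ hint).trans ?_
  rw [setIntegral_congr_fun measurableSet_Icc hinner, integral_add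
    (by apply Continuous.integrableOn_Icc; fun_prop)
    (by apply Continuous.integrableOn_Icc; fun_prop),
    integral_const_mul, integral_const_mul, hbeta, hbeta]
  have hfac : ∀ k : ℕ, (k.factorial : ℝ) ≠ 0 := fun k => by positivity
  have hn1 : (n + 1 : ℝ) ≠ 0 := by positivity
  have hn2 : (n + 2 : ℝ) ≠ 0 := by positivity
  have hn2f : ((n + 2).factorial : ℝ) = (n + 2) * ((n + 1) * n.factorial) := by
    rw [Nat.factorial_succ, Nat.factorial_succ]; push_cast; ring
  have hsecond : (n.choose q * q.choose p * ((q - p).factorial * (n - q).factorial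
            / (q - p + (n - q) + 1).factorial))
          * (p.factorial * (q - p + (n - q) + 1).factorial
            / (p + (q - p + (n - q) + 1) + 1).factorial) = (1 / ((n + 1) * (n + 2)) : ℝ) := by
    rw [Nat.cast_choose ℝ hpq, Nat.cast_choose ℝ hq,
      show p + (q - p + (n - q) + 1) + 1 = n + 2 by omega, hn2f]
    have := hfac p; have := hfac q; have := hfac (q - p); have := hfac (n - q); have := hfac n
    have := hfac (q - p + (n - q) + 1)
    field_simp
  rw [hsecond]
  rcases hpq.lt_or_eq with h | rfl
  · rw [if_neg h.ne, Nat.choose_eq_zero_of_lt h]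
    simp
  · have hfirst : (n.choose p * p.choose p * (p.factorial * (p - p).factorial
          / (p + (p - p) + 1).factorial))
          * ((p + (p - p) + 1).factorial * (n - p).factorial
            / (p + (p - p) + 1 + (n - p) + 1).factorial) = (1 / ((n + 1) * (n + 2)) : ℝ) := by
      rw [show p + (p - p) + 1 + (n - p) + 1 = n + 2 by omega, hn2f, Nat.cast_choose ℝ hp,
        Nat.choose_self, Nat.sub_self]
      have := hfac p; have := hfac (n - p); have := hfac n
      have := hfac (p + 0 + 1)
      simp only [Nat.factorial_zero, Nat.cast_one]
      field_simp
    rw [hfirst, if_pos rfl]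
    ring

/-! ### Quantiles -/

section

variable {μ : Measure ℝ} [IsProbabilityMeasure μ] {F : ℝ → ℝ}

theorem quantile_set_nonempty (hF : ∀ x, F x = μ.real (Set.Iic x)) {θ : ℝ} (h1 : θ < 1) :
    {x | θ ≤ F x}.Nonempty := by
  have h : Tendsto F atTop (nhds 1) := by
    refine (tendsto_cdf_atTop μ).congr fun x => ?_
    rw [cdf_eq_real, hF]
  obtain ⟨x, hx⟩ := (h.eventually (lt_mem_nhds h1)).exists
  exact ⟨x, hx.le⟩

theorem quantile_set_bddBelow (hF : ∀ x, F x = μ.real (Set.Iic x)) {θ : ℝ} (h0 : 0 < θ) :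
    BddBelow {x | θ ≤ F x} := by
  have h : Tendsto F atBot (nhds 0) := by
    refine (tendsto_cdf_atBot μ).congr fun x => ?_
    rw [cdf_eq_real, hF]
  obtain ⟨x, hx⟩ := (h.eventually (gt_mem_nhds h0)).exists
  refine ⟨x, fun y hy => ?_⟩
  by_contra! hlt
  exact absurd (hy.trans (cdf_monotone hF hlt.le)) (not_le.2 hx)

theorem lt_of_lt_quantile (hF : ∀ x, F x = μ.real (Set.Iic x)) {θ : ℝ} (h0 : 0 < θ) {x : ℝ}
    (hx : x < quantile F θ) : F x < θ := by
  by_contra! h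
  exact absurd (csInf_le (quantile_set_bddBelow hF h0) h) (not_le.2 hx)

theorem le_of_quantile_lt (hF : ∀ x, F x = μ.real (Set.Iic x)) {θ : ℝ} (h1 : θ < 1) {x : ℝ}
    (hx : quantile F θ < x) : θ ≤ F x := by
  obtain ⟨y, hy, hyx⟩ := exists_lt_of_csInf_lt (quantile_set_nonempty hF h1) hx
  exact le_trans hy (cdf_monotone hF hyx.le)

theorem cdf_quantile (hF : ∀ x, F x = μ.real (Set.Iic x)) {θ : ℝ} (h0 : 0 < θ) (h1 : θ < 1)
    (hc : ContinuousAt F (quantile F θ)) : F (quantile F θ) = θ := by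
  apply le_antisymm
  · refine le_of_tendsto
      (hc.tendsto.mono_left (nhdsWithin_le_nhds (s := Set.Iio (quantile F θ)))) ?_
    filter_upwards [self_mem_nhdsWithin] with x hx
    exact (lt_of_lt_quantile hF h0 hx).le
  · refine ge_of_tendsto
      (hc.tendsto.mono_left (nhdsWithin_le_nhds (s := Set.Ioi (quantile F θ)))) ?_
    filter_upwards [self_mem_nhdsWithin] with x hx
    exact le_of_quantile_lt hF h1 hx

theorem quantile_mono (hF : ∀ x, F x = μ.real (Set.Iic x)) {θ θ' : ℝ} (h0 : 0 < θ) (h : θ ≤ θ')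
    (h1 : θ' < 1) : quantile F θ ≤ quantile F θ' :=
  csInf_le_csInf (quantile_set_bddBelow hF h0) (quantile_set_nonempty hF h1)
    fun _ hx => h.trans hx

end

theorem HasPosLipschitzDensityNear.continuousAt {F f : ℝ → ℝ} {ξ : ℝ}
    (hf : HasPosLipschitzDensityNear F f ξ) : ContinuousAt F ξ := by
  obtain ⟨-, ε, hε, K, hd, -⟩ := hf
  exact (hd ξ (Metric.mem_ball_self hε)).continuousAt

/-! ### The limits of the kernel integrals -/

theorem kernelIntegral_comm (F : ℝ → ℝ) (diag : Prop) [Decidable diag] (n p q : ℕ) :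
    kernelIntegral F diag n p q = kernelIntegral F diag n q p := by
  unfold kernelIntegral
  rw [Measure.volume_eq_prod, ← integral_prod_swap]
  refine integral_congr_ae (Eventually.of_forall fun w => ?_)
  simp only [Prod.fst_swap, Prod.snd_swap, covSq, levelKernel]
  rw [min_comm, mul_comm (F w.2), jointProb_comm, mul_comm (binomProb n p (F w.2))]

theorem tendsto_sq_div_add_one_mul_add_two :
    Tendsto (fun n : ℕ => (n : ℝ) ^ 2 * (1 / (((n : ℝ) + 1) * (n + 2)))) atTop (nhds 1) := by
  have h1 := tendsto_natCast_div_add_atTop (1 : ℝ)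
  have h2 := tendsto_natCast_div_add_atTop (2 : ℝ)
  refine ((h1.mul h2).congr fun n => ?_).trans (by simp)
  field_simp

theorem tendsto_sq_div_add_one_sq :
    Tendsto (fun n : ℕ => (n : ℝ) ^ 2 * (1 / ((n : ℝ) + 1) ^ 2)) atTop (nhds 1) := by
  have h1 := tendsto_natCast_div_add_atTop (1 : ℝ)
  refine ((h1.mul h1).congr fun n => ?_).trans (by simp)
  field_simp

section

variable {F f : ℝ → ℝ} {ξ ξ' k : ℝ} {N : ℕ} {p q : ℕ → ℕ}

theorem tendsto_kernelIntegral (hF : Monotone F) (hF1 : ∀ x, F x ∈ Set.Icc (0 : ℝ) 1)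
    (hint : Integrable fun s => (F s * (1 - F s)) ^ N)
    (hf : HasPosLipschitzDensityNear F f ξ) (hf' : HasPosLipschitzDensityNear F f ξ')
    (h0 : 0 < F ξ) (h1 : F ξ < 1) (h0' : 0 < F ξ') (h1' : F ξ' < 1)
    (hp : ∀ᶠ n in atTop, |(p n : ℝ) - F ξ * n| ≤ k) (hq : ∀ᶠ n in atTop, |(q n : ℝ) - F ξ' * n| ≤ k)
    (hpn : ∀ᶠ n in atTop, p n ≤ n) (hqn : ∀ᶠ n in atTop, q n ≤ n)
    (diag : Prop) [Decidable diag] {c : ℝ} (hc : 0 < c)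
    (htot : Tendsto (fun n : ℕ => (n : ℝ) ^ 2 * ∫ w in Set.Icc (0 : ℝ) 1 ×ˢ Set.Icc (0 : ℝ) 1,
      levelKernel diag n (p n) (q n) w.1 w.2) atTop (nhds c)) :
    Tendsto (fun n : ℕ => (n : ℝ) ^ 2 * kernelIntegral F diag n (p n) (q n)) atTop
      (nhds (c * (covSq (F ξ) (F ξ') / (f ξ * f ξ')))) := by
  refine tendsto_integral_covSq_mul_kernel hF hF1 hint hf hf'
    (concentratesAt_sqrt_binomProb h0 h1 hp N) (concentratesAt_sqrt_binomProb h0' h1' hq N) ?_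
    (fun n => measurable_levelKernel diag n (p n) (q n)) hc htot
  filter_upwards [hpn, hqn] with n hn hn' u hu v hv
  exact levelKernel_bounds diag hn hn' hu hv

theorem eventually_integrable_levelKernel (hF : Monotone F) (hF1 : ∀ x, F x ∈ Set.Icc (0 : ℝ) 1)
    (hint : Integrable fun s => (F s * (1 - F s)) ^ N)
    (h0 : 0 < F ξ) (h1 : F ξ < 1) (h0' : 0 < F ξ') (h1' : F ξ' < 1)
    (hp : ∀ᶠ n in atTop, |(p n : ℝ) - F ξ * n| ≤ k) (hq : ∀ᶠ n in atTop, |(q n : ℝ) - F ξ' * n| ≤ k)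
    (hpn : ∀ᶠ n in atTop, p n ≤ n) (hqn : ∀ᶠ n in atTop, q n ≤ n)
    (diag : Prop) [Decidable diag] :
    ∀ᶠ n in atTop, Integrable fun w : ℝ × ℝ => levelKernel diag n (p n) (q n) (F w.1) (F w.2) := by
  have h := eventually_integrable_kernel (ν := (volume : Measure ℝ)) (φ := fun _ => 1)
    (concentratesAt_sqrt_binomProb h0 h1 hp N) (concentratesAt_sqrt_binomProb h0' h1' hq N)
    (h := fun n u v => levelKernel diag n (p n) (q n) u v) ?_
    (fun n => measurable_levelKernel diag n (p n) (q n)) hF.measurable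
    (Eventually.of_forall hF1) hint measurable_const (Eventually.of_forall fun _ => by simp)
  · simpa only [one_mul, ← Measure.volume_eq_prod] using h
  · filter_upwards [hpn, hqn] with n hn hn' u hu v hv
    exact levelKernel_bounds diag hn hn' hu hv

end

/-! ### The asymptotics of the higher order sum -/


theorem abs_floor_pred_sub_le {θ : ℝ} (h0 : 0 ≤ θ) (h1 : θ ≤ 1) (n : ℕ) :
    |((⌊θ * (n + 2 : ℕ)⌋₊ - 1 : ℕ) : ℝ) - θ * n| ≤ 3 := by
  have h2 : (⌊θ * (n + 2 : ℕ)⌋₊ : ℝ) ≤ θ * (n + 2 : ℕ) := Nat.floor_le (by positivity)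
  have h3 := Nat.lt_floor_add_one (θ * (n + 2 : ℕ))
  have h4 : ((⌊θ * (n + 2 : ℕ)⌋₊ - 1 : ℕ) : ℝ) ≤ ⌊θ * (n + 2 : ℕ)⌋₊ := by
    exact_mod_cast Nat.sub_le _ _
  have h5 : (⌊θ * (n + 2 : ℕ)⌋₊ : ℝ) ≤ ((⌊θ * (n + 2 : ℕ)⌋₊ - 1 : ℕ) : ℝ) + 1 := by
    exact_mod_cast Nat.le_add_of_sub_le le_rfl
  push_cast at *
  rw [abs_le]; constructor <;> nlinarith

theorem floor_mul_le {θ : ℝ} (h1 : θ ≤ 1) (n : ℕ) : ⌊θ * n⌋₊ ≤ n :=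
  Nat.floor_le_of_le (mul_le_of_le_one_left (Nat.cast_nonneg n) h1)

theorem eventually_floor_lt {α β : ℝ} (hα : 0 < α) (hαβ : α < β) :
    ∀ᶠ N : ℕ in atTop, 1 ≤ ⌊α * N⌋₊ ∧ ⌊α * N⌋₊ < ⌊β * N⌋₊ := by
  have h1 : Tendsto (fun N : ℕ => α * (N : ℝ)) atTop atTop :=
    tendsto_natCast_atTop_atTop.const_mul_atTop hα
  have h2 : Tendsto (fun N : ℕ => (β - α) * (N : ℝ)) atTop atTop :=
    tendsto_natCast_atTop_atTop.const_mul_atTop (sub_pos.2 hαβ)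
  filter_upwards [h1.eventually_ge_atTop 1, h2.eventually_ge_atTop 1] with N h3 h4
  refine ⟨(Nat.one_le_floor_iff _).2 h3, ?_⟩
  rw [← Nat.succ_le_iff, ← Nat.add_one, ← Nat.floor_add_one (by positivity)]
  exact Nat.floor_le_floor (by linarith)

theorem measurePreserving_sample {Ω : Type*} [MeasurableSpace Ω] {P : Measure Ω}
    [IsProbabilityMeasure P] {X : ℕ → Ω → ℝ} (hmeas : ∀ i, Measurable (X i))
    (hindep : iIndepFun X P) (hident : ∀ i, IdentDistrib (X i) (X 0) P P) (N : ℕ) :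
    MeasurePreserving (fun ω (i : Fin N) => X i ω) P (Measure.pi fun _ => P.map (X 0)) := by
  refine ⟨measurable_pi_lambda _ fun i => hmeas i, ?_⟩
  have h : iIndepFun (fun i : Fin N => X i) P := hindep.precomp Fin.val_injective
  rw [h.map_fun_eq_pi_map fun i : Fin N => (hmeas i).aemeasurable]
  congr 1
  funext i
  exact (hident i).map_eq

section

variable {Ω : Type*} [MeasurableSpace Ω] {P : Measure Ω} [IsProbabilityMeasure P]
  {X : ℕ → Ω → ℝ} {F f : ℝ → ℝ} {α β : ℝ}

/-- The diagonal kernels and the independent ones have limits with the same mass at the mixed pair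
of trimming points, so that these terms cancel. At a pair of equal trimming points the mass of the
diagonal kernel is twice that of the independent one, and one copy of the limit remains. -/
theorem tendsto_cube_mul_higherOrderSum (hmeas : ∀ i, Measurable (X i)) (hindep : iIndepFun X P)
    (hident : ∀ i, IdentDistrib (X i) (X 0) P P) (hF : ∀ x, F x = P.real {ω | X 0 ω ≤ x})
    (hα : 0 < α) (hαβ : α < β) (hβ : β < 1)
    (hfα : HasPosLipschitzDensityNear F f (quantile F α))
    (hfβ : HasPosLipschitzDensityNear F f (quantile F β))
    (hL2 : ∀ᶠ N : ℕ in atTop, MemLp (trimmedMeanRV X α β N) 2 P) :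
    Tendsto (fun N : ℕ => (N : ℝ) ^ 3 * higherOrderSum P X α β N) atTop
      (nhds (α ^ 2 * (1 - α) ^ 2 / f (quantile F α) ^ 2
        + β ^ 2 * (1 - β) ^ 2 / f (quantile F β) ^ 2)) := by
  set μ := P.map (X 0) with hμ
  have : IsProbabilityMeasure μ := Measure.isProbabilityMeasure_map (hmeas 0).aemeasurable
  have hF' : ∀ x, F x = μ.real (Set.Iic x) := fun x => by
    rw [hF, hμ, map_measureReal_apply (hmeas 0) measurableSet_Iic]; rfl
  have hsample : ∀ N, MeasurePreserving (fun ω (i : Fin N) => X i ω) P (Measure.pi fun _ => μ) :=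
    measurePreserving_sample hmeas hindep hident
  have hL2' : ∀ᶠ N : ℕ in atTop, MemLp (trimmedMean α β N) 2 (Measure.pi fun _ => μ) := by
    filter_upwards [hL2] with N hN
    rw [← (hsample N).map_eq, memLp_map_measure_iff
      (measurable_trimmedMean α β N).aestronglyMeasurable (hsample N).measurable.aemeasurable]
    exact hN
  have hfl := eventually_floor_lt hα hαβ
  -- A single sample size with a square integrable trimmed mean controls the tails of `F`.
  obtain ⟨N₀, ⟨-, hN₀⟩, hN₀'⟩ := (hfl.and hL2').exists
  have hint := integrable_cdf_mul_pow hF' hN₀ (floor_mul_le hβ.le N₀) hN₀'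
  have hmono := cdf_monotone hF'
  have hF1 : ∀ x, F x ∈ Set.Icc (0 : ℝ) 1 := fun x => ⟨cdf_nonneg hF' x, cdf_le_one hF' x⟩
  have hα1 : α < 1 := hαβ.trans hβ
  have hβ0 : 0 < β := hα.trans hαβ
  have hξα : F (quantile F α) = α := cdf_quantile hF' hα hα1 hfα.continuousAt
  have hξβ : F (quantile F β) = β := cdf_quantile hF' hβ0 hβ hfβ.continuousAt
  set ξα := quantile F α
  set ξβ := quantile F β
  set a : ℕ → ℕ := fun n => ⌊α * (n + 2 : ℕ)⌋₊ - 1 with ha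
  set m : ℕ → ℕ := fun n => ⌊β * (n + 2 : ℕ)⌋₊ - 1 with hm
  have hfl' : ∀ᶠ n : ℕ in atTop, a n + 1 = ⌊α * (n + 2 : ℕ)⌋₊ ∧ m n + 1 = ⌊β * (n + 2 : ℕ)⌋₊ ∧
      a n < m n := by
    filter_upwards [(tendsto_add_atTop_nat 2).eventually hfl] with n hn
    simp only [ha, hm]
    omega
  have hcα : ∀ᶠ n in atTop, |(a n : ℝ) - F ξα * n| ≤ 3 := Eventually.of_forall fun n => by
    rw [hξα]; exact abs_floor_pred_sub_le hα.le hα1.le n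
  have hcβ : ∀ᶠ n in atTop, |(m n : ℝ) - F ξβ * n| ≤ 3 := Eventually.of_forall fun n => by
    rw [hξβ]; exact abs_floor_pred_sub_le hβ0.le hβ.le n
  have hmn : ∀ᶠ n in atTop, m n ≤ n := by
    have h : Tendsto (fun n : ℕ => (1 - β) * (n : ℝ)) atTop atTop :=
      tendsto_natCast_atTop_atTop.const_mul_atTop (sub_pos.2 hβ)
    filter_upwards [h.eventually_ge_atTop 3, hcβ] with n h1 h2
    rw [hξβ] at h2
    have h3 := (abs_le.1 h2).2
    exact_mod_cast (by linarith : (m n : ℝ) ≤ n)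
  have han : ∀ᶠ n in atTop, a n ≤ n := by
    filter_upwards [hmn, hfl'] with n h1 h2
    omega
  have hα0' : 0 < F ξα := hξα.symm ▸ hα
  have hα1' : F ξα < 1 := hξα.symm ▸ hα1
  have hβ0' : 0 < F ξβ := hξβ.symm ▸ hβ0
  have hβ1' : F ξβ < 1 := hξβ.symm ▸ hβ
  -- The masses of the kernels on the unit square.
  have hFalse : ∀ {p q : ℕ → ℕ}, (∀ᶠ n in atTop, p n ≤ n) → (∀ᶠ n in atTop, q n ≤ n) →
      Tendsto (fun n : ℕ => (n : ℝ) ^ 2 * ∫ w in Set.Icc (0 : ℝ) 1 ×ˢ Set.Icc (0 : ℝ) 1,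
        levelKernel False n (p n) (q n) w.1 w.2) atTop (nhds 1) := fun hp hq => by
    refine tendsto_sq_div_add_one_sq.congr' ?_
    filter_upwards [hp, hq] with n h1 h2
    rw [integral_binomProb_mul_binomProb h1 h2]
  have hTrue : ∀ {p : ℕ → ℕ}, (∀ᶠ n in atTop, p n ≤ n) →
      Tendsto (fun n : ℕ => (n : ℝ) ^ 2 * ∫ w in Set.Icc (0 : ℝ) 1 ×ˢ Set.Icc (0 : ℝ) 1,
        levelKernel True n (p n) (p n) w.1 w.2) atTop (nhds 2) := fun hp => by
    have h := tendsto_sq_div_add_one_mul_add_two.const_mul 2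
    rw [mul_one] at h
    refine h.congr' ?_
    filter_upwards [hp] with n h1
    rw [integral_jointProb le_rfl h1, if_pos rfl]
    ring
  have hTrue' : Tendsto (fun n : ℕ => (n : ℝ) ^ 2 * ∫ w in Set.Icc (0 : ℝ) 1 ×ˢ Set.Icc (0 : ℝ) 1,
        levelKernel True n (a n) (m n) w.1 w.2) atTop (nhds 1) := by
    refine tendsto_sq_div_add_one_mul_add_two.congr' ?_
    filter_upwards [hmn, hfl'] with n h1 h2
    rw [integral_jointProb h2.2.2.le h1, if_neg h2.2.2.ne]
  have l1 := tendsto_kernelIntegral hmono hF1 hint hfβ hfβ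
    hβ0' hβ1' hβ0' hβ1' hcβ hcβ hmn hmn True two_pos (hTrue hmn)
  have l2 := tendsto_kernelIntegral hmono hF1 hint hfβ hfβ
    hβ0' hβ1' hβ0' hβ1' hcβ hcβ hmn hmn False one_pos (hFalse hmn hmn)
  have l3 := tendsto_kernelIntegral hmono hF1 hint hfα hfβ
    hα0' hα1' hβ0' hβ1' hcα hcβ han hmn True one_pos hTrue'
  have l4 := tendsto_kernelIntegral hmono hF1 hint hfα hfβ
    hα0' hα1' hβ0' hβ1' hcα hcβ han hmn False one_pos (hFalse han hmn)
  have l5 := tendsto_kernelIntegral hmono hF1 hint hfα hfα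
    hα0' hα1' hα0' hα1' hcα hcα han han True two_pos (hTrue han)
  have l6 := tendsto_kernelIntegral hmono hF1 hint hfα hfα
    hα0' hα1' hα0' hα1' hcα hcα han han False one_pos (hFalse han han)
  have hsum : ∀ᶠ n : ℕ in atTop, higherOrderSum P X α β (n + 2) = ((n + 2 : ℕ) : ℝ)⁻¹ *
      ((kernelIntegral F True n (m n) (m n) - kernelIntegral F False n (m n) (m n))
        - 2 * (kernelIntegral F True n (a n) (m n) - kernelIntegral F False n (a n) (m n))
        + (kernelIntegral F True n (a n) (a n) - kernelIntegral F False n (a n) (a n))) := by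
    filter_upwards [hfl', hmn, (tendsto_add_atTop_nat 2).eventually hL2',
      eventually_integrable_levelKernel hmono hF1 hint hβ0' hβ1' hβ0' hβ1' hcβ hcβ hmn hmn True,
      eventually_integrable_levelKernel hmono hF1 hint hβ0' hβ1' hβ0' hβ1' hcβ hcβ hmn hmn False,
      eventually_integrable_levelKernel hmono hF1 hint hα0' hα1' hβ0' hβ1' hcα hcβ han hmn True,
      eventually_integrable_levelKernel hmono hF1 hint hα0' hα1' hβ0' hβ1' hcα hcβ han hmn False,
      eventually_integrable_levelKernel hmono hF1 hint hβ0' hβ1' hα0' hα1' hcβ hcα hmn han True,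
      eventually_integrable_levelKernel hmono hF1 hint hβ0' hβ1' hα0' hα1' hcβ hcα hmn han False,
      eventually_integrable_levelKernel hmono hF1 hint hα0' hα1' hα0' hα1' hcα hcα han han True,
      eventually_integrable_levelKernel hmono hF1 hint hα0' hα1' hα0' hα1' hcα hcα han han False]
      with n ⟨h1, h2, h3⟩ h4 h5 i1 i2 i3 i4 i5 i6 i7 i8
    rw [higherOrderSum_eq_kernelIntegral hF' (hsample (n + 2)) hmeas h5 h2 h1 h3.le (by omega) ?_,
      kernelIntegral_comm F True n (m n) (a n), kernelIntegral_comm F False n (m n) (a n)]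
    · ring
    · intro p hp q hq
      simp only [Finset.mem_insert, Finset.mem_singleton] at hp hq
      rcases hp with rfl | rfl <;> rcases hq with rfl | rfl
      exacts [⟨i1, i2⟩, ⟨i5, i6⟩, ⟨i3, i4⟩, ⟨i7, i8⟩]
  have hratio : Tendsto (fun n : ℕ => ((n : ℝ) + 2) ^ 2 / (n : ℝ) ^ 2) atTop (nhds 1) := by
    have h := (tendsto_natCast_div_add_atTop (2 : ℝ)).inv₀ one_ne_zero
    refine ((h.mul h).congr fun n => ?_).trans (by simp)
    rw [inv_div]; ring
  have hmain := hratio.mul (((l1.sub l2).sub ((l3.sub l4).const_mul 2)).add (l5.sub l6))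
  rw [← tendsto_add_atTop_iff_nat 2]
  refine (hmain.congr' ?_).trans (le_of_eq ?_)
  · filter_upwards [hsum, eventually_gt_atTop 0] with n h1 h2
    have h3 : (n : ℝ) ≠ 0 := by positivity
    have h4 : ((n : ℝ) + 2) ≠ 0 := by positivity
    rw [h1]
    push_cast
    field_simp
  · congr 1
    rw [hξα, hξβ]
    simp only [covSq, min_self]
    ring

end

/-- A sequence of exact order `N⁻³` is asymptotic to a multiple of `N⁻³`, and not of the smaller
order `N ^ (-7/2)`. -/
theorem isLittleO_and_not_isBigO_of_tendsto {s : ℕ → ℝ} {L : ℝ} (hL : 0 < L)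
    (h : Tendsto (fun N : ℕ => (N : ℝ) ^ 3 * s N) atTop (nhds L)) :
    ((fun N : ℕ => s N - ((N : ℝ) ^ 3)⁻¹ * L) =o[atTop] fun N : ℕ => ((N : ℝ) ^ 3)⁻¹) ∧
      ¬ (s =O[atTop] fun N : ℕ => (N : ℝ) ^ (-(7 / 2) : ℝ)) := by
  constructor
  · rw [isLittleO_iff_tendsto']
    · have h1 := h.sub_const L
      rw [sub_self] at h1
      refine h1.congr' ?_
      filter_upwards [eventually_gt_atTop 0] with N hN
      have : (N : ℝ) ≠ 0 := by positivity
      field_simp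
    · filter_upwards [eventually_gt_atTop 0] with N hN h0
      have : ((N : ℝ) ^ 3)⁻¹ ≠ 0 := by positivity
      exact absurd h0 this
  · intro hO
    have h1 : Tendsto (fun N : ℕ => (N : ℝ) ^ 3 * (N : ℝ) ^ (-(7 / 2) : ℝ)) atTop (nhds 0) := by
      have h2 := (tendsto_rpow_neg_atTop (y := 1 / 2) (by norm_num)).comp
        (tendsto_natCast_atTop_atTop (R := ℝ))
      refine h2.congr' ?_
      filter_upwards [eventually_gt_atTop 0] with N hN
      have : (0 : ℝ) < N := by positivity
      simp only [Function.comp]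
      rw [← Real.rpow_natCast, ← Real.rpow_add this]
      norm_num
    have h3 := ((isBigO_refl (fun N : ℕ => (N : ℝ) ^ 3) atTop).mul hO).trans_tendsto h1
    exact hL.ne' (tendsto_nhds_unique h h3)

/-! ### Clipped samples -/


theorem HasPosLipschitzDensityNear.congr {F G f : ℝ → ℝ} {ξ a b : ℝ}
    (hf : HasPosLipschitzDensityNear F f ξ) (h : Set.EqOn G F (Set.Ioo a b))
    (hξ : ξ ∈ Set.Ioo a b) : HasPosLipschitzDensityNear G f ξ := by
  obtain ⟨hpos, ε, hε, K, hd, hl⟩ := hf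
  obtain ⟨δ, hδ, hsub⟩ := Metric.isOpen_iff.1 isOpen_Ioo ξ hξ
  refine ⟨hpos, min ε δ, lt_min hε hδ, K, fun x hx => ?_,
    hl.mono (Metric.ball_subset_ball (min_le_left _ _))⟩
  refine (hd x (Metric.ball_subset_ball (min_le_left _ _) hx)).congr_of_eventuallyEq ?_
  filter_upwards [isOpen_Ioo.mem_nhds (hsub (Metric.ball_subset_ball (min_le_right _ _) hx))]
    with y hy using h hy

/-- Quantiles are determined locally. -/
theorem quantile_congr {μ ν : Measure ℝ} [IsProbabilityMeasure μ] [IsProbabilityMeasure ν]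
    {F G : ℝ → ℝ} (hF : ∀ x, F x = μ.real (Set.Iic x)) (hG : ∀ x, G x = ν.real (Set.Iic x))
    {θ a b : ℝ} (h0 : 0 < θ) (h1 : θ < 1) (h : Set.EqOn G F (Set.Ioo a b))
    (hξ : quantile F θ ∈ Set.Ioo a b) : quantile G θ = quantile F θ := by
  apply le_antisymm
  · by_contra! hlt
    obtain ⟨x, hx, hx'⟩ := exists_between (lt_min hlt hξ.2)
    have h2 := le_of_quantile_lt hF h1 hx
    rw [← h ⟨hξ.1.trans hx, hx'.trans_le (min_le_right _ _)⟩] at h2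
    exact absurd (lt_of_lt_quantile hG h0 (hx'.trans_le (min_le_left _ _))) (not_lt.2 h2)
  · by_contra! hlt
    obtain ⟨x, hx, hx'⟩ := exists_between (max_lt hlt hξ.1)
    have h2 := lt_of_lt_quantile hF h0 hx'
    rw [← h ⟨(le_max_right _ _).trans_lt hx, hx'.trans hξ.2⟩] at h2
    exact absurd (le_of_quantile_lt hG h1 ((le_max_left _ _).trans_lt hx)) (not_le.2 h2)

theorem abs_trimmedMean_le {α β C : ℝ} {N : ℕ} {x : Fin N → ℝ} (hx : ∀ i, |x i| ≤ C) :
    |trimmedMean α β N x| ≤ (Real.sqrt N)⁻¹ * (N * C) := by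
  rw [trimmedMean, abs_mul, abs_of_nonneg (inv_nonneg.2 (Real.sqrt_nonneg _))]
  refine mul_le_mul_of_nonneg_left ?_ (inv_nonneg.2 (Real.sqrt_nonneg _))
  refine (Finset.abs_sum_le_sum_abs _ _).trans ?_
  refine (Finset.sum_le_sum_of_subset_of_nonneg (Finset.subset_univ _)
    fun _ _ _ => abs_nonneg _).trans ?_
  refine (Finset.sum_le_card_nsmul _ _ C fun i _ => hx _).trans (le_of_eq ?_)
  simp

theorem memLp_trimmedMeanRV_of_bounded {Ω : Type*} [MeasurableSpace Ω] {P : Measure Ω}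
    [IsFiniteMeasure P] {X : ℕ → Ω → ℝ} (hmeas : ∀ i, Measurable (X i)) {C : ℝ}
    (hC : ∀ i ω, |X i ω| ≤ C) (α β : ℝ) (N : ℕ) : MemLp (trimmedMeanRV X α β N) 2 P :=
  MemLp.of_bound
    ((measurable_trimmedMean α β N).comp
      (measurable_pi_lambda _ fun i : Fin N => hmeas i)).aestronglyMeasurable
    _ (Eventually.of_forall fun ω => abs_trimmedMean_le fun i : Fin N => hC i ω)

theorem clipped_le_iff {Ω : Type*} {X : ℕ → Ω → ℝ} {a b x : ℝ} (hx : x ∈ Set.Ioo a b) (i : ℕ)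
    (ω : Ω) : clipped X a b i ω ≤ x ↔ X i ω ≤ x := by
  simp [clipped, hx.1.le, hx.2]

theorem abs_clipped_le {Ω : Type*} (X : ℕ → Ω → ℝ) {a b : ℝ} (hab : a ≤ b) (i : ℕ) (ω : Ω) :
    |clipped X a b i ω| ≤ max |a| |b| :=
  abs_le_max_abs_abs (le_max_left _ _) (max_le hab (min_le_right _ _))

theorem lemmaA2 {Ω : Type*} [MeasurableSpace Ω] (P : Measure Ω) [IsProbabilityMeasure P]
    (X : ℕ → Ω → ℝ) (hmeas : ∀ i, Measurable (X i)) (hindep : iIndepFun X P)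
    (hident : ∀ i, IdentDistrib (X i) (X 0) P P)
    (F : ℝ → ℝ) (hF : ∀ x, F x = P.real {ω | X 0 ω ≤ x})
    (f : ℝ → ℝ) (α β : ℝ) (hα : 0 < α) (hαβ : α < β) (hβ : β < 1)
    (hfα : HasPosLipschitzDensityNear F f (quantile F α))
    (hfβ : HasPosLipschitzDensityNear F f (quantile F β)) :
    -- no moment assumption: the trimmed mean of the sample winsorized at distance `Δ`
    (∀ Δ : ℝ, 0 < Δ →
      ((fun N : ℕ =>
          higherOrderSum P (clipped X (quantile F α - Δ) (quantile F β + Δ)) α β N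
            - ((N : ℝ) ^ 3)⁻¹ * (α ^ 2 * (1 - α) ^ 2 / f (quantile F α) ^ 2
                + β ^ 2 * (1 - β) ^ 2 / f (quantile F β) ^ 2))
        =o[atTop] fun N : ℕ => ((N : ℝ) ^ 3)⁻¹) ∧
      ¬ ((fun N : ℕ =>
          higherOrderSum P (clipped X (quantile F α - Δ) (quantile F β + Δ)) α β N)
        =O[atTop] fun N : ℕ => (N : ℝ) ^ (-(7 / 2) : ℝ))) ∧
    -- the trimmed mean itself, as soon as its second moment exists
    ((∀ᶠ N : ℕ in atTop, MemLp (trimmedMeanRV X α β N) 2 P) →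
      ((fun N : ℕ =>
          higherOrderSum P X α β N
            - ((N : ℝ) ^ 3)⁻¹ * (α ^ 2 * (1 - α) ^ 2 / f (quantile F α) ^ 2
                + β ^ 2 * (1 - β) ^ 2 / f (quantile F β) ^ 2))
        =o[atTop] fun N : ℕ => ((N : ℝ) ^ 3)⁻¹) ∧
      ¬ ((fun N : ℕ => higherOrderSum P X α β N)
        =O[atTop] fun N : ℕ => (N : ℝ) ^ (-(7 / 2) : ℝ))) := by
  have hα1 : α < 1 := hαβ.trans hβ
  have hβ0 : 0 < β := hα.trans hαβ
  have hlim : 0 < α ^ 2 * (1 - α) ^ 2 / f (quantile F α) ^ 2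
      + β ^ 2 * (1 - β) ^ 2 / f (quantile F β) ^ 2 := by
    have h1 := hfα.1
    have h2 := hfβ.1
    have h3 := sub_pos.2 hα1
    have h4 := sub_pos.2 hβ
    positivity
  refine ⟨fun Δ hΔ => isLittleO_and_not_isBigO_of_tendsto hlim ?_, fun hL2 =>
    isLittleO_and_not_isBigO_of_tendsto hlim
      (tendsto_cube_mul_higherOrderSum hmeas hindep hident hF hα hαβ hβ hfα hfβ hL2)⟩
  set a := quantile F α - Δ with ha
  set b := quantile F β + Δ with hb
  have hg : Measurable fun x : ℝ => max a (min x b) :=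
    measurable_const.max (measurable_id.min measurable_const)
  have hmeas' : ∀ i, Measurable (clipped X a b i) := fun i => hg.comp (hmeas i)
  have hcdf : ∀ {Y : Ω → ℝ} {G : ℝ → ℝ}, Measurable Y → (∀ x, G x = P.real {ω | Y ω ≤ x}) →
      ∀ x, G x = (P.map Y).real (Set.Iic x) := fun hY hG x => by
    rw [hG, map_measureReal_apply hY measurableSet_Iic]; rfl
  have : IsProbabilityMeasure (P.map (X 0)) :=
    Measure.isProbabilityMeasure_map (hmeas 0).aemeasurable
  have : IsProbabilityMeasure (P.map (clipped X a b 0)) :=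
    Measure.isProbabilityMeasure_map (hmeas' 0).aemeasurable
  let G : ℝ → ℝ := fun x => P.real {ω | clipped X a b 0 ω ≤ x}
  have hG : ∀ x, G x = P.real {ω | clipped X a b 0 ω ≤ x} := fun _ => rfl
  have hGF : Set.EqOn G F (Set.Ioo a b) := fun x hx => by
    simp only [hG, hF, clipped_le_iff hx]
  have hle : quantile F α ≤ quantile F β :=
    quantile_mono (hcdf (hmeas 0) hF) hα hαβ.le hβ
  have hmα : quantile F α ∈ Set.Ioo a b := ⟨by linarith, by linarith⟩
  have hmβ : quantile F β ∈ Set.Ioo a b := ⟨by linarith, by linarith⟩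
  have hqα : quantile G α = quantile F α :=
    quantile_congr (hcdf (hmeas 0) hF) (hcdf (hmeas' 0) hG) hα hα1 hGF hmα
  have hqβ : quantile G β = quantile F β :=
    quantile_congr (hcdf (hmeas 0) hF) (hcdf (hmeas' 0) hG) hβ0 hβ hGF hmβ
  have h := tendsto_cube_mul_higherOrderSum (f := f) hmeas' (hindep.comp _ fun _ => hg)
    (fun i => (hident i).comp hg) hG hα hαβ hβ (hqα ▸ hfα.congr hGF hmα)
    (hqβ ▸ hfβ.congr hGF hmβ) (Eventually.of_forall fun N =>
      memLp_trimmedMeanRV_of_bounded hmeas'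
        (abs_clipped_le X (hmα.1.trans hmα.2).le) α β N)
  rwa [hqα, hqβ] at h

end
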